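/- For a point $p\in\mathbb{R}^3$ let $C(p)=\{x\in\mathbb{R}^3 : |x_i-p_i|\le 1/2 \text{ for } i=1,2,3\}$ be the closed axis-parallel unit cube centred at $p$. The model of computation is the deterministic real RAM with unit cost: exact real numbers with the operations $+,-,\times,\div$ and comparisons (no floor function or other conversion of reals to integers), integer words of $O(\log n)$ bits with the usual arithmetic and comparisons, indirect addressing, and (recursive) procedures. $\tilde O(n)$ means $O(n\log^{k} n)$ for some constant $k$. (1) There is an algorithm that, given finite point sets $P,Q,R\subset\mathbb{R}^3$ of total size $n$ (each set given by a list of its points in any order, repetitions allowed), decides in $\tilde O(n)$ time whether for every $(p,r)\in P\times R$ there is a $q\in Q$ such that $C(q)\cap C(p)\neq\emptyset$ and $C(q)\cap C(r)\neq\emptyset$. (2) Consequently, Diameter-2 for unit cubes in $\mathbb{R}^3$ can be solved in $\tilde O(n)$ time: there is an algorithm that, given $n$ points $p_1,\dots,p_n\in\mathbb{R}^3$, decides in $\tilde O(n)$ time whether the intersection graph of the cubes $C(p_1),\dots,C(p_n)$ (vertices $1,\dots,n$, with $i\neq j$ adjacent if and only if $C(p_i)\cap C(p_j)\neq\emptyset$)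 has diameter at most $2$, where a disconnected graph has infinite diameter. No general position of the points is assumed. -/

import Mathlib

/-! ### Unit cubes in three-dimensional space and their intersection graphs -/

/-- Points of `ℝ³`, given by their three coordinates. -/
abbrev Point3 : Type := Fin 3 → ℝ

/-- The closed axis-parallel cube of side length `1` centred at `p`. -/
def unitCube (p : Point3) : Set Point3 := {x | ∀ i, |x i - p i| ≤ 1 / 2}

/-- The intersection graph of the unit cubes centred at the points of a list: one vertex per entry,
two distinct vertices being adjacent iff their cubes intersect. -/
def unitCubeGraph (L : List Point3) : SimpleGraph (Fin L.length) where
  Adj i j := i ≠ j ∧ (unitCube (L.get i) ∩ unitCube (L.get j)).Nonempty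
  symm := ⟨fun i j h => ⟨h.1.symm, by rw [Set.inter_comm]; exact h.2⟩⟩
  loopless := ⟨fun _ h => h.1 rfl⟩

/-! ### The real RAM

A program works on integer registers, real registers, integer arrays and real arrays; it mentions
only finitely many registers and arrays, and the arrays are unbounded and addressed indirectly.
Integers are natural numbers at most `W` (words of `log₂ W` bits).  Real numbers are exact; the
operations on them are the four arithmetic operations and comparisons.  There is no rounding and
no other conversion between reals and integers.  Every elementary operation takes one step. -/

namespace RealRAM

/-- The contents of all registers and arrays. -/
structure State where
  /-- integer registers -/
  ireg : ℕ → ℕ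
  /-- real registers -/
  rreg : ℕ → ℝ
  /-- `imem k i` is the entry at address `i` of the integer array number `k` -/
  imem : ℕ → ℕ → ℕ
  /-- `rmem k i` is the entry at address `i` of the real array number `k` -/
  rmem : ℕ → ℕ → ℝ

/-- Arithmetic operations on integers. -/
inductive IntOp where
  | add | sub | mul | div

/-- Natural-number arithmetic; subtraction is truncated at `0`, division is rounded down. -/
def IntOp.eval : IntOp → ℕ → ℕ → ℕ
  | .add, a, b => a + b
  | .sub, a, b => a - b
  | .mul, a, b => a * b
  | .div, a, b => a / b

/-- Arithmetic operations on reals. -/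
inductive RealOp where
  | add | sub | mul | div

open Classical in
/-- Exact real arithmetic; division by zero is an error. -/
noncomputable def RealOp.eval : RealOp → ℝ → ℝ → Option ℝ
  | .add, a, b => some (a + b)
  | .sub, a, b => some (a - b)
  | .mul, a, b => some (a * b)
  | .div, a, b => if b = 0 then none else some (a / b)

/-- Elementary instructions. The arguments `d`, `a`, `b` are numbers of registers, and `k` is the
number of an array. -/
inductive Instr where
  /-- integer register `d` receives the constant `c` -/
  | iconst (d c : ℕ)
  /-- integer register `d` receives the result of an operation on integer registers `a`, `b` -/
  | iarith (o : IntOp) (d a b : ℕ)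
  /-- integer register `d` receives the entry of integer array `k` whose address is in integer
  register `a` -/
  | iload (d k a : ℕ)
  /-- the entry of integer array `k` whose address is in integer register `a` receives the content
  of integer register `b` -/
  | istore (k a b : ℕ)
  /-- real register `d` receives the rational constant `c` -/
  | rconst (d : ℕ) (c : ℚ)
  /-- real register `d` receives the result of an operation on real registers `a`, `b` -/
  | rarith (o : RealOp) (d a b : ℕ)
  /-- real register `d` receives the entry of real array `k` whose address is in integer
  register `a` -/
  | rload (d k a : ℕ)
  /-- the entry of real array `k` whose address is in integer register `a` receives the content
  of real register `b` -/
  | rstore (k a b : ℕ)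

/-- The effect of an instruction, with word bound `W`. The value `none` is a run-time error: an
integer larger than `W`, or a real division by zero. -/
noncomputable def Instr.exec (W : ℕ) : Instr → State → Option State
  | .iconst d c, s =>
      if c ≤ W then some { s with ireg := Function.update s.ireg d c } else none
  | .iarith o d a b, s =>
      let v := o.eval (s.ireg a) (s.ireg b)
      if v ≤ W then some { s with ireg := Function.update s.ireg d v } else none
  | .iload d k a, s =>
      some { s with ireg := Function.update s.ireg d (s.imem k (s.ireg a)) }
  | .istore k a b, s =>
      some { s with
        imem := Function.update s.imem k
          (Function.update (s.imem k) (s.ireg a) (s.ireg b)) }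
  | .rconst d c, s =>
      some { s with rreg := Function.update s.rreg d (c : ℝ) }
  | .rarith o d a b, s =>
      (o.eval (s.rreg a) (s.rreg b)).map
        fun v => { s with rreg := Function.update s.rreg d v }
  | .rload d k a, s =>
      some { s with rreg := Function.update s.rreg d (s.rmem k (s.ireg a)) }
  | .rstore k a b, s =>
      some { s with
        rmem := Function.update s.rmem k
          (Function.update (s.rmem k) (s.ireg a) (s.rreg b)) }

/-- Tests: comparisons of two integer registers or of two real registers. -/
inductive Test where
  | ilt (a b : ℕ)
  | ieq (a b : ℕ)
  | rlt (a b : ℕ)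
  | req (a b : ℕ)

/-- The outcome of a test. -/
def Test.Holds : Test → State → Prop
  | .ilt a b, s => s.ireg a < s.ireg b
  | .ieq a b, s => s.ireg a = s.ireg b
  | .rlt a b, s => s.rreg a < s.rreg b
  | .req a b, s => s.rreg a = s.rreg b

/-- Commands: elementary instructions, sequencing, branching, while loops, and calls of the
(possibly recursive) procedures of the program by their number. -/
inductive Cmd where
  | skip
  | instr (i : Instr)
  | seq (c₁ c₂ : Cmd)
  | ite (b : Test) (c₁ c₂ : Cmd)
  | loop (b : Test) (c : Cmd)
  | call (f : ℕ)

/-- `Exec W procs c s s' t`: started in state `s`, the command `c` halts without error after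
exactly `t` steps, in state `s'`. Registers are local to a procedure: a called procedure starts
with a copy of the registers of its caller, which get their old values back when the procedure
returns (on a machine: the finitely many registers of the program are saved on a stack). The arrays
are global. -/
inductive Exec (W : ℕ) (procs : List Cmd) : Cmd → State → State → ℕ → Prop where
  | skip (s : State) : Exec W procs .skip s s 1
  | instr {i : Instr} {s s' : State} (h : i.exec W s = some s') :
      Exec W procs (.instr i) s s' 1
  | seq {c₁ c₂ : Cmd} {s s' s'' : State} {t₁ t₂ : ℕ}
      (h₁ : Exec W procs c₁ s s' t₁) (h₂ : Exec W procs c₂ s' s'' t₂) :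
      Exec W procs (.seq c₁ c₂) s s'' (t₁ + t₂)
  | ite_true {b : Test} {c₁ c₂ : Cmd} {s s' : State} {t : ℕ}
      (hb : b.Holds s) (h : Exec W procs c₁ s s' t) :
      Exec W procs (.ite b c₁ c₂) s s' (t + 1)
  | ite_false {b : Test} {c₁ c₂ : Cmd} {s s' : State} {t : ℕ}
      (hb : ¬ b.Holds s) (h : Exec W procs c₂ s s' t) :
      Exec W procs (.ite b c₁ c₂) s s' (t + 1)
  | loop_done {b : Test} {c : Cmd} {s : State} (hb : ¬ b.Holds s) :
      Exec W procs (.loop b c) s s 1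
  | loop_step {b : Test} {c : Cmd} {s s' s'' : State} {t₁ t₂ : ℕ}
      (hb : b.Holds s) (h₁ : Exec W procs c s s' t₁)
      (h₂ : Exec W procs (.loop b c) s' s'' t₂) :
      Exec W procs (.loop b c) s s'' (t₁ + t₂ + 1)
  | call {f : ℕ} {c : Cmd} {s s' : State} {t : ℕ}
      (hf : procs[f]? = some c) (h : Exec W procs c s s' t) :
      Exec W procs (.call f) s { s' with ireg := s.ireg, rreg := s.rreg } (t + 1)

/-- The machine is deterministic: the final state and the number of steps are determined by the
command and the initial state. -/
theorem Exec.deterministic {W : ℕ} {procs : List Cmd} {c : Cmd} {s s₁ s₂ : State} {t₁ t₂ : ℕ}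
    (h₁ : Exec W procs c s s₁ t₁) (h₂ : Exec W procs c s s₂ t₂) : s₁ = s₂ ∧ t₁ = t₂ := by
  induction h₁ generalizing s₂ t₂ with
  | skip s => cases h₂; exact ⟨rfl, rfl⟩
  | instr h =>
    cases h₂ with
    | instr h' => exact ⟨Option.some.inj (h.symm.trans h'), rfl⟩
  | seq _ _ ih₁ ih₂ =>
    cases h₂ with
    | seq g₁ g₂ =>
      obtain ⟨rfl, rfl⟩ := ih₁ g₁
      obtain ⟨rfl, rfl⟩ := ih₂ g₂
      exact ⟨rfl, rfl⟩
  | ite_true hb _ ih =>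
    cases h₂ with
    | ite_true _ g => obtain ⟨rfl, rfl⟩ := ih g; exact ⟨rfl, rfl⟩
    | ite_false hb' _ => exact absurd hb hb'
  | ite_false hb _ ih =>
    cases h₂ with
    | ite_true hb' _ => exact absurd hb' hb
    | ite_false _ g => obtain ⟨rfl, rfl⟩ := ih g; exact ⟨rfl, rfl⟩
  | loop_done hb =>
    cases h₂ with
    | loop_done _ => exact ⟨rfl, rfl⟩
    | loop_step hb' _ _ => exact absurd hb' hb
  | loop_step hb _ _ ih₁ ih₂ =>
    cases h₂ with
    | loop_done hb' => exact absurd hb hb'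
    | loop_step _ g₁ g₂ =>
      obtain ⟨rfl, rfl⟩ := ih₁ g₁
      obtain ⟨rfl, rfl⟩ := ih₂ g₂
      exact ⟨rfl, rfl⟩
  | call hf _ ih =>
    cases h₂ with
    | call hf' g =>
      obtain rfl := Option.some.inj (hf.symm.trans hf')
      obtain ⟨rfl, rfl⟩ := ih g
      exact ⟨rfl, rfl⟩

/-- A program: a finite list of procedures, and the command at which the execution starts. -/
structure Program where
  procs : List Cmd
  main : Cmd

/-- The initial state for an input that consists of several lists of points. Integer register `m`
holds the length of list number `m`, and the real array number `3 * m + j` (`j = 0, 1, 2`) holds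
the `j`-th coordinates of the points of list number `m`, in their order. Everything else is `0`. -/
noncomputable def inputState (Ls : List (List Point3)) : State where
  ireg m := (Ls.getD m []).length
  rreg _ := 0
  imem _ _ := 0
  rmem k i := ((Ls.getD (k / 3) []).getD i 0) (Fin.ofNat 3 k)

/-- A decision problem with instances `x : ι`, of size `size x` and given to the machine as the
lists of points `input x`, is solvable in near-linear time, that is in time `Õ(n)` for instances of
size `n`: one program, running with integers of `O(log n)` bits, answers every instance correctly
(`1` for yes, `0` for no, in integer register `0`) within `C (n + 1) (log (n + 2)) ^ k` steps.
(The shifts by `1` and `2` only matter for `n ≤ 1`.) -/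
def SolvableInNearLinearTime {ι : Type} (size : ι → ℕ) (input : ι → List (List Point3))
    (yes : ι → Prop) : Prop :=
  ∃ (prog : Program) (K k : ℕ) (C : ℝ), ∀ x : ι, ∃ (s' : State) (t : ℕ),
    Exec ((size x + 2) ^ K) prog.procs prog.main (inputState (input x)) s' t ∧
    (t : ℝ) ≤ C * ((size x : ℝ) + 1) * Real.log ((size x : ℝ) + 2) ^ k ∧
    (yes x → s'.ireg 0 = 1) ∧ (¬ yes x → s'.ireg 0 = 0)

end RealRAM

/-!
Cubes `C(p)` and `C(q)` meet iff `p` and `q` differ by at most `1` in every coordinate, so the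
question is whether some pair `(p, r)` is *bad*: no `q` is within distance `1` of both `p` and `r` in
every coordinate. A graph has diameter at most `2` iff every two vertices, equal or not, have a
vertex that is equal or adjacent to both (`unitCubeGraph_ediam_le_two_iff`), so the second problem
is the first one for `P = Q = R`.

After a change of signs of the coordinates (eight cases, `exists_signs`), only pairs with `p ≤ r`
coordinatewise matter. For them `q` has to lie in the box from `r - 1` to `p + 1`. The corners of
these boxes are not independent: in each coordinate let `o` be the largest number `r - 1`. If some
`p + 1` is smaller than `o`, then a pair is so far apart that it is bad. Otherwise the point `o`
lies in all the boxes, including those of all other pairs. It splits space into eight octants. In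
the octant in which a point `q` lies, only three of the six constraints of a box matter, one in each
coordinate, and at least two of these three come from the same corner, say from `p`
(`mem_box_iff`). The box is free of points of that octant iff the third constraint, which
comes from `r`, fails for the point of the octant that satisfies the two constraints from
`p` and is extremal in the third coordinate. (If all three come from the same corner, a dummy
coordinate, in which everything is `0`, takes the part of the third one.) This extremal value
depends on `p` alone, so it can be tabulated, and emptiness of the box becomes one comparison
between a number that depends on `p` and one that depends on `r` for each octant
(`box_empty_iff`). Together with `p ≤ r` these are eleven comparisons, so that a bad pair is a dominating pair in dimension eleven.

Both steps are dominance maxima: for every query the largest value of an item that is smaller in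
each of `d` dimensions (`domMax_runs`). For this every item leaves its value at all combinations of
ancestors of its keys in `d` binary tries, and a query looks at all combinations of left siblings
of ancestors of its keys. That works because `x < y` iff an ancestor of the leaf `x` is the left
sibling of an ancestor of the leaf `y` (`lt_iff_exists_leftSibling`). A combination of trie nodes is
an address below a power of the number of points, hence a word, and unused entries are zero. This
takes `O(n (log n) ^ d)` steps. The coordinates are first replaced by their ranks, with ties broken
in favour of the closed inequalities by the order of the numbers in the array (`Ranked.of_cnt`);
the ranks come from merging by binary search (`rankLoop_runs`).

The programs are built from expressions and counting loops, whose correctness and running time are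
treated by the rules for `Runs`. There is no branching except in one comparison of reals: the
maximum of integers is `a + (b - a)`, and the truth value of `a ≤ b` is `1 - (a - b)`, with truncated
subtraction.
-/

namespace RealRAM

/-! ### Expressions, memories and a total-correctness calculus for programs -/

/-- Integer expressions: constants, registers, arithmetic, and entries of integer arrays. -/
inductive IExp where
  | const (n : ℕ)
  | reg (r : ℕ)
  | bin (o : IntOp) (a b : IExp)
  | get (k : ℕ) (a : IExp)

namespace IExp

instance : Add IExp := ⟨bin .add⟩
instance : Sub IExp := ⟨bin .sub⟩
instance : Mul IExp := ⟨bin .mul⟩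
instance : Div IExp := ⟨bin .div⟩

end IExp

/-- The part of a machine state that programs built from expressions care about: the real registers
and the integer registers from `200` on only hold intermediate results. -/
structure Mem where
  /-- integer registers -/
  reg : ℕ → ℕ
  /-- integer arrays -/
  int : ℕ → ℕ → ℕ
  /-- real arrays -/
  real : ℕ → ℕ → ℝ

/-- A machine state realises a memory: they agree up to the registers for intermediate results. -/
def Sim (s : State) (σ : Mem) : Prop :=
  (∀ r < 200, s.ireg r = σ.reg r) ∧ s.imem = σ.int ∧ s.rmem = σ.real

namespace Mem

/-- Assignment to a register. -/
def set (σ : Mem) (x v : ℕ) : Mem := { σ with reg := Function.update σ.reg x v }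

/-- Assignment to an entry of an integer array. -/
def setInt (σ : Mem) (k a v : ℕ) : Mem :=
  { σ with int := Function.update σ.int k (Function.update (σ.int k) a v) }

/-- Assignment to an entry of a real array. -/
def setReal (σ : Mem) (k a : ℕ) (v : ℝ) : Mem :=
  { σ with real := Function.update σ.real k (Function.update (σ.real k) a v) }

variable (σ : Mem) (x v k a y : ℕ) (w : ℝ)

@[simp] theorem set_reg : (σ.set x v).reg y = if y = x then v else σ.reg y := by
  simp [set, Function.update_apply]
@[simp] theorem set_int : (σ.set x v).int = σ.int := rfl
@[simp] theorem set_real : (σ.set x v).real = σ.real := rfl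
@[simp] theorem setInt_reg : (σ.setInt k a v).reg = σ.reg := rfl
@[simp] theorem setInt_real : (σ.setInt k a v).real = σ.real := rfl
@[simp] theorem setInt_int (b : ℕ) :
    (σ.setInt k a v).int y b = if y = k ∧ b = a then v else σ.int y b := by
  simp only [setInt, Function.update_apply]
  split_ifs <;> simp_all
@[simp] theorem setReal_reg : (σ.setReal k a w).reg = σ.reg := rfl
@[simp] theorem setReal_real (b : ℕ) :
    (σ.setReal k a w).real y b = if y = k ∧ b = a then w else σ.real y b := by
  simp only [setReal, Function.update_apply]
  split_ifs <;> simp_all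

end Mem

namespace IExp

/-- The value of an expression. -/
def eval : IExp → Mem → ℕ
  | const n, _ => n
  | reg r, σ => σ.reg r
  | bin o a b, σ => o.eval (a.eval σ) (b.eval σ)
  | get k a, σ => σ.int k (a.eval σ)

/-- The evaluation of an expression mentions no register reserved for intermediate results, and
respects the word bound `W`. -/
def ok (W : ℕ) : IExp → Mem → Prop
  | const n, _ => n ≤ W
  | reg r, σ => r < 200 ∧ σ.reg r ≤ W
  | bin o a b, σ => a.ok W σ ∧ b.ok W σ ∧ o.eval (a.eval σ) (b.eval σ) ≤ W
  | get _ a, σ => a.ok W σ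

/-- The number of steps spent on the evaluation of an expression. -/
def size : IExp → ℕ
  | const _ => 1
  | reg _ => 2
  | bin _ a b => a.size + b.size + 1
  | get _ a => a.size + 1

/-- The code that evaluates an expression into register `d`; the registers from `m` on are used
for intermediate results. -/
def code : IExp → ℕ → ℕ → Cmd
  | const n, d, _ => .instr (.iconst d n)
  | reg r, d, m => .seq (.instr (.iconst m 0)) (.instr (.iarith .add d r m))
  | bin o a b, d, m =>
      .seq (.seq (a.code m (m + 1)) (b.code (m + 1) (m + 2))) (.instr (.iarith o d m (m + 1)))
  | get k a, d, m => .seq (a.code m (m + 1)) (.instr (.iload d k m))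

variable (a b : IExp) (σ : Mem) (W : ℕ)

@[simp] theorem eval_const (n : ℕ) : (const n).eval σ = n := rfl
@[simp] theorem eval_reg (r : ℕ) : (reg r).eval σ = σ.reg r := rfl
@[simp] theorem eval_get (k : ℕ) : (get k a).eval σ = σ.int k (a.eval σ) := rfl
@[simp] theorem eval_add : (a + b).eval σ = a.eval σ + b.eval σ := rfl
@[simp] theorem eval_sub : (a - b).eval σ = a.eval σ - b.eval σ := rfl
@[simp] theorem eval_mul : (a * b).eval σ = a.eval σ * b.eval σ := rfl
@[simp] theorem eval_div : (a / b).eval σ = a.eval σ / b.eval σ := rfl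
@[simp] theorem ok_const (n : ℕ) : (const n).ok W σ ↔ n ≤ W := Iff.rfl
@[simp] theorem ok_reg (r : ℕ) : (reg r).ok W σ ↔ r < 200 ∧ σ.reg r ≤ W := Iff.rfl
@[simp] theorem ok_get (k : ℕ) : (get k a).ok W σ ↔ a.ok W σ := Iff.rfl
@[simp] theorem ok_add :
    (a + b).ok W σ ↔ a.ok W σ ∧ b.ok W σ ∧ a.eval σ + b.eval σ ≤ W := Iff.rfl
@[simp] theorem ok_sub :
    (a - b).ok W σ ↔ a.ok W σ ∧ b.ok W σ ∧ a.eval σ - b.eval σ ≤ W := Iff.rfl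
@[simp] theorem ok_mul :
    (a * b).ok W σ ↔ a.ok W σ ∧ b.ok W σ ∧ a.eval σ * b.eval σ ≤ W := Iff.rfl
@[simp] theorem ok_div :
    (a / b).ok W σ ↔ a.ok W σ ∧ b.ok W σ ∧ a.eval σ / b.eval σ ≤ W := Iff.rfl
@[simp] theorem size_const (n : ℕ) : (const n).size = 1 := rfl
@[simp] theorem size_reg (r : ℕ) : (reg r).size = 2 := rfl
@[simp] theorem size_get (k : ℕ) : (get k a).size = a.size + 1 := rfl
@[simp] theorem size_add : (a + b).size = a.size + b.size + 1 := rfl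
@[simp] theorem size_sub : (a - b).size = a.size + b.size + 1 := rfl
@[simp] theorem size_mul : (a * b).size = a.size + b.size + 1 := rfl
@[simp] theorem size_div : (a / b).size = a.size + b.size + 1 := rfl

/-- The code of an expression is correct: it leaves alone all registers below `m` except `d`, and
the registers it uses for intermediate results are not among those that the expression reads. -/
theorem exec_code {W : ℕ} {procs : List Cmd} (e : IExp) {d m : ℕ} (hm : 200 ≤ m)
    {s : State} {σ : Mem} (hs : Sim s σ) (hok : e.ok W σ) :
    ∃ s', Exec W procs (e.code d m) s s' e.size ∧ s'.ireg d = e.eval σ ∧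
      (∀ r < m, r ≠ d → s'.ireg r = s.ireg r) ∧
      s'.imem = s.imem ∧ s'.rmem = s.rmem ∧ s'.rreg = s.rreg := by
  induction e generalizing d m s with
  | const n =>
    refine ⟨_, .instr (s' := { s with ireg := Function.update s.ireg d n }) ?_, ?_⟩
    · have : n ≤ W := hok
      simp [Instr.exec, this]
    · simp +contextual
  | reg r =>
    obtain ⟨h1, h2⟩ := hok
    have h3 := hs.1 r h1
    have hrm : r ≠ m := by omega
    refine ⟨_, .seq (.instr (s' := { s with ireg := Function.update s.ireg m 0 }) ?_)
      (.instr (s' := { s with ireg := Function.update (Function.update s.ireg m 0) d (σ.reg r) })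
        ?_), ?_⟩
    · simp [Instr.exec]
    · simp [Instr.exec, IntOp.eval, Function.update_of_ne hrm, h3, h2]
    · simp +contextual [Function.update_apply]
      omega
  | bin o a b iha ihb =>
    obtain ⟨h1, h2, h3⟩ := hok
    obtain ⟨s1, e1, v1, f1, i1, r1, q1⟩ := iha (d := m) (m := m + 1) (by omega) hs h1
    have hs1 : Sim s1 σ := ⟨fun r hr => (f1 r (by omega) (by omega)).trans (hs.1 r hr),
      i1.trans hs.2.1, r1.trans hs.2.2⟩
    obtain ⟨s2, e2, v2, f2, i2, r2, q2⟩ := ihb (d := m + 1) (m := m + 2) (by omega) hs1 h2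
    refine ⟨_, .seq (.seq e1 e2) (.instr (s' := { s2 with
      ireg := Function.update s2.ireg d (o.eval (a.eval σ) (b.eval σ)) }) ?_), ?_⟩
    · have : s2.ireg m = a.eval σ := (f2 m (by omega) (by omega)).trans v1
      simp [Instr.exec, v2, this, h3]
    · refine ⟨by simp [IExp.eval], fun r hr hd => ?_, i2.trans i1, r2.trans r1, q2.trans q1⟩
      simp only [Function.update_of_ne hd]
      rw [f2 r (by omega) (by omega), f1 r (by omega) (by omega)]
  | get k a iha =>
    obtain ⟨s1, e1, v1, f1, i1, r1, q1⟩ := iha (d := m) (m := m + 1) (by omega) hs hok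
    refine ⟨_, .seq e1 (.instr rfl), ?_⟩
    refine ⟨by simp [v1, i1, hs.2.1, IExp.eval], fun r hr hd => ?_, i1, r1, q1⟩
    simp only [Function.update_of_ne hd]
    rw [f1 r (by omega) (by omega)]

end IExp

/-- What a command may write: registers, integer arrays, real arrays. -/
inductive Loc where
  | reg (r : ℕ)
  | int (k : ℕ)
  | real (k : ℕ)

/-- The locations, other than registers for intermediate results, that occur in a command as
destinations. -/
def Cmd.writes : Cmd → Loc → Prop
  | .skip, _ => False
  | .instr (.iconst d _), l => l = .reg d ∧ d < 200
  | .instr (.iarith _ d _ _), l => l = .reg d ∧ d < 200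
  | .instr (.iload d _ _), l => l = .reg d ∧ d < 200
  | .instr (.istore k _ _), l => l = .int k
  | .instr (.rstore k _ _), l => l = .real k
  | .instr _, _ => False
  | .seq c₁ c₂, l => c₁.writes l ∨ c₂.writes l
  | .ite _ c₁ c₂, l => c₁.writes l ∨ c₂.writes l
  | .loop _ c, l => c.writes l
  | .call _, _ => True

/-- Two memories agree on everything that the command `c` does not write. -/
def Frame (c : Cmd) (σ σ' : Mem) : Prop :=
  (∀ r < 200, ¬ c.writes (.reg r) → σ'.reg r = σ.reg r) ∧
  (∀ k, ¬ c.writes (.int k) → σ'.int k = σ.int k) ∧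
  (∀ k, ¬ c.writes (.real k) → σ'.real k = σ.real k)

theorem Frame.trans {c : Cmd} {σ₁ σ₂ σ₃ : Mem} (h : Frame c σ₁ σ₂) (h' : Frame c σ₂ σ₃) :
    Frame c σ₁ σ₃ :=
  ⟨fun r h1 h2 => (h'.1 r h1 h2).trans (h.1 r h1 h2),
    fun k h1 => (h'.2.1 k h1).trans (h.2.1 k h1), fun k h1 => (h'.2.2 k h1).trans (h.2.2 k h1)⟩

theorem Frame.mono {c c' : Cmd} {σ₁ σ₂ : Mem} (h : Frame c σ₁ σ₂)
    (hc : ∀ l, c.writes l → c'.writes l) : Frame c' σ₁ σ₂ :=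
  ⟨fun r h1 h2 => h.1 r h1 fun h3 => h2 (hc _ h3), fun k h1 => h.2.1 k fun h3 => h1 (hc _ h3),
    fun k h1 => h.2.2 k fun h3 => h1 (hc _ h3)⟩

/-- Programs change only what they mention as a destination. A call counts as writing everything. -/
theorem Exec.frame {W : ℕ} {procs : List Cmd} {c : Cmd} {s s' : State} {t : ℕ}
    (h : Exec W procs c s s' t) :
    (∀ r < 200, ¬ c.writes (.reg r) → s'.ireg r = s.ireg r) ∧
    (∀ k, ¬ c.writes (.int k) → s'.imem k = s.imem k) ∧
    (∀ k, ¬ c.writes (.real k) → s'.rmem k = s.rmem k) := by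
  induction h with
  | skip s => simp
  | @instr i s s' h =>
    cases i with
    | iconst d c =>
      simp only [Instr.exec] at h
      split_ifs at h
      cases h
      simp only [Cmd.writes]
      refine ⟨fun r hr h => Function.update_of_ne (fun h' => h ?_) _ _, by simp, by simp⟩
      subst h'; exact ⟨rfl, hr⟩
    | iarith o d a b =>
      simp only [Instr.exec] at h
      split_ifs at h
      cases h
      simp only [Cmd.writes]
      refine ⟨fun r hr h => Function.update_of_ne (fun h' => h ?_) _ _, by simp, by simp⟩
      subst h'; exact ⟨rfl, hr⟩
    | iload d k a =>
      cases h
      simp only [Cmd.writes]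
      refine ⟨fun r hr h => Function.update_of_ne (fun h' => h ?_) _ _, by simp, by simp⟩
      subst h'; exact ⟨rfl, hr⟩
    | istore k a b =>
      cases h
      simp only [Cmd.writes]
      refine ⟨by simp, fun r h => Function.update_of_ne (fun h' => h ?_) _ _, by simp⟩
      subst h'; rfl
    | rconst d c => cases h; simp
    | rarith o d a b =>
      simp only [Instr.exec, Option.map_eq_some_iff] at h
      obtain ⟨v, -, rfl⟩ := h
      simp
    | rload d k a => cases h; simp
    | rstore k a b =>
      cases h
      simp only [Cmd.writes]
      refine ⟨by simp, by simp, fun r h => Function.update_of_ne (fun h' => h ?_) _ _⟩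
      subst h'; rfl
  | seq _ _ ih₁ ih₂ =>
    simp only [Cmd.writes, not_or]
    exact ⟨fun r h1 h2 => (ih₂.1 r h1 h2.2).trans (ih₁.1 r h1 h2.1),
      fun k h2 => (ih₂.2.1 k h2.2).trans (ih₁.2.1 k h2.1),
      fun k h2 => (ih₂.2.2 k h2.2).trans (ih₁.2.2 k h2.1)⟩
  | ite_true _ _ ih =>
    simp only [Cmd.writes, not_or]
    exact ⟨fun r h1 h2 => ih.1 r h1 h2.1, fun k h2 => ih.2.1 k h2.1, fun k h2 => ih.2.2 k h2.1⟩
  | ite_false _ _ ih =>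
    simp only [Cmd.writes, not_or]
    exact ⟨fun r h1 h2 => ih.1 r h1 h2.2, fun k h2 => ih.2.1 k h2.2, fun k h2 => ih.2.2 k h2.2⟩
  | loop_done _ => simp
  | loop_step _ _ _ ih₁ ih₂ =>
    simp only [Cmd.writes] at *
    exact ⟨fun r h1 h2 => (ih₂.1 r h1 h2).trans (ih₁.1 r h1 h2),
      fun k h2 => (ih₂.2.1 k h2).trans (ih₁.2.1 k h2),
      fun k h2 => (ih₂.2.2 k h2).trans (ih₁.2.2 k h2)⟩
  | call _ _ _ => simp [Cmd.writes]

/-- Total correctness with a time bound: started in any state realising `σ`, the command `c` halts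
within `T` steps without error in a state realising a memory that satisfies `Q`. -/
def Runs (W : ℕ) (c : Cmd) (σ : Mem) (T : ℕ) (Q : Mem → Prop) : Prop :=
  ∀ s, Sim s σ → ∃ s' t σ', Exec W [] c s s' t ∧ t ≤ T ∧ Sim s' σ' ∧ Q σ'

section Rules

variable {W : ℕ} {σ : Mem} {T T₁ T₂ : ℕ} {Q Q₁ : Mem → Prop} {c c₁ c₂ : Cmd}

theorem Runs.mono (h : Runs W c σ T₁ Q₁) (hT : T₁ ≤ T) (hQ : ∀ σ', Q₁ σ' → Q σ') :
    Runs W c σ T Q := fun s hs =>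
  let ⟨s', t, σ', h1, h2, h3, h4⟩ := h s hs
  ⟨s', t, σ', h1, h2.trans hT, h3, hQ _ h4⟩

/-- A command leaves alone what it does not write. -/
theorem Runs.frame (h : Runs W c σ T Q) : Runs W c σ T fun σ' => Q σ' ∧ Frame c σ σ' := by
  intro s hs
  obtain ⟨s', t, σ', h1, h2, h3, h4⟩ := h s hs
  obtain ⟨f1, f2, f3⟩ := h1.frame
  refine ⟨s', t, σ', h1, h2, h3, h4, fun r hr hw => ?_, fun k hw => ?_, fun k hw => ?_⟩
  · rw [← h3.1 r hr, ← hs.1 r hr, f1 r hr hw]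
  · rw [← h3.2.1, ← hs.2.1, f2 k hw]
  · rw [← h3.2.2, ← hs.2.2, f3 k hw]

theorem Runs.seq (h₁ : Runs W c₁ σ T₁ Q₁)
    (h₂ : ∀ σ', Q₁ σ' → Frame c₁ σ σ' → Runs W c₂ σ' T₂ Q) :
    Runs W (.seq c₁ c₂) σ (T₁ + T₂) Q := by
  intro s hs
  obtain ⟨s1, t1, σ1, e1, b1, m1, q1, f1⟩ := h₁.frame s hs
  obtain ⟨s2, t2, σ2, e2, b2, m2, q2⟩ := h₂ σ1 q1 f1 s1 m1
  exact ⟨s2, _, σ2, .seq e1 e2, by omega, m2, q2⟩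

theorem Runs.skip (h : Q σ) : Runs W .skip σ 1 Q := fun s hs => ⟨s, 1, σ, .skip s, le_rfl, hs, h⟩

/-- `assign x e` assigns the value of the expression `e` to register `x`. -/
def assign (x : ℕ) (e : IExp) : Cmd := e.code x 200

theorem IExp.writes_code (e : IExp) {d m : ℕ} (hm : 200 ≤ m) (l : Loc) :
    (e.code d m).writes l ↔ l = .reg d ∧ d < 200 := by
  induction e generalizing d m with
  | const n => rfl
  | reg r => simp [code, Cmd.writes, show ¬ m < 200 by omega]
  | bin o a b iha ihb =>
    simp [code, Cmd.writes, iha, ihb, show ¬ m < 200 by omega,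
      show ¬ m + 1 < 200 by omega, show 200 ≤ m + 1 by omega, show 200 ≤ m + 2 by omega]
  | get k a iha =>
    simp [code, Cmd.writes, iha, show ¬ m < 200 by omega, show 200 ≤ m + 1 by omega]

@[simp] theorem writes_assign (x : ℕ) (e : IExp) (l : Loc) :
    (assign x e).writes l ↔ l = .reg x ∧ x < 200 := e.writes_code le_rfl l

@[simp] theorem writes_seq (l : Loc) :
    (Cmd.seq c₁ c₂).writes l ↔ c₁.writes l ∨ c₂.writes l := Iff.rfl

@[simp] theorem writes_skip (l : Loc) : ¬ Cmd.skip.writes l := id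

theorem Runs.assign {x : ℕ} {e : IExp} (hok : e.ok W σ)
    (h : Q (σ.set x (e.eval σ))) : Runs W (assign x e) σ e.size Q := by
  intro s hs
  obtain ⟨s', h1, h2, h3, h4, h5, -⟩ := e.exec_code (d := x) (le_refl 200) hs hok
  refine ⟨s', _, σ.set x (e.eval σ), h1, le_rfl, ⟨fun r hr => ?_, h4.trans hs.2.1, h5.trans hs.2.2⟩, h⟩
  rw [Mem.set_reg]
  split_ifs with hrx
  · rw [hrx, h2]
  · rw [h3 r hr hrx, hs.1 r hr]

theorem Runs.assign_seq {x : ℕ} {e : IExp} (hok : e.ok W σ)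
    (h : Runs W c (σ.set x (e.eval σ)) T Q) :
    Runs W (.seq (RealRAM.assign x e) c) σ (e.size + T) Q :=
  Runs.seq (Q₁ := fun σ' => σ' = σ.set x (e.eval σ)) (Runs.assign hok rfl)
    fun _ h' _ => h' ▸ h

/-- `store k a e` stores the value of `e` in integer array `k` at the address given by `a`. -/
def store (k : ℕ) (a e : IExp) : Cmd :=
  .seq (.seq (a.code 200 201) (e.code 201 202)) (.instr (.istore k 200 201))

@[simp] theorem writes_store (k : ℕ) (a e : IExp) (l : Loc) :
    (store k a e).writes l ↔ l = .int k := by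
  simp [store, Cmd.writes, IExp.writes_code]

theorem Runs.store {k : ℕ} {a e : IExp} (ha : a.ok W σ) (he : e.ok W σ)
    (h : Q (σ.setInt k (a.eval σ) (e.eval σ))) :
    Runs W (store k a e) σ (a.size + e.size + 1) Q := by
  intro s hs
  obtain ⟨s1, e1, v1, f1, i1, r1, -⟩ := a.exec_code (d := 200) (m := 201) (by simp) hs ha
  have hs1 : Sim s1 σ := ⟨fun r hr => (f1 r (by omega) (by omega)).trans (hs.1 r hr),
    i1.trans hs.2.1, r1.trans hs.2.2⟩
  obtain ⟨s2, e2, v2, f2, i2, r2, -⟩ := e.exec_code (d := 201) (m := 202) (by simp) hs1 he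
  have h200 : s2.ireg 200 = a.eval σ := (f2 200 (by omega) (by omega)).trans v1
  refine ⟨_, _, _, .seq (.seq e1 e2) (.instr rfl), le_rfl, ⟨fun r hr => ?_, ?_, ?_⟩, h⟩
  · exact ((f2 r (by omega) (by omega)).trans (f1 r (by omega) (by omega))).trans (hs.1 r hr)
  · simp only [Mem.setInt, v2, h200, i2, i1, hs.2.1]
  · exact (r2.trans r1).trans hs.2.2

theorem Runs.store_seq {k : ℕ} {a e : IExp} (ha : a.ok W σ) (he : e.ok W σ)
    (h : Runs W c (σ.setInt k (a.eval σ) (e.eval σ)) T Q) :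
    Runs W (.seq (RealRAM.store k a e) c) σ (a.size + e.size + 1 + T) Q :=
  Runs.seq (Q₁ := fun σ' => σ' = σ.setInt k (a.eval σ) (e.eval σ)) (Runs.store ha he rfl)
    fun _ h' _ => h' ▸ h

/-- `fill k a c k' b δ` stores `c * y + δ` in the real array `k` at the address given by `a`, where
`y` is the entry of the real array `k'` at the address given by `b`. -/
def fill (k : ℕ) (a : IExp) (c : ℚ) (k' : ℕ) (b : IExp) (δ : ℚ) : Cmd :=
  .seq (.seq (a.code 200 201) (b.code 201 202))
    (.seq (.instr (.rconst 0 c)) (.seq (.instr (.rload 1 k' 201))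
      (.seq (.instr (.rarith .mul 0 0 1)) (.seq (.instr (.rconst 1 δ))
        (.seq (.instr (.rarith .add 0 0 1)) (.instr (.rstore k 200 0)))))))

@[simp] theorem writes_fill (k : ℕ) (a : IExp) (c : ℚ) (k' : ℕ) (b : IExp) (δ : ℚ) (l : Loc) :
    (fill k a c k' b δ).writes l ↔ l = .real k := by
  simp [fill, Cmd.writes, IExp.writes_code]

theorem Runs.fill {k k' : ℕ} {a b : IExp} {x δ : ℚ} (ha : a.ok W σ) (hb : b.ok W σ)
    (h : Q (σ.setReal k (a.eval σ) (x * σ.real k' (b.eval σ) + δ))) :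
    Runs W (fill k a x k' b δ) σ (a.size + b.size + 6) Q := by
  intro s hs
  obtain ⟨s1, e1, v1, f1, i1, r1, -⟩ := a.exec_code (d := 200) (m := 201) (by simp) hs ha
  have hs1 : Sim s1 σ := ⟨fun r hr => (f1 r (by omega) (by omega)).trans (hs.1 r hr),
    i1.trans hs.2.1, r1.trans hs.2.2⟩
  obtain ⟨s2, e2, v2, f2, i2, r2, -⟩ := b.exec_code (d := 201) (m := 202) (by simp) hs1 hb
  have h200 : s2.ireg 200 = a.eval σ := (f2 200 (by omega) (by omega)).trans v1
  refine ⟨_, _, _, .seq (.seq e1 e2) (.seq (.instr rfl) (.seq (.instr rfl) (.seq (.instr rfl)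
    (.seq (.instr rfl) (.seq (.instr rfl) (.instr rfl)))))), le_rfl,
    ⟨fun r hr => ?_, ?_, ?_⟩, h⟩
  · exact ((f2 r (by omega) (by omega)).trans (f1 r (by omega) (by omega))).trans (hs.1 r hr)
  · exact (i2.trans i1).trans hs.2.1
  · simp [Mem.setReal, v2, h200, r2, r1, hs.2.2]

/-- `setLex d k a b` sets register `d` to `1` if the entry of the real array `k` at address `a` is
smaller than the one at address `b`, or equal to it while `a < b`; and to `0` otherwise. -/
def setLex (d k : ℕ) (a b : IExp) : Cmd :=
  .seq (.seq (a.code 200 201) (b.code 201 202))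
    (.seq (.instr (.rload 0 k 200)) (.seq (.instr (.rload 1 k 201))
      (.ite (.rlt 0 1) (.instr (.iconst d 1))
        (.ite (.req 0 1) (.ite (.ilt 200 201) (.instr (.iconst d 1)) (.instr (.iconst d 0)))
          (.instr (.iconst d 0))))))

@[simp] theorem writes_setLex (d k : ℕ) (a b : IExp) (l : Loc) :
    (setLex d k a b).writes l ↔ l = .reg d ∧ d < 200 := by
  simp [setLex, Cmd.writes, IExp.writes_code]

/-- The lexicographic order on the indices of a real sequence: by value, then by index. -/
def Lex (V : ℕ → ℝ) (x y : ℕ) : Prop := V x < V y ∨ V x = V y ∧ x < y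

noncomputable instance (V : ℕ → ℝ) (x y : ℕ) : Decidable (Lex V x y) := Classical.propDecidable _

theorem Runs.setLex {d k : ℕ} {a b : IExp} (ha : a.ok W σ) (hb : b.ok W σ) (hW : 1 ≤ W)
    (h : Q (σ.set d (if Lex (σ.real k) (a.eval σ) (b.eval σ) then 1 else 0))) :
    Runs W (setLex d k a b) σ (a.size + b.size + 6) Q := by
  intro s hs
  obtain ⟨s1, e1, v1, f1, i1, r1, -⟩ := a.exec_code (d := 200) (m := 201) (by simp) hs ha
  have hs1 : Sim s1 σ := ⟨fun r hr => (f1 r (by omega) (by omega)).trans (hs.1 r hr),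
    i1.trans hs.2.1, r1.trans hs.2.2⟩
  obtain ⟨s2, e2, v2, f2, i2, r2, -⟩ := b.exec_code (d := 201) (m := 202) (by simp) hs1 hb
  have h200 : s2.ireg 200 = a.eval σ := (f2 200 (by omega) (by omega)).trans v1
  have hr2 : s2.rmem = σ.real := (r2.trans r1).trans hs.2.2
  have hi2 : s2.imem = σ.int := (i2.trans i1).trans hs.2.1
  have hg : ∀ r < 200, s2.ireg r = σ.reg r := fun r hr =>
    ((f2 r (by omega) (by omega)).trans (f1 r (by omega) (by omega))).trans (hs.1 r hr)
  let s3 : State := { s2 with rreg := Function.update (Function.update s2.rreg 0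
    (s2.rmem k (s2.ireg 200))) 1 (s2.rmem k (s2.ireg 201)) }
  have h0 : s3.rreg 0 = σ.real k (a.eval σ) := by simp [s3, h200, hr2]
  have h1 : s3.rreg 1 = σ.real k (b.eval σ) := by simp [s3, v2, hr2]
  have fin : ∀ v, v ≤ 1 → ∃ s4, Exec W [] (.instr (.iconst d v)) s3 s4 1 ∧
      Sim s4 (σ.set d v) := by
    intro v hv
    refine ⟨{ s3 with ireg := Function.update s3.ireg d v }, .instr ?_, fun r hr => ?_, hi2, hr2⟩
    · simp [Instr.exec, hv.trans hW]
    · simp only [Mem.set_reg, Function.update_apply]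
      split_ifs
      · rfl
      · exact hg r hr
  have key : ∃ s4 t, Exec W [] (.ite (.rlt 0 1) (.instr (.iconst d 1))
        (.ite (.req 0 1) (.ite (.ilt 200 201) (.instr (.iconst d 1)) (.instr (.iconst d 0)))
          (.instr (.iconst d 0)))) s3 s4 t ∧ t ≤ 4 ∧
      Sim s4 (σ.set d (if Lex (σ.real k) (a.eval σ) (b.eval σ) then 1 else 0)) := by
    obtain ⟨u, hu1, hu2⟩ := fin 1 le_rfl
    obtain ⟨w, hw1, hw2⟩ := fin 0 (by omega)
    by_cases c1 : (Test.rlt 0 1).Holds s3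
    · have : Lex (σ.real k) (a.eval σ) (b.eval σ) := Or.inl (by simpa [Test.Holds, h0, h1] using c1)
      rw [if_pos this]
      exact ⟨u, _, .ite_true c1 hu1, by omega, hu2⟩
    · have c1' : ¬ σ.real k (a.eval σ) < σ.real k (b.eval σ) := by
        simpa [Test.Holds, h0, h1] using c1
      by_cases c2 : (Test.req 0 1).Holds s3
      · have c2' : σ.real k (a.eval σ) = σ.real k (b.eval σ) := by
          simpa [Test.Holds, h0, h1] using c2
        by_cases c3 : (Test.ilt 200 201).Holds s3
        · have c3' : a.eval σ < b.eval σ := by simpa [Test.Holds, s3, h200, v2] using c3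
          rw [if_pos (show Lex _ _ _ from Or.inr ⟨c2', c3'⟩)]
          exact ⟨u, _, .ite_false c1 (.ite_true c2 (.ite_true c3 hu1)), by omega, hu2⟩
        · have c3' : ¬ a.eval σ < b.eval σ := by simpa [Test.Holds, s3, h200, v2] using c3
          rw [if_neg (by simp [Lex, c1', c3'])]
          exact ⟨w, _, .ite_false c1 (.ite_true c2 (.ite_false c3 hw1)), by omega, hw2⟩
      · have c2' : ¬ σ.real k (a.eval σ) = σ.real k (b.eval σ) := by
          simpa [Test.Holds, h0, h1] using c2
        rw [if_neg (by simp [Lex, c1', c2'])]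
        exact ⟨w, _, .ite_false c1 (.ite_false c2 hw1), by omega, hw2⟩
  obtain ⟨s4, t, e4, ht, m4⟩ := key
  exact ⟨s4, _, _, .seq (.seq e1 e2) (.seq (.instr rfl) (.seq (.instr rfl) e4)), by omega, m4, h⟩

theorem Runs.setLex_seq {d k : ℕ} {a b : IExp} (ha : a.ok W σ) (hb : b.ok W σ) (hW : 1 ≤ W)
    (h : Runs W c (σ.set d (if Lex (σ.real k) (a.eval σ) (b.eval σ) then 1 else 0)) T Q) :
    Runs W (.seq (RealRAM.setLex d k a b) c) σ (a.size + b.size + 6 + T) Q :=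
  Runs.seq (Runs.setLex ha hb hW rfl) fun _ h' _ => (h' : _ = _) ▸ h

/-- `forLoop i n c` runs `c` with register `i` set to `0, 1, …` as long as this is less than the
content of register `n`. -/
def forLoop (i n : ℕ) (c : Cmd) : Cmd :=
  .seq (assign i (.const 0)) (.loop (.ilt i n) (.seq c (assign i (.reg i + .const 1))))

@[simp] theorem writes_forLoop (i n : ℕ) (c : Cmd) (l : Loc) :
    (forLoop i n c).writes l ↔ l = .reg i ∧ i < 200 ∨ c.writes l := by
  simp only [forLoop, Cmd.writes, writes_assign]
  tauto

/-- The loop invariant `I j` holds when `j` iterations are done. -/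
theorem Runs.forLoop {i n : ℕ} (I : ℕ → Mem → Prop) (hi : ¬ c.writes (.reg i))
    (hn : ¬ c.writes (.reg n)) (hin : i ≠ n) (hi' : i < 200) (hn' : n < 200) (hW : σ.reg n ≤ W)
    (h0 : I 0 (σ.set i 0))
    (hstep : ∀ j < σ.reg n, ∀ σ', Frame (forLoop i n c) σ σ' → σ'.reg i = j → I j σ' →
      Runs W c σ' T fun σ'' => I (j + 1) (σ''.set i (j + 1)))
    (hQ : ∀ σ', Frame (RealRAM.forLoop i n c) σ σ' → I (σ.reg n) σ' → Q σ') :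
    Runs W (RealRAM.forLoop i n c) σ (σ.reg n * (T + 5) + 2) Q := by
  have hwn : ¬ (RealRAM.forLoop i n c).writes (.reg n) := by
    simp [hn, Ne.symm hin]
  have main : ∀ m j σ', j + m = σ.reg n → Frame (RealRAM.forLoop i n c) σ σ' → σ'.reg i = j →
      I j σ' →
      Runs W (.loop (.ilt i n) (.seq c (RealRAM.assign i (.reg i + .const 1)))) σ'
        (m * (T + 5) + 1) fun σ'' => Frame (RealRAM.forLoop i n c) σ σ'' ∧ I (σ.reg n) σ'' := by
    intro m
    induction m with
    | zero =>
      intro j σ' hj hf hr hI s hs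
      have hj' : j = σ.reg n := by omega
      refine ⟨s, 1, σ', .loop_done ?_, by omega, hs, hf, hj' ▸ hI⟩
      simp only [Test.Holds, hs.1 i hi', hs.1 n hn', hr, hf.1 n hn' hwn]
      omega
    | succ m ih =>
      intro j σ' hj hf hr hI s hs
      have body : Runs W (.seq c (RealRAM.assign i (.reg i + .const 1))) σ' (T + 4)
          fun σ'' => σ''.reg i = j + 1 ∧ I (j + 1) σ'' := by
        refine Runs.seq (T₂ := 4) (hstep j (by omega) σ' hf hr hI) fun σ'' h1 h2 => ?_
        have : σ''.reg i = j := (h2.1 i hi' hi).trans hr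
        refine Runs.assign (e := .reg i + .const 1) ?_ ?_
        · simp only [IExp.ok_add, IExp.ok_reg, IExp.ok_const, IExp.eval_reg, IExp.eval_const]
          omega
        · simp only [IExp.eval_add, IExp.eval_reg, IExp.eval_const, this]
          exact ⟨by simp, h1⟩
      obtain ⟨s1, t1, σ1, e1, b1, m1, ⟨r1, q1⟩, f1⟩ := body.frame s hs
      have f1' : Frame (RealRAM.forLoop i n c) σ' σ1 := f1.mono fun l hl => by
        simp only [writes_seq, writes_assign] at hl
        simp only [writes_forLoop]
        tauto
      obtain ⟨s2, t2, σ2, e2, b2, m2, q2⟩ := ih (j + 1) σ1 (by omega) (hf.trans f1') r1 q1 s1 m1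
      refine ⟨s2, _, σ2, .loop_step ?_ e1 e2, ?_, m2, q2⟩
      · simp only [Test.Holds, hs.1 i hi', hs.1 n hn', hr, hf.1 n hn' hwn]
        omega
      · rw [add_one_mul]; omega
  refine Runs.mono (Runs.assign_seq (T := σ.reg n * (T + 5) + 1) (by simp)
    (main (σ.reg n) 0 _ (by simp) ?_ (by simp) (by simpa using h0))) ?_ fun σ' h => hQ σ' h.1 h.2
  · refine ⟨fun r _ hr => ?_, fun _ _ => rfl, fun _ _ => rfl⟩
    have : r ≠ i := fun h => hr (by simp [h, hi'])
    simp [this]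
  · simp; omega

end Rules

/-! ### Ranking a real array -/

section Lex

variable {V : ℕ → ℝ} {x y z : ℕ}

theorem Lex.irrefl (V : ℕ → ℝ) (x : ℕ) : ¬ Lex V x x := by simp [Lex]

theorem Lex.trans (h : Lex V x y) (h' : Lex V y z) : Lex V x z := by
  rcases h with h | ⟨h, h1⟩ <;> rcases h' with h' | ⟨h', h1'⟩
  · exact .inl (h.trans h')
  · exact .inl (h' ▸ h)
  · exact .inl (h ▸ h')
  · exact .inr ⟨h.trans h', h1.trans h1'⟩

theorem Lex.total (h : ¬ Lex V x y) : x = y ∨ Lex V y x := by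
  simp only [Lex] at *
  rcases lt_trichotomy (V x) (V y) with h1 | h1 | h1 <;>
    rcases lt_trichotomy x y with h2 | h2 | h2 <;> simp_all

/-- Ties are broken by the index, so that for `x < y` the order is the non-strict one on values. -/
theorem lex_iff_of_lt (h : x < y) : Lex V x y ↔ V x ≤ V y := by
  rw [le_iff_lt_or_eq]; simp [Lex, h]

/-- The number of indices in the block `[b, b + w)` that precede `x`. -/
noncomputable def cnt (V : ℕ → ℝ) (b w x : ℕ) : ℕ :=
  ((Finset.range w).filter fun t => Lex V (b + t) x).card

theorem cnt_le (V : ℕ → ℝ) (b w x : ℕ) : cnt V b w x ≤ w := by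
  rw [cnt]
  exact (Finset.card_filter_le _ _).trans (by simp)

theorem cnt_add (V : ℕ → ℝ) (b w w' x : ℕ) :
    cnt V b (w + w') x = cnt V b w x + cnt V (b + w) w' x := by
  simp only [cnt, Finset.card_filter, Finset.sum_range_add, Nat.add_assoc]

theorem cnt_lt_cnt_iff {b w : ℕ} (hx : b ≤ x) (hx' : x < b + w) :
    cnt V b w x < cnt V b w y ↔ Lex V x y := by
  constructor
  · intro h
    by_contra hxy
    refine absurd h (not_lt.2 (Finset.card_le_card fun t ht => ?_))
    simp only [Finset.mem_filter] at ht ⊢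
    refine ⟨ht.1, ?_⟩
    rcases Lex.total hxy with rfl | h'
    · exact ht.2
    · exact ht.2.trans h'
  · intro h
    refine Finset.card_lt_card ((Finset.ssubset_iff_of_subset fun t ht => ?_).2
      ⟨x - b, ?_, ?_⟩)
    · simp only [Finset.mem_filter] at ht ⊢
      exact ⟨ht.1, ht.2.trans h⟩
    · simp only [Finset.mem_filter, Finset.mem_range]
      rw [Nat.add_sub_cancel' hx]
      exact ⟨by omega, h⟩
    · simp only [Finset.mem_filter]
      rw [Nat.add_sub_cancel' hx]
      exact fun h' => Lex.irrefl V x h'.2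

theorem cnt_lt {b w : ℕ} (hx : b ≤ x) (hx' : x < b + w) : cnt V b w x < w := by
  have : x - b ∉ (Finset.range w).filter fun t => Lex V (b + t) x := by
    simp only [Finset.mem_filter]
    rw [Nat.add_sub_cancel' hx]
    exact fun h' => Lex.irrefl V x h'.2
  have h2 := Finset.card_lt_card ((Finset.ssubset_iff_of_subset
    (Finset.filter_subset (fun t => Lex V (b + t) x) (Finset.range w))).2
      ⟨x - b, by simp; omega, this⟩)
  simpa [cnt] using h2

theorem cnt_inj {b w : ℕ} (hx : b ≤ x) (hx' : x < b + w) (hy : b ≤ y) (hy' : y < b + w)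
    (h : cnt V b w x = cnt V b w y) : x = y := by
  have h1 : ¬ Lex V x y := fun hl => by
    have := (cnt_lt_cnt_iff hx hx').2 hl
    omega
  rcases Lex.total h1 with h2 | h2
  · exact h2
  · have := (cnt_lt_cnt_iff hy hy').2 h2
    omega

theorem exists_cnt_eq (V : ℕ → ℝ) (b : ℕ) {w t : ℕ} (ht : t < w) :
    ∃ x, b ≤ x ∧ x < b + w ∧ cnt V b w x = t := by
  let f : Fin w → Fin w := fun u =>
    ⟨cnt V b w (b + u), cnt_lt (by omega) (by have := u.2; omega)⟩
  have hf : Function.Injective f := fun u v huv => by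
    have := cnt_inj (V := V) (b := b) (w := w) (by omega) (by have := u.2; omega) (by omega)
      (by have := v.2; omega) (Fin.mk.inj_iff.1 huv)
    exact Fin.ext (by omega)
  obtain ⟨u, hu⟩ := (Finite.injective_iff_surjective.1 hf) ⟨t, ht⟩
  exact ⟨b + u, by omega, by have := u.2; omega, Fin.mk.inj_iff.1 hu⟩

end Lex

/-- The first address of the block of length `w` that contains `x`. -/
def blockStart (w x : ℕ) : ℕ := x / w * w

theorem blockStart_le (w x : ℕ) : blockStart w x ≤ x := Nat.div_mul_le_self x w

theorem lt_blockStart_add {w : ℕ} (hw : 0 < w) (x : ℕ) : x < blockStart w x + w :=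
  Nat.lt_div_mul_add hw

theorem blockStart_eq {w x b : ℕ} (hb : w ∣ b) (h : b ≤ x) (h' : x < b + w) :
    blockStart w x = b := by
  obtain ⟨c, rfl⟩ := hb
  have : x / w = c := Nat.div_eq_of_lt_le (by rwa [mul_comm]) (by rw [Nat.succ_mul, mul_comm]; exact h')
  rw [blockStart, this, mul_comm]

theorem blockStart_add_le {w x M : ℕ} (hw : w ∣ M) (hx : x < M) : blockStart w x + w ≤ M := by
  obtain ⟨c, rfl⟩ := hw
  have h1 : x / w < c := Nat.div_lt_of_lt_mul hx
  rw [blockStart, ← Nat.succ_mul, mul_comm w c]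
  exact Nat.mul_le_mul_right w h1

/-- A block of length `2 * w` consists of the block of length `w` around `x` and its sibling. -/
theorem blockStart_two_mul {w : ℕ} (hw : 0 < w) (x : ℕ) :
    blockStart w x = blockStart (2 * w) x ∨ blockStart w x = blockStart (2 * w) x + w := by
  have h1 := blockStart_le (2 * w) x
  have h2 := lt_blockStart_add (w := 2 * w) (by omega) x
  have hd : w ∣ blockStart (2 * w) x := (Dvd.intro_left 2 rfl).trans (Dvd.intro_left _ rfl)
  by_cases h : x < blockStart (2 * w) x + w
  · exact .inl (blockStart_eq hd h1 h)
  · exact .inr (blockStart_eq (hd.add (dvd_refl w)) (by omega) (by omega))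

/-- Binary search for the number of entries of a sorted block that precede the index in register
`22`. The block has length `reg 20` and starts at column `reg 23` of row `reg 21` of the table `kS`.
Register `25` holds a lower bound for the number, and register `26` runs through decreasing powers
of two, by which the bound is raised as long as the entries passed precede. The number of rounds
is the content of register `4`; rounds after register `26` has become `0` have no effect. -/
def searchLoop (kS kV : ℕ) : Cmd :=
  .seq (assign 25 (.const 0)) (.seq (assign 26 (.reg 20)) (forLoop 27 4
    (.seq (setLex 28 kV
        (.get kS (.reg 21 * .reg 5 + .reg 23 + .reg 25 + .reg 26 - .const 1)) (.reg 22))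
      (.seq (assign 25 (.reg 25 +
          .reg 26 * (.reg 28 * (.const 1 - (.reg 25 + .reg 26 - .reg 20)))))
        (assign 26 (.reg 26 / .const 2))))))

theorem searchLoop_runs {W kS kV : ℕ} {σ : Mem} {lev M sb x C : ℕ}
    (hlev : lev + 1 ≤ σ.reg 4) (h20 : σ.reg 20 = 2 ^ lev) (h21 : σ.reg 21 = lev)
    (h5 : σ.reg 5 = M) (h23 : σ.reg 23 = sb) (h22 : σ.reg 22 = x)
    (hM : 2 ^ lev ≤ M) (hsb : sb < M) (hx : x < M) (hW : lev * M + 5 * M ≤ W)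
    (h4 : σ.reg 4 ≤ W) (hC : C ≤ 2 ^ lev)
    (htest : ∀ t < 2 ^ lev, Lex (σ.real kV) (σ.int kS (lev * M + sb + t)) x ↔ t < C) :
    Runs W (searchLoop kS kV) σ (σ.reg 4 * 60 + 20) fun σ' => σ'.reg 25 = C := by
  have hlM : lev ≤ lev * M := Nat.le_mul_of_pos_right _ (by omega)
  have hpos : 0 < 2 ^ lev := by positivity
  refine Runs.mono (Runs.assign_seq (by simp) (Runs.assign_seq (by simp [h20]; omega)
    -- in round `j ≤ lev`, the number is less than `2 * 2 ^ (lev - j)` above the lower bound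
    (Runs.forLoop (T := 50) (fun j σ' => (j ≤ lev ∧ σ'.reg 26 = 2 ^ (lev - j) ∧
      σ'.reg 25 ≤ C ∧ C < σ'.reg 25 + 2 * 2 ^ (lev - j)) ∨
      (lev < j ∧ σ'.reg 26 = 0 ∧ σ'.reg 25 = C))
      (by simp) (by simp) (by simp) (by simp) (by simp) (by simpa using h4) ?_ ?_ ?_)))
      ?_ (fun _ h => h)
  · left
    simp [h20]
    omega
  · intro j hj σ' hf hr hI
    simp only [Mem.set_reg, Nat.reduceEqDiff, if_false] at hj
    have f20 : σ'.reg 20 = 2 ^ lev := by simpa [h20] using hf.1 20 (by simp) (by simp)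
    have f21 : σ'.reg 21 = lev := by simpa [h21] using hf.1 21 (by simp) (by simp)
    have f22 : σ'.reg 22 = x := by simpa [h22] using hf.1 22 (by simp) (by simp)
    have f23 : σ'.reg 23 = sb := by simpa [h23] using hf.1 23 (by simp) (by simp)
    have f5 : σ'.reg 5 = M := by simpa [h5] using hf.1 5 (by simp) (by simp)
    have fS : σ'.int kS = σ.int kS := by simpa using hf.2.1 kS (by simp)
    have fV : σ'.real kV = σ.real kV := by simpa using hf.2.2 kV (by simp)
    have hst : σ'.reg 26 ≤ 2 ^ lev := by
      rcases hI with hI | hI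
      · rw [hI.2.1]; exact Nat.pow_le_pow_right (by simp) (by omega)
      · omega
    have hc : σ'.reg 25 ≤ 2 ^ lev := by omega
    refine Runs.mono (Runs.setLex_seq (T := 24) ?_ ?_ ?_ ?_) (by simp) (fun _ h => h)
    · simp only [IExp.ok_get, IExp.ok_sub, IExp.ok_add, IExp.ok_mul, IExp.ok_reg, IExp.ok_const,
        IExp.eval_add, IExp.eval_mul, IExp.eval_reg, IExp.eval_const, f21, f5, f23]
      omega
    · simp [f22]; omega
    · omega
    simp only [IExp.eval_get, IExp.eval_sub, IExp.eval_add, IExp.eval_mul, IExp.eval_reg,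
      IExp.eval_const, f21, f5, f23, f22, fS, fV]
    set fl := if Lex (σ.real kV) (σ.int kS (lev * M + sb + σ'.reg 25 + σ'.reg 26 - 1)) x
      then 1 else 0 with hfl
    have hfl1 : fl ≤ 1 := by rw [hfl]; split_ifs <;> omega
    have hb1 : fl * (1 - (σ'.reg 25 + σ'.reg 26 - 2 ^ lev)) ≤ 1 := by
      calc _ ≤ 1 * 1 := Nat.mul_le_mul hfl1 (by omega)
        _ = 1 := rfl
    have hb2 : σ'.reg 26 * (fl * (1 - (σ'.reg 25 + σ'.reg 26 - 2 ^ lev))) ≤ σ'.reg 26 := by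
      simpa using Nat.mul_le_mul_left (σ'.reg 26) hb1
    refine Runs.mono (Runs.assign_seq ?_ (Runs.assign (by simp; omega) ?_)) ?_ (fun _ h => h)
    · simp only [IExp.ok_sub, IExp.ok_add, IExp.ok_mul, IExp.ok_reg, IExp.ok_const,
        IExp.eval_sub, IExp.eval_add, IExp.eval_mul, IExp.eval_reg, IExp.eval_const,
        Mem.set_reg, f20]
      simp only [Nat.reduceEqDiff, if_true, if_false]
      omega
    · simp only [IExp.eval_sub, IExp.eval_add, IExp.eval_mul, IExp.eval_div, IExp.eval_reg,
        IExp.eval_const, Mem.set_reg, f20]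
      simp only [Nat.reduceEqDiff, if_true, if_false]
      rcases hI with ⟨i1, i2, i3, i4⟩ | ⟨i1, i2, i3⟩
      · have hp : 0 < 2 ^ (lev - j) := by positivity
        have hnew : σ'.reg 25 + σ'.reg 26 * (fl * (1 - (σ'.reg 25 + σ'.reg 26 - 2 ^ lev))) ≤ C ∧
            C < σ'.reg 25 + σ'.reg 26 * (fl * (1 - (σ'.reg 25 + σ'.reg 26 - 2 ^ lev)))
              + 2 ^ (lev - j) := by
          by_cases hle : σ'.reg 25 + σ'.reg 26 ≤ 2 ^ lev
          · have ht := htest (σ'.reg 25 + σ'.reg 26 - 1) (by omega)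
            rw [show lev * M + sb + (σ'.reg 25 + σ'.reg 26 - 1) =
              lev * M + sb + σ'.reg 25 + σ'.reg 26 - 1 by omega] at ht
            rw [Nat.sub_eq_zero_of_le hle]
            by_cases hl : Lex (σ.real kV) (σ.int kS (lev * M + sb + σ'.reg 25 + σ'.reg 26 - 1)) x
            · have := ht.1 hl
              rw [hfl, if_pos hl]
              simp only [Nat.sub_zero, mul_one]
              omega
            · have := mt ht.2 hl
              rw [hfl, if_neg hl]
              simp only [zero_mul, mul_zero]
              omega
          · rw [show 1 - (σ'.reg 25 + σ'.reg 26 - 2 ^ lev) = 0 by omega]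
            simp only [mul_zero]
            omega
        rcases Nat.lt_or_ge j lev with hjl | hjl
        · left
          have hh : 2 ^ (lev - j) = 2 * 2 ^ (lev - (j + 1)) := by
            rw [← pow_succ']; congr 1; omega
          refine ⟨by omega, by omega, by omega, by omega⟩
        · right
          have hh : 2 ^ (lev - j) = 1 := by rw [show lev - j = 0 by omega, pow_zero]
          refine ⟨by omega, by omega, by omega⟩
      · right
        exact ⟨by omega, by simp [i2], by simp [i2, i3]⟩
    · simp
  · rintro σ' - (h | h)
    · simp only [Mem.set_reg, Nat.reduceEqDiff, if_false] at h; omega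
    · exact h.2.2
  · simp; omega

/-- Row `lev` of the tables `R` and `S` (with rows of length `M`) is correct for the indices below
`n`: `R` holds the rank of an index in its block of length `2 ^ lev`, and `S` lists the
indices of each block in increasing order. -/
def RankRow (R S : ℕ → ℕ) (V : ℕ → ℝ) (M lev n : ℕ) : Prop :=
  ∀ j < n, R (lev * M + j) = cnt V (blockStart (2 ^ lev) j) (2 ^ lev) j ∧
    S (lev * M + (blockStart (2 ^ lev) j + cnt V (blockStart (2 ^ lev) j) (2 ^ lev) j)) = j

/-- The entries of a correct row are in increasing order within each block. -/
theorem RankRow.lex_iff {R S : ℕ → ℕ} {V : ℕ → ℝ} {M lev sb x t : ℕ} (h : RankRow R S V M lev M)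
    (hsb : 2 ^ lev ∣ sb) (hsM : sb + 2 ^ lev ≤ M) (ht : t < 2 ^ lev) :
    Lex V (S (lev * M + sb + t)) x ↔ t < cnt V sb (2 ^ lev) x := by
  obtain ⟨j, h1, h2, h3⟩ := exists_cnt_eq V sb ht
  have hj := (h j (by omega)).2
  rw [blockStart_eq hsb h1 h2, h3, ← Nat.add_assoc] at hj
  rw [hj, ← cnt_lt_cnt_iff h1 h2, h3]

/-- Rank of index `22` in its block of length `2 ^ (lev + 1)`: the rank in its block of length
`2 ^ lev`, plus the number of smaller entries in the sibling block. -/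
def rankStep (kR kS kV : ℕ) : Cmd :=
  .seq (assign 24 (.reg 22 / (.const 2 * .reg 20) * (.const 2 * .reg 20)))
    (.seq (assign 23 (.const 2 * .reg 24 + .reg 20 - .reg 22 / .reg 20 * .reg 20))
      (.seq (searchLoop kS kV)
        (.seq (store kR ((.reg 21 + .const 1) * .reg 5 + .reg 22)
            (.get kR (.reg 21 * .reg 5 + .reg 22) + .reg 25))
          (store kS ((.reg 21 + .const 1) * .reg 5 +
            (.reg 24 + .get kR ((.reg 21 + .const 1) * .reg 5 + .reg 22))) (.reg 22)))))

@[simp] theorem writes_searchLoop (kS kV : ℕ) (l : Loc) :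
    (searchLoop kS kV).writes l ↔ l = .reg 25 ∨ l = .reg 26 ∨ l = .reg 27 ∨ l = .reg 28 := by
  simp [searchLoop]; tauto

theorem rankStep_runs {W kR kS kV : ℕ} {σ : Mem} {lev M x : ℕ} (hRS : kR ≠ kS)
    (hlev : lev + 1 ≤ σ.reg 4) (h20 : σ.reg 20 = 2 ^ lev) (h21 : σ.reg 21 = lev)
    (h5 : σ.reg 5 = M) (h22 : σ.reg 22 = x) (hM : 2 ^ (lev + 1) ∣ M) (hx : x < M)
    (hW : (lev + 8) * M ≤ W) (h4 : σ.reg 4 ≤ W)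
    (hrow : RankRow (σ.int kR) (σ.int kS) (σ.real kV) M lev M)
    (hnew : RankRow (σ.int kR) (σ.int kS) (σ.real kV) M (lev + 1) x) :
    Runs W (rankStep kR kS kV) σ (σ.reg 4 * 60 + 120) fun σ' =>
      RankRow (σ'.int kR) (σ'.int kS) (σ'.real kV) M lev M ∧
      RankRow (σ'.int kR) (σ'.int kS) (σ'.real kV) M (lev + 1) (x + 1) := by
  have hpos : 0 < 2 ^ lev := by positivity
  have hp2 : 2 ^ (lev + 1) = 2 * 2 ^ lev := pow_succ' 2 lev
  have hWs : lev * M + 8 * M ≤ W := by rwa [← Nat.add_mul]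
  have hlM : lev ≤ lev * M := Nat.le_mul_of_pos_right _ (by omega)
  have hl1 : (lev + 1) * M = lev * M + M := Nat.succ_mul _ _
  set pb := blockStart (2 ^ (lev + 1)) x with hpb
  set own := blockStart (2 ^ lev) x with hown
  have b1 : pb ≤ x := blockStart_le _ x
  have b2 : own ≤ x := blockStart_le _ x
  have b3 : pb + 2 ^ (lev + 1) ≤ M := blockStart_add_le hM hx
  have b4 : x < pb + 2 ^ (lev + 1) := lt_blockStart_add (by positivity) x
  have b5 : x < own + 2 ^ lev := lt_blockStart_add (by positivity) x
  have hdp : 2 ^ (lev + 1) ∣ pb := Dvd.intro_left _ rfl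
  have hdp' : 2 ^ lev ∣ pb := (Dvd.intro_left 2 hp2.symm).trans hdp
  have hsib : own = pb ∨ own = pb + 2 ^ lev := by
    rw [hpb, hown, hp2]; exact blockStart_two_mul hpos x
  have hsd : 2 ^ lev ∣ 2 * pb + 2 ^ lev - own := by
    rcases hsib with h | h
    · rw [show 2 * pb + 2 ^ lev - own = pb + 2 ^ lev by omega]; exact hdp'.add (dvd_refl _)
    · rwa [show 2 * pb + 2 ^ lev - own = pb by omega]
  have hsM : 2 * pb + 2 ^ lev - own + 2 ^ lev ≤ M := by omega
  -- a block consists of the own half and the sibling half, which starts at `2 * pb + 2 ^ lev - own`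
  have hcnt : cnt (σ.real kV) own (2 ^ lev) x +
      cnt (σ.real kV) (2 * pb + 2 ^ lev - own) (2 ^ lev) x =
      cnt (σ.real kV) pb (2 ^ (lev + 1)) x := by
    rw [hp2, two_mul (2 ^ lev), cnt_add]
    rcases hsib with h | h
    · rw [show 2 * pb + 2 ^ lev - own = pb + 2 ^ lev by omega, h]
    · rw [show 2 * pb + 2 ^ lev - own = pb by omega, h, add_comm]
  have hc1 := cnt_lt (V := σ.real kV) b1 b4
  have e24 : x / (2 * 2 ^ lev) * (2 * 2 ^ lev) = pb := by rw [hpb, blockStart, hp2]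
  have e23 : x / 2 ^ lev * 2 ^ lev = own := rfl
  have d1 : x / (2 * 2 ^ lev) ≤ x := Nat.div_le_self _ _
  have d2 : x / 2 ^ lev ≤ x := Nat.div_le_self _ _
  refine Runs.mono (Runs.assign_seq ?_ (Runs.assign_seq ?_ (Runs.seq (searchLoop_runs
    (σ := _) (lev := lev) (M := M) (sb := 2 * pb + 2 ^ lev - own) (x := x)
    (C := cnt (σ.real kV) (2 * pb + 2 ^ lev - own) (2 ^ lev) x)
    ?_ ?_ ?_ ?_ ?_ ?_ ?_ ?_ hx ?_ ?_ (cnt_le _ _ _ _) ?_) (T₂ := 50) fun σ₁ q1 f1 => ?_)))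
    ?_ (fun _ h => h)
  · simp only [IExp.ok_div, IExp.ok_mul, IExp.ok_reg, IExp.ok_const, IExp.eval_div,
      IExp.eval_mul, IExp.eval_reg, IExp.eval_const, h20, h22, e24]
    omega
  · simp only [IExp.ok_div, IExp.ok_add, IExp.ok_sub, IExp.ok_mul, IExp.ok_reg, IExp.ok_const,
      IExp.eval_div, IExp.eval_add, IExp.eval_mul, IExp.eval_reg, IExp.eval_const,
      h20, h22, e24, Mem.set_reg]
    simp only [Nat.reduceEqDiff, if_true, if_false, e23]
    omega
  · simpa using hlev
  · simpa using h20
  · simpa using h21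
  · simpa using h5
  · simp [h20, h22, e24, e23]
  · simpa using h22
  · omega
  · omega
  · omega
  · simpa using h4
  · intro t ht
    simpa using hrow.lex_iff hsd hsM ht
  · have f4 : σ₁.reg 22 = x := by simpa [h22] using f1.1 22 (by simp) (by simp)
    have f5 : σ₁.reg 5 = M := by simpa [h5] using f1.1 5 (by simp) (by simp)
    have f21 : σ₁.reg 21 = lev := by simpa [h21] using f1.1 21 (by simp) (by simp)
    have f24 : σ₁.reg 24 = pb := by simpa [h20, h22, e24] using f1.1 24 (by simp) (by simp)
    have fR : σ₁.int kR = σ.int kR := by simpa using f1.2.1 kR (by simp)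
    have fS : σ₁.int kS = σ.int kS := by simpa using f1.2.1 kS (by simp)
    have fV : σ₁.real kV = σ.real kV := by simpa using f1.2.2 kV (by simp)
    have hRx := (hrow x hx).1
    rw [← hown] at hRx
    have c1 := cnt_le (σ.real kV) own (2 ^ lev) x
    have hval : σ.int kR (lev * M + x) + σ₁.reg 25 = cnt (σ.real kV) pb (2 ^ (lev + 1)) x := by
      rw [hRx, q1, hcnt]
    refine Runs.mono (Runs.store_seq ?_ ?_ (Runs.store ?_ ?_ ?_)) ?_ (fun _ h => h)
    · simp only [IExp.ok_add, IExp.ok_mul, IExp.ok_reg, IExp.ok_const,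
        IExp.eval_add, IExp.eval_mul, IExp.eval_reg, IExp.eval_const, f21, f4, f5, hl1]
      omega
    · simp only [IExp.ok_get, IExp.eval_get, IExp.ok_add, IExp.ok_mul, IExp.ok_reg,
        IExp.eval_add, IExp.eval_mul, IExp.eval_reg, f21, f4, f5, fR, hRx]
      omega
    · simp only [IExp.ok_get, IExp.eval_get, IExp.ok_add, IExp.ok_mul, IExp.ok_reg, IExp.ok_const,
        IExp.eval_add, IExp.eval_mul, IExp.eval_reg, IExp.eval_const, f21, f4, f5, hl1, fR,
        Mem.setInt_int, Mem.setInt_reg, and_self, if_true, hval, f24]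
      omega
    · simp only [IExp.ok_reg, Mem.setInt_reg, f4]
      omega
    · simp only [IExp.eval_get, IExp.eval_add, IExp.eval_mul, IExp.eval_reg, IExp.eval_const,
        f21, f4, f5, hl1, fR, fV, fS, Mem.setInt_int, Mem.setInt_reg, Mem.setInt_real, and_self,
        if_true, hval, f24, RankRow, hRS, hRS.symm, false_and, if_false, true_and]
      refine ⟨fun j hj => ?_, fun j hj => ?_⟩
      · have hb := blockStart_le (2 ^ lev) j
        have hb2 := blockStart_add_le ((Dvd.intro_left 2 hp2.symm).trans hM) hj
        have hc := cnt_lt (V := σ.real kV) hb (lt_blockStart_add hpos j)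
        rw [if_neg (by omega), if_neg (by omega)]
        exact hrow j hj
      · rcases Nat.lt_succ_iff_lt_or_eq.1 hj with hj | rfl
        · have hjn := hnew j hj
          rw [hl1] at hjn
          rw [if_neg (by omega), if_neg]
          · exact hjn
          · intro he
            have hb := blockStart_le (2 ^ (lev + 1)) j
            have hb' := lt_blockStart_add (w := 2 ^ (lev + 1)) (by positivity) j
            have hc := cnt_lt (V := σ.real kV) hb hb'
            -- equal positions lie in the same block, hence have equal ranks
            have hbb : blockStart (2 ^ (lev + 1)) j = pb := by
              rw [← blockStart_eq (w := 2 ^ (lev + 1)) (b := blockStart (2 ^ (lev + 1)) j)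
                (x := pb + cnt (σ.real kV) pb (2 ^ (lev + 1)) x) (Dvd.intro_left _ rfl)
                (by omega) (by omega)]
              exact blockStart_eq hdp (by omega) (by omega)
            rw [hbb] at he hb hb'
            exact absurd (cnt_inj (V := σ.real kV) hb hb' b1 b4 (by omega)) (by omega)
        · rw [← hpb, if_pos (by omega), if_pos (by omega)]
          exact ⟨rfl, rfl⟩
    · simp
  · simp; omega

/-- Fills row `0`, `1`, … of the tables `kR` and `kS` of ranks for the real array `kV`; the last row
holds the ranks in the whole array. -/
def rankLoop (kR kS kV : ℕ) : Cmd :=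
  .seq (forLoop 22 5 (.seq (store kR (.reg 22) (.const 0)) (store kS (.reg 22) (.reg 22))))
    (.seq (assign 20 (.const 1))
      (forLoop 21 9 (.seq (forLoop 22 5 (rankStep kR kS kV))
        (assign 20 (.const 2 * .reg 20)))))

@[simp] theorem writes_rankStep (kR kS kV : ℕ) (l : Loc) :
    (rankStep kR kS kV).writes l ↔ l = .reg 23 ∨ l = .reg 24 ∨ l = .reg 25 ∨ l = .reg 26 ∨
      l = .reg 27 ∨ l = .reg 28 ∨ l = .int kR ∨ l = .int kS := by
  simp [rankStep]; tauto

theorem writes_rankLoop {kR kS kV : ℕ} {l : Loc} (h : (rankLoop kR kS kV).writes l) :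
    (∃ r, 20 ≤ r ∧ r < 30 ∧ l = .reg r) ∨ l = .int kR ∨ l = .int kS := by
  simp only [rankLoop, writes_seq, writes_forLoop, writes_store, writes_assign,
    writes_rankStep] at h
  cases l <;> simp_all; omega

/-- After `log₂ M` rounds, each with a binary search for every index, the whole array is one block. -/
theorem rankLoop_runs {W kR kS kV : ℕ} {σ : Mem} {M Lr : ℕ} (hRS : kR ≠ kS)
    (hM : M = 2 ^ Lr) (h9 : σ.reg 9 = Lr) (h4 : σ.reg 4 = Lr + 2) (h5 : σ.reg 5 = M)
    (hW : (Lr + 8) * M ≤ W) :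
    Runs W (rankLoop kR kS kV) σ (Lr * (M * (Lr * 60 + 250) + 20) + M * 15 + 20) fun σ' =>
      ∀ j < M, σ'.int kR (Lr * M + j) = cnt (σ.real kV) 0 M j := by
  have hMpos : 0 < M := by rw [hM]; positivity
  have hWs : Lr * M + 8 * M ≤ W := by rwa [← Nat.add_mul]
  have hlM : Lr ≤ Lr * M := Nat.le_mul_of_pos_right _ (by omega)
  refine Runs.mono (Runs.seq (Runs.forLoop (T := 10)
    (fun j σ' => RankRow (σ'.int kR) (σ'.int kS) (σ'.real kV) M 0 j)
    (by simp) (by simp) (by simp) (by simp) (by simp) (by omega)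
    ?_ ?_ (fun σ' _ h => h)) (T₂ := Lr * (M * (Lr * 60 + 250) + 14) + 3) fun σ₁ hr0 f1 => ?_)
    ?_ (fun _ h => h)
  · simp [RankRow]
  · intro j hj σ' hf hr hI
    rw [h5] at hj
    refine Runs.mono (Runs.store_seq (by simp; omega) (by simp) (Runs.store (by simp; omega)
      (by simp; omega) ?_)) (by simp) (fun _ h => h)
    simp only [IExp.eval_reg, IExp.eval_const, Mem.set_int, Mem.setInt_reg,
      Mem.set_real, Mem.setInt_real, hr]
    have hb (i : ℕ) : blockStart 1 i = i := by simp [blockStart]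
    have hc (i : ℕ) : cnt (σ'.real kV) i 1 i = 0 := by
      have := cnt_lt (V := σ'.real kV) (le_refl i) (show i < i + 1 by omega)
      omega
    intro i hi
    simp only [pow_zero, hb, hc, zero_mul, zero_add, add_zero, Mem.setInt_int, hRS, hRS.symm,
      true_and, false_and, if_false]
    rcases Nat.lt_succ_iff_lt_or_eq.1 hi with hi | rfl
    · have := hI i hi
      simp only [pow_zero, hb, hc, zero_mul, zero_add, add_zero] at this
      rw [if_neg (by omega), if_neg (by omega)]
      exact this
    · simp
  · have g9 : σ₁.reg 9 = Lr := by rw [f1.1 9 (by simp) (by simp), h9]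
    refine Runs.mono (Runs.assign_seq (by simp; omega)
      (Runs.forLoop (T := M * (Lr * 60 + 250) + 9)
        (fun j σ' => σ'.reg 20 = 2 ^ j ∧ RankRow (σ'.int kR) (σ'.int kS) (σ'.real kV) M j M)
        (by simp) (by simp) (by simp) (by simp) (by simp) (by simp [g9]; omega) ?_ ?_ ?_))
      ?_ (fun _ h => h)
    · rw [h5] at hr0
      simpa using hr0
    · intro j hj σ' hf hr hI
      have g4 : σ'.reg 4 = Lr + 2 := by
        rw [hf.1 4 (by simp) (by simp)]
        simpa [h4] using f1.1 4 (by simp) (by simp)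
      have g5 : σ'.reg 5 = M := by
        rw [hf.1 5 (by simp) (by simp)]
        simpa [h5] using f1.1 5 (by simp) (by simp)
      simp only [Mem.set_reg, Nat.reduceEqDiff, if_false, g9] at hj
      have hle : (j + 8) * M ≤ W := (Nat.mul_le_mul_right M (by omega)).trans hW
      have hdvd : 2 ^ (j + 1) ∣ M := by rw [hM]; exact Nat.pow_dvd_pow 2 (by omega)
      have hple := Nat.le_of_dvd hMpos hdvd
      refine Runs.mono (Runs.seq (Runs.forLoop (T := Lr * 60 + 240)
        (fun x σ'' => RankRow (σ''.int kR) (σ''.int kS) (σ''.real kV) M j M ∧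
          RankRow (σ''.int kR) (σ''.int kS) (σ''.real kV) M (j + 1) x)
        (by simp) (by simp) (by simp) (by simp) (by simp) (by omega) ?_ ?_
        (fun σ'' _ h => h)) (T₂ := 4) ?_) ?_ (fun _ h => h)
      · exact ⟨hI.2, by simp [RankRow]⟩
      · intro x hx σ'' hf'' hr'' hI''
        have k4 : σ''.reg 4 = Lr + 2 := by rw [hf''.1 4 (by simp) (by simp), g4]
        have k5 : σ''.reg 5 = M := by rw [hf''.1 5 (by simp) (by simp), g5]
        have k20 : σ''.reg 20 = 2 ^ j := by rw [hf''.1 20 (by simp) (by simp), hI.1]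
        have k21 : σ''.reg 21 = j := by rw [hf''.1 21 (by simp) (by simp), hr]
        refine Runs.mono (rankStep_runs (lev := j) hRS (by omega) k20 k21 k5 hr'' hdvd (by omega)
          hle (by omega) hI''.1 hI''.2) (by rw [k4]; omega) (fun _ h => h)
      · intro σ₂ h2 f2
        rw [g5] at h2
        have k20 : σ₂.reg 20 = 2 ^ j := by rw [f2.1 20 (by simp) (by simp), hI.1]
        refine Runs.mono (Runs.assign (by simp [k20]; rw [pow_succ'] at hple; omega) ?_)
          (by simp) (fun _ h => h)
        simpa [k20, pow_succ'] using h2.2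
      · rw [g5, Nat.mul_add M _ 250, show Lr * 60 + 240 + 5 = (Lr * 60) + 245 by omega,
          Nat.mul_add M _ 245]
        omega
    · intro σ' hf hI j hj
      simp only [Mem.set_reg, Nat.reduceEqDiff, if_false, g9] at hI
      have hb : blockStart (2 ^ Lr) j = 0 := by
        rw [blockStart, Nat.div_eq_of_lt (by omega), zero_mul]
      have hV : σ'.real kV = σ.real kV := by
        rw [hf.2.2 kV (by simp)]
        simpa using f1.2.2 kV (by simp)
      have := (hI.2 j hj).1
      rwa [hb, ← hM, hV] at this
    · simp [g9, Nat.add_assoc]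
      omega
  · have : Lr * (M * (Lr * 60 + 250) + 14) ≤ Lr * (M * (Lr * 60 + 250) + 20) :=
      Nat.mul_le_mul_left _ (by omega)
    simp [h5]
    omega

/-! ### Dominance by binary tries -/

/-- The number of the left sibling of node `v` of a binary trie if `v` is a right child, and `0`
otherwise. The root is node `1`, and the children of node `v` are `2 * v` and `2 * v + 1`. -/
def leftSibling (v : ℕ) : ℕ := (v - 1) * (v - v / 2 * 2)

theorem leftSibling_of_even {v : ℕ} (h : v % 2 = 0) : leftSibling v = 0 := by
  rw [leftSibling, show v - v / 2 * 2 = 0 by omega, mul_zero]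

theorem leftSibling_of_odd {v : ℕ} (h : v % 2 = 1) : leftSibling v = v - 1 := by
  rw [leftSibling, show v - v / 2 * 2 = 1 by omega, mul_one]

theorem leftSibling_le (v : ℕ) : leftSibling v ≤ v := by
  rcases Nat.mod_two_eq_zero_or_one v with h | h
  · simp [leftSibling_of_even h]
  · simp [leftSibling_of_odd h]

/-- The ancestor at height `i` of a leaf of a trie of height `K` has number between `2 ^ (K - i)`
and `2 ^ (K - i + 1)`. -/
theorem ancestor_bounds {K x i : ℕ} (hx : x < 2 ^ K) (hi : i ≤ K) :
    2 ^ (K - i) ≤ (2 ^ K + x) / 2 ^ i ∧ (2 ^ K + x) / 2 ^ i < 2 ^ (K - i + 1) := by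
  have h : 2 ^ K = 2 ^ (K - i) * 2 ^ i := by rw [← pow_add]; congr 1; omega
  constructor
  · rw [Nat.le_div_iff_mul_le (by positivity), ← h]
    omega
  · rw [Nat.div_lt_iff_lt_mul (by positivity), pow_succ, mul_right_comm, ← h]
    omega

/-- A leaf is to the left of another one iff some ancestor of the former is the left sibling of
an ancestor of the latter. -/
theorem lt_iff_exists_leftSibling {K x y : ℕ} (hx : x < 2 ^ K) (hy : y < 2 ^ K) :
    x < y ↔ ∃ i < K + 1, ∃ j < K + 1,
      (2 ^ K + x) / 2 ^ i = leftSibling ((2 ^ K + y) / 2 ^ j) := by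
  constructor
  · intro hxy
    have hex : ∃ j, (2 ^ K + x) / 2 ^ j = (2 ^ K + y) / 2 ^ j := by
      refine ⟨K, ?_⟩
      have h1 := ancestor_bounds hx le_rfl
      have h2 := ancestor_bounds hy le_rfl
      simp only [Nat.sub_self] at h1 h2
      omega
    have hK : Nat.find hex ≤ K := Nat.find_min' hex (by
      have h1 := ancestor_bounds hx le_rfl
      have h2 := ancestor_bounds hy le_rfl
      simp only [Nat.sub_self] at h1 h2
      omega)
    have h1 := Nat.find_spec hex
    obtain ⟨j, hj⟩ : ∃ j, Nat.find hex = j + 1 := by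
      refine Nat.exists_eq_succ_of_ne_zero fun h0 => ?_
      rw [h0] at h1
      simp at h1
      omega
    have h2 := Nat.find_min hex (m := j) (by omega)
    rw [hj, pow_succ, ← Nat.div_div_eq_div_mul, ← Nat.div_div_eq_div_mul] at h1
    have h3 : (2 ^ K + x) / 2 ^ j ≤ (2 ^ K + y) / 2 ^ j := Nat.div_le_div_right (by omega)
    refine ⟨j, by omega, j, by omega, ?_⟩
    generalize (2 ^ K + x) / 2 ^ j = u at h1 h2 h3 ⊢
    generalize (2 ^ K + y) / 2 ^ j = v at h1 h2 h3 ⊢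
    rw [leftSibling_of_odd (by omega)]
    omega
  · rintro ⟨i, hi, j, hj, h⟩
    have hxi := ancestor_bounds hx (Nat.lt_succ_iff.1 hi)
    have hyj := ancestor_bounds hy (Nat.lt_succ_iff.1 hj)
    have hpos : 0 < 2 ^ (K - i) := by positivity
    rcases Nat.mod_two_eq_zero_or_one ((2 ^ K + y) / 2 ^ j) with ho | ho
    · rw [leftSibling_of_even ho] at h
      omega
    · rw [leftSibling_of_odd ho] at h
      rcases lt_trichotomy i j with hij | rfl | hij
      · have : 2 ^ (K - j + 1) ≤ 2 ^ (K - i) := Nat.pow_le_pow_right (by simp) (by omega)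
        omega
      · by_contra hle
        have : (2 ^ K + y) / 2 ^ i ≤ (2 ^ K + x) / 2 ^ i := Nat.div_le_div_right (by omega)
        omega
      · have h1 : 2 ^ (K - i + 1) ≤ 2 ^ (K - j) := Nat.pow_le_pow_right (by simp) (by omega)
        have h2 : 2 ^ (K - j) = 2 * 2 ^ (K - j - 1) := by
          rw [← pow_succ']; congr 1; omega
        omega

/-- `Keys D L U t κ a`: the address `a` is obtained by appending to `κ` base-`U` digits
`D (t - 1) _`, …, `D 0 _`, each at one of the `L` levels. -/
def Keys (D : ℕ → ℕ → ℕ) (L U : ℕ) : ℕ → ℕ → ℕ → Prop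
  | 0, κ, a => a = κ
  | t + 1, κ, a => ∃ j < L, Keys D L U t (κ * U + D t j) a

theorem Keys.div_eq {D : ℕ → ℕ → ℕ} {L U t κ a : ℕ} (hD : ∀ u < t, ∀ j, D u j < U)
    (h : Keys D L U t κ a) : a / U ^ t = κ := by
  induction t generalizing κ with
  | zero => simpa [Keys] using h
  | succ t ih =>
    obtain ⟨j, -, hj⟩ := h
    have h1 := ih (fun u hu => hD u (by omega)) hj
    have h2 := hD t (by omega) j
    rw [pow_succ, ← Nat.div_div_eq_div_mul, h1, Nat.mul_comm κ, Nat.mul_add_div (by omega),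
      Nat.div_eq_of_lt h2, add_zero]

/-- Two sets of addresses meet iff they agree in every digit for some choice of levels. -/
theorem exists_keys_iff {D D' : ℕ → ℕ → ℕ} {L U t κ : ℕ} (hD : ∀ u < t, ∀ j, D u j < U)
    (hD' : ∀ u < t, ∀ j, D' u j < U) :
    (∃ a, Keys D L U t κ a ∧ Keys D' L U t κ a) ↔
      ∀ u < t, ∃ i < L, ∃ j < L, D u i = D' u j := by
  induction t generalizing κ with
  | zero => simp [Keys]
  | succ t ih =>
    have e1 : ∀ u < t, ∀ j, D u j < U := fun u hu => hD u (by omega)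
    have e2 : ∀ u < t, ∀ j, D' u j < U := fun u hu => hD' u (by omega)
    constructor
    · rintro ⟨a, ⟨i, hi, h1⟩, ⟨j, hj, h2⟩⟩ u hu
      have h : D t i = D' t j := by
        have := (h1.div_eq e1).symm.trans (h2.div_eq e2)
        omega
      rcases Nat.lt_succ_iff_lt_or_eq.1 hu with hu | rfl
      · rw [← h] at h2
        exact (ih e1 e2).1 ⟨a, h1, h2⟩ u hu
      · exact ⟨i, hi, j, hj, h⟩
    · intro h
      obtain ⟨i, hi, j, hj, hij⟩ := h t (by omega)
      obtain ⟨a, h1, h2⟩ := (ih (κ := κ * U + D t i) e1 e2).2 fun u hu => h u (by omega)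
      exact ⟨a, ⟨i, hi, h1⟩, ⟨j, hj, hij ▸ h2⟩⟩

/-- Runs `base` for all addresses, in register `34`, that arise from the content of
register `34 + 3 * t` by appending `t` digits. The digits in dimension `u < t` are the images under
`dig` of the ancestors of the leaf `leaf u`. -/
def nest (dig : IExp → IExp) (leaf : ℕ → IExp) (base : Cmd) : ℕ → Cmd
  | 0 => base
  | t + 1 =>
    .seq (assign (33 + 3 * t) (leaf t)) (forLoop (32 + 3 * t) 4
      (.seq (assign (34 + 3 * t)
          (.reg (34 + 3 * (t + 1)) * (.const 4 * .reg 5) + dig (.reg (33 + 3 * t))))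
        (.seq (nest dig leaf base t)
          (assign (33 + 3 * t) (.reg (33 + 3 * t) / .const 2)))))

theorem writes_nest {dig : IExp → IExp} {leaf : ℕ → IExp} {base : Cmd} {t : ℕ} {l : Loc}
    (h : (nest dig leaf base t).writes l) :
    base.writes l ∨ ∃ r, 32 ≤ r ∧ r < 32 + 3 * t ∧ l = .reg r := by
  induction t with
  | zero => exact .inl h
  | succ t ih =>
    simp only [nest, writes_seq, writes_assign, writes_forLoop] at h
    rcases h with ⟨rfl, -⟩ | ⟨rfl, -⟩ | ⟨rfl, -⟩ | h | ⟨rfl, -⟩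
    · exact .inr ⟨_, by omega, by omega, rfl⟩
    · exact .inr ⟨_, by omega, by omega, rfl⟩
    · exact .inr ⟨_, by omega, by omega, rfl⟩
    · rcases ih h with h | ⟨r, h1, h2, h3⟩
      · exact .inl h
      · exact .inr ⟨r, h1, by omega, h3⟩
    · exact .inr ⟨_, by omega, by omega, rfl⟩

/-- `J A` describes the memory when `base` has been run for the addresses in `A`, and `E` describes
what stays the same. -/
theorem nest_runs {W M L d b kT : ℕ} {dig : IExp → IExp} {g : ℕ → ℕ} {leaf : ℕ → IExp}
    {lf : ℕ → ℕ} {base : Cmd} (J : (ℕ → Prop) → Mem → Prop) (E : Mem → Prop)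
    (hE : ∀ σ σ', E σ → (∀ r < 31, σ'.reg r = σ.reg r) → (∀ k, k ≠ kT → σ'.int k = σ.int k) →
      E σ')
    (hJ : ∀ A σ σ', σ'.int = σ.int → σ'.reg 31 = σ.reg 31 → J A σ → J A σ')
    (hbase : ∀ A σ, E σ → J A σ → σ.reg 34 ≤ W →
      Runs W base σ b (J fun a => A a ∨ a = σ.reg 34))
    (hwr : ∀ l, base.writes l → l = .int kT ∨ l = .reg 31)
    (hreg : ∀ σ, E σ → σ.reg 5 = M ∧ σ.reg 4 = L)
    (hleaf : ∀ t < d, ∀ σ, E σ → (leaf t).ok W σ ∧ (leaf t).eval σ = lf t ∧ (leaf t).size ≤ 50)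
    (hlf : ∀ t < d, lf t < 4 * M) (hg : ∀ v, g v ≤ v)
    (hdig : ∀ e σ, (dig e).eval σ = g (e.eval σ))
    (hdig' : ∀ e σ, e.ok W σ → 2 ≤ W → e.eval σ ≤ W → (dig e).ok W σ)
    (hdig'' : ∀ r, (dig (.reg r)).size ≤ 20)
    (hW : (4 * M) ^ 12 ≤ W) (hLW : L ≤ W) (hb : 1 ≤ b) (hM : 1 ≤ M) (t : ℕ) :
    ∀ s κ A σ, t ≤ d → s + t ≤ 11 → κ < (4 * M) ^ s → E σ → J A σ → σ.reg (34 + 3 * t) = κ →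
    Runs W (nest dig leaf base t) σ (b * (60 * (L + 1)) ^ t)
      (J fun a => A a ∨ Keys (fun u j => g (lf u / 2 ^ j)) L (4 * M) t κ a) := by
  have hpw : ∀ s ≤ 12, (4 * M) ^ s ≤ W := fun s hs =>
    (Nat.pow_le_pow_right (by omega) hs).trans hW
  have h4W : 4 * M ≤ W := by simpa using hpw 1 (by simp)
  induction t with
  | zero =>
    intro s κ A σ ht hs hκ hEσ hJσ hr
    refine Runs.mono (hbase A σ hEσ hJσ ?_) (by simp) fun σ' h => ?_
    · have := hpw s (by omega)
      simp only [Nat.mul_zero, Nat.add_zero] at hr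
      omega
    · simpa [Keys, ← hr] using h
  | succ t ih =>
    intro s κ A σ ht hs hκ hEσ hJσ hr
    obtain ⟨l1, l2, l3⟩ := hleaf t (by omega) σ hEσ
    have hlt := hlf t (by omega)
    have hbT : 1 ≤ b * (60 * (L + 1)) ^ t := Nat.mul_pos hb (by positivity)
    have hwn : ∀ r, 35 + 3 * t ≤ r ∨ 33 + 3 * t = r ∨ 34 + 3 * t = r ∨ 32 + 3 * t = r ∨
        r < 31 → ¬ (nest dig leaf base t).writes (.reg r) := by
      intro r hr' hw
      rcases writes_nest hw with h | ⟨r', h1, h2, h3⟩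
      · rcases hwr _ h with h | h
        · cases h
        · cases h; omega
      · cases h3; omega
    have hwm : ∀ k, k ≠ kT → ¬ (nest dig leaf base t).writes (.int k) := by
      intro k hk hw
      rcases writes_nest hw with h | ⟨r', h1, h2, h3⟩
      · rcases hwr _ h with h | h
        · cases h; exact hk rfl
        · cases h
      · cases h3
    refine Runs.mono (Runs.assign_seq l1 (Runs.forLoop
      (T := b * (60 * (L + 1)) ^ t + 50)
      (fun j σ' => J (fun a => A a ∨ ∃ i < j, Keys (fun u j => g (lf u / 2 ^ j)) L (4 * M) t
        (κ * (4 * M) + g (lf t / 2 ^ i)) a) σ' ∧ σ'.reg (33 + 3 * t) = lf t / 2 ^ j)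
      ?_ ?_ (by omega) (by omega) (by omega) ?_ ?_ ?_ ?_)) ?_ (fun _ h => h)
    · simp only [writes_seq, writes_assign, Loc.reg.injEq]
      have := hwn (32 + 3 * t) (by simp)
      rintro (h | h | h)
      · omega
      · exact this h
      · omega
    · simp only [writes_seq, writes_assign, Loc.reg.injEq]
      have := hwn 4 (by simp)
      rintro (h | h | h)
      · omega
      · exact this h
      · omega
    · rw [Mem.set_reg, if_neg (by omega), (hreg σ hEσ).2]; exact hLW
    · refine ⟨?_, ?_⟩
      · refine hJ _ σ _ rfl ?_ ?_
        · rw [Mem.set_reg, if_neg (by omega), Mem.set_reg, if_neg (by omega)]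
        · simpa using hJσ
      · rw [Mem.set_reg, if_neg (by omega), Mem.set_reg, if_pos rfl, l2, pow_zero, Nat.div_one]
    · rintro j hj σ' hf hrj ⟨hI1, hI2⟩
      have hEσ' : E σ' := by
        refine hE σ σ' hEσ (fun r hr => ?_) (fun k hk => ?_)
        · rw [hf.1 r (by omega), Mem.set_reg, if_neg (by omega)]
          simp only [writes_forLoop, writes_seq, writes_assign, Loc.reg.injEq]
          have := hwn r (by simp [hr])
          rintro (h | h | h | h)
          · omega
          · omega
          · exact this h
          · omega
        · rw [hf.2.1 k]
          · rfl
          · simpa using hwm k hk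
      have hκ' : σ'.reg (34 + 3 * (t + 1)) = κ := by
        rw [hf.1 _ (by omega), Mem.set_reg, if_neg (by omega), hr]
        simp only [writes_forLoop, writes_seq, writes_assign, Loc.reg.injEq]
        have := hwn (34 + 3 * (t + 1)) (by omega)
        rintro (h | h | h | h)
        · omega
        · omega
        · exact this h
        · omega
      obtain ⟨q5, q4⟩ := hreg σ' hEσ'
      have hx : lf t / 2 ^ j < 4 * M := (Nat.div_le_self _ _).trans_lt hlt
      have hgx := hg (lf t / 2 ^ j)
      have hnew : κ * (4 * M) + g (lf t / 2 ^ j) < (4 * M) ^ (s + 1) := by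
        calc κ * (4 * M) + g (lf t / 2 ^ j) < (κ + 1) * (4 * M) := by rw [Nat.add_mul, one_mul]; omega
          _ ≤ _ := by rw [pow_succ]; exact Nat.mul_le_mul_right _ hκ
      have hs1 := hpw (s + 1) (by omega)
      have hs0 := hpw s (by omega)
      refine Runs.mono (Runs.assign_seq ?_ (Runs.seq (ih (s + 1) (κ * (4 * M) + g (lf t / 2 ^ j)) _
        _ (by omega) (by omega) hnew ?_ (hJ _ σ' _ rfl ?_ hI1) ?_) (T₂ := 4)
        fun σ₁ h1 f1 => ?_)) ?_ (fun _ h => h)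
      · simp only [IExp.ok_add, IExp.ok_mul, IExp.ok_reg, IExp.ok_const,
          IExp.eval_mul, IExp.eval_reg, IExp.eval_const, hdig, hκ', q5, hI2]
        refine ⟨⟨⟨by omega, by omega⟩, ⟨by omega, ⟨by omega, by omega⟩, h4W⟩, by omega⟩,
          hdig' _ _ ?_ (by omega) ?_, by omega⟩
        · simp only [IExp.ok_reg, hI2]
          omega
        · simp only [IExp.eval_reg, hI2]
          omega
      · refine hE σ' _ hEσ' (fun r hr => ?_) (fun k hk => rfl)
        rw [Mem.set_reg, if_neg (by omega)]
      · rw [Mem.set_reg, if_neg (by omega)]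
      · simp only [Mem.set_reg, if_true, IExp.eval_add, IExp.eval_mul, IExp.eval_reg,
          IExp.eval_const, hdig, hκ', q5, hI2]
      · have hx1 : σ₁.reg (33 + 3 * t) = lf t / 2 ^ j := by
          rw [f1.1 _ (by omega) (hwn _ (by simp)), Mem.set_reg, if_neg (by omega), hI2]
        refine Runs.mono (Runs.assign ?_ ?_) (by simp) (fun _ h => h)
        · simp only [IExp.ok_div, IExp.ok_reg, IExp.ok_const, IExp.eval_reg,
            IExp.eval_const, hx1]
          omega
        · refine ⟨?_, ?_⟩
          · refine hJ _ σ₁ _ rfl ?_ ?_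
            · rw [Mem.set_reg, if_neg (by omega), Mem.set_reg, if_neg (by omega)]
            · refine (congrArg (fun B => J B σ₁) (funext fun a => propext ?_)).mp h1
              simp only [Nat.lt_succ_iff_lt_or_eq, or_and_right, exists_or, exists_eq_left,
                or_assoc]
          · rw [Mem.set_reg, if_neg (by omega), Mem.set_reg, if_pos rfl]
            simp only [IExp.eval_div, IExp.eval_reg, IExp.eval_const, hx1]
            rw [Nat.div_div_eq_div_mul, pow_succ]
      · have := hdig'' (33 + 3 * t)
        simp
        omega
    · intro σ' hf h
      rw [Mem.set_reg, if_neg (by omega), (hreg σ hEσ).2] at h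
      exact h.1
    · rw [Mem.set_reg, if_neg (by omega), (hreg σ hEσ).2, pow_succ, ← mul_assoc]
      generalize b * (60 * (L + 1)) ^ t = X at hbT
      have h1 : L ≤ L * X := Nat.le_mul_of_pos_right _ hbT
      have h2 : L * (X + 50 + 5) = L * X + L * 55 := by ring
      have h3 : X * (60 * (L + 1)) = 60 * (L * X) + 60 * X := by ring
      omega

/-- `domMax d nB nA val keyI keyQ kOut kT` computes a dominance maximum in `d` dimensions. Item
number `b` (below the content of register `nB`) has key vector `keyI _` and value `val`, query
number `a` (below the content of register `nA`) has key vector `keyQ _`; the expressions find the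
number in register `30`. Entry `a` of the integer array `kOut` receives the largest value of an item
whose key vector is smaller than that of query `a` in every dimension, or `0`. The integer array
`kT` has to be zero at the start: every item leaves its value at all addresses that are
composed of ancestors of its keys, one for each dimension. -/
def domMax (d nB nA : ℕ) (val : IExp) (keyI keyQ : ℕ → IExp) (kOut kT : ℕ) : Cmd :=
  .seq (forLoop 30 nB (.seq (assign 31 val) (.seq (assign (34 + 3 * d) (.const 0))
      (nest id (fun t => .const 2 * .reg 5 + keyI t)
        (store kT (.reg 34) (.get kT (.reg 34) + (.reg 31 - .get kT (.reg 34)))) d))))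
    (forLoop 30 nA (.seq (assign 31 (.const 0)) (.seq (assign (34 + 3 * d) (.const 0))
      (.seq (nest (fun e => (e - .const 1) * (e - e / .const 2 * .const 2))
        (fun t => .const 2 * .reg 5 + keyQ t)
        (assign 31 (.reg 31 + (.get kT (.reg 34) - .reg 31))) d)
        (store kOut (.reg 30) (.reg 31))))))

theorem writes_domMax {d nB nA kOut kT : ℕ} {val : IExp} {keyI keyQ : ℕ → IExp} {l : Loc}
    (h : (domMax d nB nA val keyI keyQ kOut kT).writes l) :
    (∃ r, 30 ≤ r ∧ l = .reg r) ∨ l = .int kOut ∨ l = .int kT := by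
  simp only [domMax, writes_seq, writes_forLoop, writes_assign, writes_store] at h
  rcases h with (⟨rfl, -⟩ | ⟨rfl, -⟩ | ⟨rfl, -⟩ | h) | ⟨rfl, -⟩ | ⟨rfl, -⟩ | ⟨rfl, -⟩ | h | rfl
  · exact .inl ⟨_, by omega, rfl⟩
  · exact .inl ⟨_, by omega, rfl⟩
  · exact .inl ⟨_, by omega, rfl⟩
  · rcases writes_nest h with h | ⟨r, h1, -, rfl⟩
    · simp only [writes_store] at h
      exact .inr (.inr h)
    · exact .inl ⟨_, by omega, rfl⟩
  · exact .inl ⟨_, by omega, rfl⟩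
  · exact .inl ⟨_, by omega, rfl⟩
  · exact .inl ⟨_, by omega, rfl⟩
  · rcases writes_nest h with h | ⟨r, h1, -, rfl⟩
    · simp only [writes_assign] at h
      exact .inl ⟨_, by omega, h.1⟩
    · exact .inl ⟨_, by omega, rfl⟩
  · exact .inr (.inl rfl)

/-- The memories agree on the registers below `30` and on the integer arrays except `kOut`, `kT`. -/
def Agree (kOut kT : ℕ) (σ σ' : Mem) : Prop :=
  (∀ r < 30, σ'.reg r = σ.reg r) ∧ ∀ k, k ≠ kOut → k ≠ kT → σ'.int k = σ.int k

/-- The items have values `V` and key vectors `KI`, the queries have key vectors `KQ`. The result is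
described by its upper bounds, which covers queries that dominate no item. An address has
`d ≤ 11` digits below `4 * M`, so that it fits into a word. -/
theorem domMax_runs {W M Lr d nB nA kOut kT : ℕ} {val : IExp} {keyI keyQ : ℕ → IExp} {σ : Mem}
    {V : ℕ → ℕ} {KI KQ : ℕ → ℕ → ℕ} (hM : M = 2 ^ Lr) (h4 : σ.reg 4 = Lr + 2) (h5 : σ.reg 5 = M)
    (hd : d ≤ 11) (hW : (4 * M) ^ 12 ≤ W) (hB : nB < 20) (hA : nA < 20) (hBM : σ.reg nB ≤ M)
    (hAM : σ.reg nA ≤ M) (hout : kOut ≠ kT) (hT : ∀ a, σ.int kT a = 0)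
    (hV : ∀ b < σ.reg nB, V b ≤ W) (hKI : ∀ b < σ.reg nB, ∀ t < d, KI t b < 2 * M)
    (hKQ : ∀ a < σ.reg nA, ∀ t < d, KQ t a < 2 * M)
    (hval : ∀ σ', Agree kOut kT σ σ' → σ'.reg 30 < σ.reg nB →
      val.ok W σ' ∧ val.eval σ' = V (σ'.reg 30))
    (hvs : val.size ≤ 150)
    (hkeyI : ∀ t < d, ∀ σ', Agree kOut kT σ σ' → σ'.reg 30 < σ.reg nB →
      (keyI t).ok W σ' ∧ (keyI t).eval σ' = KI t (σ'.reg 30) ∧ (keyI t).size ≤ 40)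
    (hkeyQ : ∀ t < d, ∀ σ', Agree kOut kT σ σ' → σ'.reg 30 < σ.reg nA →
      (keyQ t).ok W σ' ∧ (keyQ t).eval σ' = KQ t (σ'.reg 30) ∧ (keyQ t).size ≤ 40) :
    Runs W (domMax d nB nA val keyI keyQ kOut kT) σ
      (2 * M * (40 * (60 * (Lr + 3)) ^ d + 200) + 10) fun σ' =>
      ∀ a < σ.reg nA, ∀ z, σ'.int kOut a ≤ z ↔
        ∀ b < σ.reg nB, (∀ t < d, KI t b < KQ t a) → V b ≤ z := by
  have hMpos : 1 ≤ M := by rw [hM]; exact Nat.one_le_two_pow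
  have h4W : 4 * M ≤ W := le_trans (Nat.le_self_pow (by simp) _) hW
  have hL4 : Lr + 2 ≤ 4 * M := by
    have : Lr < 2 ^ Lr := Nat.lt_two_pow_self
    omega
  have h2M : 2 * M = 2 ^ (Lr + 1) := by rw [hM, pow_succ']
  set DI : ℕ → ℕ → ℕ → ℕ := fun b u j => (2 * M + KI u b) / 2 ^ j with hDI
  set DQ : ℕ → ℕ → ℕ → ℕ := fun a u j => leftSibling ((2 * M + KQ u a) / 2 ^ j) with hDQ
  -- a query looks at some address at which an item left its value iff it dominates the item
  have hmeet : ∀ b < σ.reg nB, ∀ a < σ.reg nA,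
      (∃ x, Keys (DI b) (Lr + 2) (4 * M) d 0 x ∧ Keys (DQ a) (Lr + 2) (4 * M) d 0 x) ↔
        ∀ t < d, KI t b < KQ t a := by
    intro b hb a ha
    rw [exists_keys_iff]
    · refine forall₂_congr fun t ht => ?_
      have h1 := hKI b hb t ht
      have h2 := hKQ a ha t ht
      rw [h2M] at h1 h2
      rw [lt_iff_exists_leftSibling h1 h2]
      simp only [hDI, hDQ, h2M]
    · intro u hu j
      have := hKI b hb u hu
      exact (Nat.div_le_self _ _).trans_lt (by omega)
    · intro u hu j
      have := hKQ a ha u hu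
      exact ((leftSibling_le _).trans (Nat.div_le_self _ _)).trans_lt (by omega)
  refine Runs.mono (Runs.seq (Runs.forLoop (T := 40 * (60 * (Lr + 2 + 1)) ^ d + 155)
    (fun b σ' => ∀ x z, σ'.int kT x ≤ z ↔
      ∀ b' < b, Keys (DI b') (Lr + 2) (4 * M) d 0 x → V b' ≤ z)
    ?_ ?_ (by omega) (by simp) (by omega) (by omega) ?_ ?_ (fun σ' _ h => h))
    (T₂ := M * (40 * (60 * (Lr + 2 + 1)) ^ d + 10 + 5) + 2) fun σ₁ h1 f1 => ?_) ?_ (fun _ h => h)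
  · intro h
    simp only [writes_seq, writes_assign, Loc.reg.injEq] at h
    rcases h with h | h | h
    · omega
    · omega
    · rcases writes_nest h with h | ⟨r, h1, -, h2⟩
      · simp at h
      · cases h2; omega
  · intro h
    simp only [writes_seq, writes_assign, Loc.reg.injEq] at h
    rcases h with h | h | h
    · omega
    · omega
    · rcases writes_nest h with h | ⟨r, h1, -, h2⟩
      · simp at h
      · cases h2; omega
  · simp [hT]
  · intro b hb σ' hf hr hI
    have hag : Agree kOut kT σ σ' := by
      constructor
      · intro r hr'
        rw [hf.1 r (by omega)]
        intro h
        simp only [writes_forLoop, writes_seq, writes_assign, Loc.reg.injEq] at h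
        rcases h with h | h | h | h
        · omega
        · omega
        · omega
        · rcases writes_nest h with h | ⟨r, h1, -, h2⟩
          · simp at h
          · cases h2; omega
      · intro k hk1 hk2
        rw [hf.2.1 k]
        intro h
        simp only [writes_forLoop, writes_seq, writes_assign] at h
        rcases h with h | h | h | h
        · cases h.1
        · cases h.1
        · cases h.1
        · rcases writes_nest h with h | ⟨r, h1, -, h2⟩
          · simp only [writes_store, Loc.int.injEq] at h
            exact hk2 h
          · cases h2
    obtain ⟨v1, v2⟩ := hval σ' hag (by omega)
    rw [hr] at v2
    have hVb := hV b hb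
    have hTW : ∀ x, σ'.int kT x ≤ W := fun x => (hI x W).2 fun b' hb' _ => hV b' (by omega)
    set σ₀ : Mem := (σ'.set 31 (val.eval σ')).set (34 + 3 * d) 0 with hσ₀
    have hb31 : σ₀.reg 31 = V b := by
      rw [hσ₀, Mem.set_reg, if_neg (by omega), Mem.set_reg, if_pos rfl, v2]
    have hag₀ : ∀ σ'', (∀ r < 31, σ''.reg r = σ₀.reg r) →
        (∀ k, k ≠ kT → σ''.int k = σ₀.int k) →
        Agree kOut kT σ σ'' ∧ σ''.reg 30 = b := by
      intro σ'' e1 e2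
      refine ⟨⟨fun r hr' => ?_, fun k hk1 hk2 => ?_⟩, ?_⟩
      · rw [e1 r (by omega), hσ₀, Mem.set_reg, if_neg (by omega), Mem.set_reg, if_neg (by omega),
          hag.1 r hr']
      · rw [e2 k hk2, ← hag.2 k hk1 hk2]
        rfl
      · rw [e1 30 (by simp), hσ₀, Mem.set_reg, if_neg (by omega), Mem.set_reg, if_neg (by omega), hr]
    refine Runs.mono (Runs.assign_seq v1 (Runs.assign_seq (by simp) (nest_runs (M := M)
      (L := Lr + 2) (d := d) (b := 40) (kT := kT) (g := id) (lf := fun t => 2 * M + KI t b)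
      (fun A s => s.reg 31 = V b ∧ ∀ x z, s.int kT x ≤ z ↔ σ'.int kT x ≤ z ∧ (A x → V b ≤ z))
      (fun s => (∀ r < 31, s.reg r = σ₀.reg r) ∧ (∀ k, k ≠ kT → s.int k = σ₀.int k))
      ?_ ?_ ?_ ?_ ?_ ?_ ?_ ?_ ?_ ?_ ?_ hW (by omega) (by simp) hMpos d 0 0 (fun _ => False) σ₀
      le_rfl (by omega) (by simp) ?_ ?_ ?_))) ?_ ?_
    · rintro s s' ⟨e1, e2⟩ e3 e4
      exact ⟨fun r hr => (e3 r hr).trans (e1 r hr), fun k hk => (e4 k hk).trans (e2 k hk)⟩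
    · rintro A s s' e1 e2 ⟨e3, e4⟩
      exact ⟨e2.trans e3, by simpa only [e1] using e4⟩
    · rintro A s - ⟨e3, e4⟩ e5
      have hTs : s.int kT (s.reg 34) ≤ W := (e4 _ W).2 ⟨hTW _, fun _ => hVb⟩
      refine Runs.mono (Runs.store ?_ ?_ ?_) (by simp) (fun _ h => h)
      · simpa using e5
      · simp only [IExp.ok_add, IExp.ok_sub, IExp.ok_get, IExp.ok_reg, IExp.eval_sub,
          IExp.eval_get, IExp.eval_reg]
        omega
      · refine ⟨e3, fun x z => ?_⟩
        simp only [IExp.eval_add, IExp.eval_sub, IExp.eval_get, IExp.eval_reg, Mem.setInt_int,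
          true_and, e3]
        have := e4 x z
        by_cases hx : x = s.reg 34
        · rw [if_pos hx, ← hx]
          simp only [or_true, true_implies]
          by_cases hA : A x
          · simp only [hA, true_implies] at this
            omega
          · simp only [hA, false_implies, and_true] at this
            omega
        · rw [if_neg hx, this]
          simp [hx]
    · intro l hl
      simp only [writes_store] at hl
      exact .inl hl
    · rintro s ⟨e1, e2⟩
      have hh := (hag₀ s e1 e2).1
      rw [hh.1 5 (by simp), hh.1 4 (by simp)]
      exact ⟨h5, h4⟩
    · rintro t ht s ⟨e1, e2⟩
      obtain ⟨hh, hh'⟩ := hag₀ s e1 e2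
      obtain ⟨k1, k2, k3⟩ := hkeyI t ht s hh (by omega)
      have s5 : s.reg 5 = M := by rw [hh.1 5 (by simp), h5]
      have := hKI b hb t ht
      rw [hh'] at k2
      refine ⟨?_, ?_, ?_⟩
      · simp only [IExp.ok_add, IExp.ok_mul, IExp.ok_reg, IExp.ok_const, IExp.eval_mul,
          IExp.eval_reg, IExp.eval_const, s5, k1, k2, true_and]
        omega
      · simp [s5, k2]
      · simp; omega
    · intro t ht
      have := hKI b hb t ht
      omega
    · simp
    · simp
    · intro e s h _ _
      exact h
    · simp
    · exact ⟨fun _ _ => rfl, fun _ _ => rfl⟩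
    · exact ⟨hb31, by simp [hσ₀]⟩
    · simp [hσ₀]
    · simp
      omega
    · rintro σ'' ⟨-, h⟩ x z
      simp only [Mem.set_int, h x z, hI x z, id, false_or]
      simp only [Nat.lt_succ_iff_lt_or_eq]
      constructor
      · rintro ⟨e1, e2⟩ b' (hb' | rfl)
        · exact e1 b' hb'
        · exact e2
      · intro e
        exact ⟨fun b' hb' => e b' (.inl hb'), e b (.inr rfl)⟩
  · have hag1 : Agree kOut kT σ σ₁ := by
      constructor
      · intro r hr'
        refine f1.1 r (by omega) fun h => ?_
        simp only [writes_forLoop, writes_seq, writes_assign, Loc.reg.injEq] at h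
        rcases h with h | h | h | h
        · omega
        · omega
        · omega
        · rcases writes_nest h with h | ⟨r, h1, -, h2⟩
          · simp at h
          · cases h2; omega
      · intro k hk1 hk2
        refine f1.2.1 k fun h => ?_
        simp only [writes_forLoop, writes_seq, writes_assign] at h
        rcases h with h | h | h | h
        · cases h.1
        · cases h.1
        · cases h.1
        · rcases writes_nest h with h | ⟨r, h1, -, h2⟩
          · simp only [writes_store, Loc.int.injEq] at h
            exact hk2 h
          · cases h2
    have hA1 := hag1.1 nA (by omega)
    have hTW : ∀ x, σ₁.int kT x ≤ W := fun x => (h1 x W).2 fun b' hb' _ => hV b' (by omega)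
    refine Runs.mono (Runs.forLoop (T := 40 * (60 * (Lr + 2 + 1)) ^ d + 10)
      (fun a σ' => ∀ a' < a, ∀ z, σ'.int kOut a' ≤ z ↔
        ∀ b < σ.reg nB, (∀ t < d, KI t b < KQ t a') → V b ≤ z)
      ?_ ?_ (by omega) (by simp) (by omega) (by omega) ?_ ?_ ?_) ?_ (fun _ h => h)
    · intro h
      simp only [writes_seq, writes_assign, writes_store, Loc.reg.injEq] at h
      rcases h with h | h | h | h
      · omega
      · omega
      · rcases writes_nest h with h | ⟨r, h1, -, h2⟩
        · simp at h
        · cases h2; omega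
      · cases h
    · intro h
      simp only [writes_seq, writes_assign, writes_store, Loc.reg.injEq] at h
      rcases h with h | h | h | h
      · omega
      · omega
      · rcases writes_nest h with h | ⟨r, h1, -, h2⟩
        · simp at h; omega
        · cases h2; omega
      · cases h
    · simp
    · intro a ha σ' hf hr hI
      rw [hA1] at ha
      have hag' : Agree kOut kT σ₁ σ' ∧ σ'.int kT = σ₁.int kT := by
        have hk : ∀ k, k ≠ kOut → σ'.int k = σ₁.int k := by
          intro k hk1
          rw [hf.2.1 k]
          intro h
          simp only [writes_forLoop, writes_seq, writes_assign, writes_store] at h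
          rcases h with h | h | h | h | h
          · cases h.1
          · cases h.1
          · cases h.1
          · rcases writes_nest h with h | ⟨r, h1, -, h2⟩
            · simp at h
            · cases h2
          · cases h; exact hk1 rfl
        refine ⟨⟨?_, fun k hk1 _ => hk k hk1⟩, hk kT hout.symm⟩
        intro r hr'
        rw [hf.1 r (by omega)]
        intro h
        simp only [writes_forLoop, writes_seq, writes_assign, writes_store, Loc.reg.injEq] at h
        rcases h with h | h | h | h | h
        · omega
        · omega
        · omega
        · rcases writes_nest h with h | ⟨r, h1, -, h2⟩
          · simp at h; omega
          · cases h2; omega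
        · cases h
      obtain ⟨hag', hkT⟩ := hag'
      have hag : Agree kOut kT σ σ' := ⟨fun r hr => (hag'.1 r hr).trans (hag1.1 r hr),
        fun k k1 k2 => (hag'.2 k k1 k2).trans (hag1.2 k k1 k2)⟩
      set σ₀ : Mem := (σ'.set 31 0).set (34 + 3 * d) 0 with hσ₀
      have hag₀ : ∀ σ'', (∀ r < 31, σ''.reg r = σ₀.reg r) →
          (∀ k, k ≠ kT → σ''.int k = σ₀.int k) →
          Agree kOut kT σ σ'' ∧ σ''.reg 30 = a := by
        intro σ'' e1 e2
        refine ⟨⟨fun r hr' => ?_, fun k hk1 hk2 => ?_⟩, ?_⟩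
        · rw [e1 r (by omega), hσ₀, Mem.set_reg, if_neg (by omega), Mem.set_reg,
            if_neg (by omega), hag.1 r hr']
        · rw [e2 k hk2, ← hag.2 k hk1 hk2]
          rfl
        · rw [e1 30 (by simp), hσ₀, Mem.set_reg, if_neg (by omega), Mem.set_reg,
            if_neg (by omega), hr]
      refine Runs.mono (Runs.assign_seq (by simp) (Runs.assign_seq (by simp)
        (Runs.seq (nest_runs (M := M)
        (L := Lr + 2) (d := d) (b := 40) (kT := kT) (g := leftSibling)
        (lf := fun t => 2 * M + KQ t a)
        (fun A s => s.int kT = σ₁.int kT ∧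
          ∀ z, s.reg 31 ≤ z ↔ ∀ x, A x → σ₁.int kT x ≤ z)
        (fun s => (∀ r < 31, s.reg r = σ₀.reg r) ∧ (∀ k, k ≠ kT → s.int k = σ₀.int k))
        ?_ ?_ ?_ ?_ ?_ ?_ ?_ ?_ ?_ ?_ ?_ hW (by omega) (by simp) hMpos d 0 0 (fun _ => False) σ₀
        le_rfl (by omega) (by simp) ?_ ?_ ?_) (T₂ := 6) fun σ₂ h2 f2 => ?_))) ?_ (fun _ h => h)
      · rintro s s' ⟨e1, e2⟩ e3 e4
        exact ⟨fun r hr => (e3 r hr).trans (e1 r hr), fun k hk => (e4 k hk).trans (e2 k hk)⟩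
      · rintro A s s' e1 e2 ⟨e3, e4⟩
        exact ⟨by rw [e1, e3], by simpa only [e2] using e4⟩
      · rintro A s - ⟨e3, e4⟩ e5
        have hTs : s.int kT (s.reg 34) ≤ W := by rw [e3]; exact hTW _
        have h31 : s.reg 31 ≤ W := (e4 W).2 fun x _ => hTW x
        refine Runs.mono (Runs.assign ?_ ?_) (by simp) (fun _ h => h)
        · simp only [IExp.ok_add, IExp.ok_sub, IExp.ok_get, IExp.ok_reg, IExp.eval_sub,
            IExp.eval_get, IExp.eval_reg]
          omega
        · refine ⟨e3, fun z => ?_⟩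
          simp only [IExp.eval_add, IExp.eval_sub, IExp.eval_get, IExp.eval_reg, Mem.set_reg,
            if_true, e3]
          have := e4 z
          simp only [or_imp, forall_and, forall_eq, ← this]
          omega
      · intro l hl
        simp only [writes_assign] at hl
        exact .inr hl.1
      · rintro s ⟨e1, e2⟩
        have hh := (hag₀ s e1 e2).1
        rw [hh.1 5 (by simp), hh.1 4 (by simp)]
        exact ⟨h5, h4⟩
      · rintro t ht s ⟨e1, e2⟩
        obtain ⟨hh, hh'⟩ := hag₀ s e1 e2
        obtain ⟨k1, k2, k3⟩ := hkeyQ t ht s hh (by omega)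
        have s5 : s.reg 5 = M := by rw [hh.1 5 (by simp), h5]
        have := hKQ a ha t ht
        rw [hh'] at k2
        refine ⟨?_, ?_, ?_⟩
        · simp only [IExp.ok_add, IExp.ok_mul, IExp.ok_reg, IExp.ok_const, IExp.eval_mul,
            IExp.eval_reg, IExp.eval_const, s5, k1, k2, true_and]
          omega
        · simp [s5, k2]
        · simp; omega
      · intro t ht
        have := hKQ a ha t ht
        omega
      · exact leftSibling_le
      · intro e s
        simp [leftSibling]
      · intro e s h h2W heW
        have := leftSibling_le (e.eval s)
        simp only [leftSibling] at this
        simp only [IExp.ok_mul, IExp.ok_sub, IExp.ok_div, IExp.ok_const,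
          IExp.eval_mul, IExp.eval_sub, IExp.eval_div, IExp.eval_const]
        refine ⟨⟨h, by omega, by omega⟩, ⟨h, ⟨⟨h, by omega, by omega⟩, by omega, by omega⟩,
          by omega⟩, by omega⟩
      · simp
      · exact ⟨fun _ _ => rfl, fun _ _ => rfl⟩
      · refine ⟨hkT, ?_⟩
        rw [hσ₀, Mem.set_reg, if_neg (by omega), Mem.set_reg, if_pos rfl]
        simp
      · simp [hσ₀]
      · have hwr : ∀ r < 31, σ₂.reg r = σ₀.reg r := by
          intro r hr'
          refine f2.1 r (by omega) fun h => ?_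
          rcases writes_nest h with h | ⟨r, h1, -, h2⟩
          · simp at h; omega
          · cases h2; omega
        have hwi : ∀ k, σ₂.int k = σ₀.int k := by
          intro k
          refine f2.2.1 k fun h => ?_
          rcases writes_nest h with h | ⟨r, h1, -, h2⟩
          · simp at h
          · cases h2
        obtain ⟨hh, hh'⟩ := hag₀ σ₂ hwr fun k _ => hwi k
        refine Runs.mono (Runs.store ?_ ?_ ?_) (by simp) (fun _ h => h)
        · simp only [IExp.ok_reg]
          omega
        · simp only [IExp.ok_reg]
          exact ⟨by omega, (h2.2 W).2 fun x _ => hTW x⟩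
        · intro a' ha' z
          simp only [IExp.eval_reg, Mem.set_int, Mem.setInt_int, true_and, hh', hwi]
          rcases Nat.lt_succ_iff_lt_or_eq.1 ha' with ha' | rfl
          · rw [if_neg (by omega), ← hI a' ha' z]
            rfl
          · rw [if_pos rfl, h2.2 z]
            simp only [false_or, h1]
            constructor
            · intro e b hb hlt
              obtain ⟨x, hx1, hx2⟩ := (hmeet b hb a' ha).2 hlt
              exact e x hx2 b hb hx1
            · intro e x hx b hb hx'
              exact e b hb ((hmeet b hb a' ha).1 ⟨x, hx', hx⟩)
      · simp
        omega
    · intro σ' _ hI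
      rw [hA1] at hI
      exact hI
    · rw [hA1]
      have := Nat.mul_le_mul_right (40 * (60 * (Lr + 2 + 1)) ^ d + 10 + 5) hAM
      omega
  · have := Nat.mul_le_mul_right (40 * (60 * (Lr + 2 + 1)) ^ d + 155 + 5) hBM
    rw [show Lr + 3 = Lr + 2 + 1 by omega]
    generalize 40 * (60 * (Lr + 2 + 1)) ^ d = X at *
    have e1 : M * (X + 155 + 5) = M * X + M * 160 := by ring
    have e2 : M * (X + 10 + 5) = M * X + M * 15 := by ring
    have e3 : 2 * M * (X + 200) = 2 * (M * X) + M * 400 := by ring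
    omega

/-! ### Ranks of the coordinates -/

/-- The registers and the word size during the computation, for `nP`, `nQ`, `nR` points:
register `3` holds a power of two `2 ^ ℓ` that is at least `nP`, `nQ` and `nR`, and register `5`
holds the length of the arrays that are ranked. The ranks are in row `ℓ + 3` of their table, which
starts at the address in register `6`. Register `4` holds the number of nodes on a path in a trie.
Register `13` is the coordinate of the piercing point in the dummy dimension. -/
structure Setup (W ℓ nP nQ nR : ℕ) (σ : Mem) : Prop where
  r0 : σ.reg 0 = nP
  r1 : σ.reg 1 = nQ
  r2 : σ.reg 2 = nR
  r3 : σ.reg 3 = 2 ^ ℓ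
  r4 : σ.reg 4 = ℓ + 5
  r5 : σ.reg 5 = 8 * 2 ^ ℓ
  r6 : σ.reg 6 = (ℓ + 3) * (8 * 2 ^ ℓ)
  r9 : σ.reg 9 = ℓ + 3
  r13 : σ.reg 13 = 0
  hP : nP ≤ 2 ^ ℓ
  hQ : nQ ≤ 2 ^ ℓ
  hR : nR ≤ 2 ^ ℓ
  hW : (4 * (8 * 2 ^ ℓ)) ^ 12 ≤ W

theorem Setup.congr {W ℓ nP nQ nR : ℕ} {σ σ' : Mem} (h : Setup W ℓ nP nQ nR σ)
    (h' : ∀ r, r < 10 ∧ r ≠ 7 ∨ r = 13 → σ'.reg r = σ.reg r) : Setup W ℓ nP nQ nR σ' where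
  r0 := (h' 0 (by simp)).trans h.r0
  r1 := (h' 1 (by simp)).trans h.r1
  r2 := (h' 2 (by simp)).trans h.r2
  r3 := (h' 3 (by simp)).trans h.r3
  r4 := (h' 4 (by simp)).trans h.r4
  r5 := (h' 5 (by simp)).trans h.r5
  r6 := (h' 6 (by simp)).trans h.r6
  r9 := (h' 9 (by simp)).trans h.r9
  r13 := (h' 13 (by simp)).trans h.r13
  hP := h.hP
  hQ := h.hQ
  hR := h.hR
  hW := h.hW

theorem Setup.le_W {W ℓ nP nQ nR : ℕ} {σ : Mem} (h : Setup W ℓ nP nQ nR σ) :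
    (ℓ + 3 + 8) * (8 * 2 ^ ℓ) ≤ W := by
  refine le_trans ?_ h.hW
  have h1 : ℓ < 2 ^ ℓ := Nat.lt_two_pow_self
  calc (ℓ + 3 + 8) * (8 * 2 ^ ℓ) ≤ (4 * (8 * 2 ^ ℓ)) * (4 * (8 * 2 ^ ℓ)) :=
        Nat.mul_le_mul (by omega) (by omega)
    _ = (4 * (8 * 2 ^ ℓ)) ^ 2 := (sq _).symm
    _ ≤ _ := Nat.pow_le_pow_right (by omega) (by omega)

/-- What the ranks `G` of one coordinate tell. The ranked array of length `8 * N` consists of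
segments of length `N`, which start with the numbers `r k - 1`, `q l`, `p j + 1`, `p j`, `r k`
respectively. Moreover `o` is the largest rank of a number `r k - 1`. -/
structure Ranked (N nP nQ nR : ℕ) (p q r : ℕ → ℝ) (G : ℕ → ℕ) (o : ℕ) : Prop where
  lt : ∀ x < 8 * N, G x < 8 * N
  inj : ∀ x < 8 * N, ∀ y < 8 * N, G x = G y → x = y
  pr : ∀ j < nP, ∀ k < nR, G (3 * N + j) < G (4 * N + k) ↔ p j ≤ r k
  rq : ∀ k < nR, ∀ l < nQ, G k < G (N + l) ↔ r k - 1 ≤ q l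
  qp : ∀ l < nQ, ∀ j < nP, G (N + l) < G (2 * N + j) ↔ q l ≤ p j + 1
  rp : ∀ k < nR, ∀ j < nP, G k < G (2 * N + j) ↔ r k - 1 ≤ p j + 1
  top : ∀ z, o ≤ z ↔ ∀ k < nR, G k ≤ z

/-- Ties are broken by position in the array, and the segments are in such an order that all four
inequalities come out non-strict. -/
theorem Ranked.of_cnt {N nP nQ nR : ℕ} {p q r V : ℕ → ℝ} {G : ℕ → ℕ} {o : ℕ} (hP : nP ≤ N)
    (hQ : nQ ≤ N) (hR : nR ≤ N) (hG : ∀ x < 8 * N, G x = cnt V 0 (8 * N) x)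
    (h0 : ∀ k < nR, V k = r k - 1) (h1 : ∀ l < nQ, V (N + l) = q l)
    (h2 : ∀ j < nP, V (2 * N + j) = p j + 1) (h3 : ∀ j < nP, V (3 * N + j) = p j)
    (h4 : ∀ k < nR, V (4 * N + k) = r k) (ho : ∀ z, o ≤ z ↔ ∀ k < nR, G k ≤ z) :
    Ranked N nP nQ nR p q r G o := by
  have key : ∀ x y, x < y → y < 8 * N → (G x < G y ↔ V x ≤ V y) := by
    intro x y hxy hy
    rw [hG x (by omega), hG y hy, cnt_lt_cnt_iff (by omega) (by omega), lex_iff_of_lt hxy]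
  refine ⟨fun x hx => ?_, fun x hx y hy h => ?_, fun j hj k hk => ?_, fun k hk l hl => ?_,
    fun l hl j hj => ?_, fun k hk j hj => ?_, ho⟩
  · rw [hG x hx]
    exact cnt_lt (by omega) (by omega)
  · rw [hG x hx, hG y hy] at h
    exact cnt_inj (by omega) (by omega) (by omega) (by omega) h
  · rw [key _ _ (by omega) (by omega), h3 j hj, h4 k hk]
  · rw [key _ _ (by omega) (by omega), h0 k hk, h1 l hl]
  · rw [key _ _ (by omega) (by omega), h1 l hl, h2 j hj]
  · rw [key _ _ (by omega) (by omega), h0 k hk, h2 j hj]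

/-- Writes the numbers to be ranked for coordinate `i` of the points, multiplied by `c`, to the
real array `20`. The coordinates are in the real arrays `aP + i`, `aQ + i`, `aR + i`. -/
def fillCoord (aP aQ aR i : ℕ) (c : ℚ) : Cmd :=
  .seq (forLoop 20 2 (.seq (fill 20 (.reg 20) c (aR + i) (.reg 20) (-1))
      (fill 20 (.const 4 * .reg 3 + .reg 20) c (aR + i) (.reg 20) 0)))
    (.seq (forLoop 20 1 (fill 20 (.reg 3 + .reg 20) c (aQ + i) (.reg 20) 0))
      (forLoop 20 0 (.seq (fill 20 (.const 2 * .reg 3 + .reg 20) c (aP + i) (.reg 20) 1)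
        (fill 20 (.const 3 * .reg 3 + .reg 20) c (aP + i) (.reg 20) 0))))

/-- Ranks coordinate `i` into the integer array `i`, and stores the largest rank of a number
`r k - 1` in register `10 + i`. -/
def rankCoord (aP aQ aR i : ℕ) (c : ℚ) : Cmd :=
  .seq (fillCoord aP aQ aR i c) (.seq (rankLoop i 4 20) (.seq (assign (10 + i) (.const 0))
    (forLoop 20 2 (assign (10 + i)
      (.reg (10 + i) + (.get i (.reg 6 + .reg 20) - .reg (10 + i)))))))

theorem writes_rankCoord {aP aQ aR i : ℕ} {c : ℚ} {l : Loc}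
    (h : (rankCoord aP aQ aR i c).writes l) :
    (∃ r, 20 ≤ r ∧ r < 30 ∧ l = .reg r) ∨ l = .reg (10 + i) ∨ l = .int i ∨ l = .int 4 ∨
      l = .real 20 := by
  simp only [rankCoord, fillCoord, writes_seq, writes_forLoop, writes_fill, writes_assign] at h
  rcases h with ((⟨rfl, -⟩ | h | h) | (⟨rfl, -⟩ | h) | (⟨rfl, -⟩ | h | h)) | h | ⟨rfl, -⟩ |
    ⟨rfl, -⟩ | ⟨rfl, -⟩
  all_goals first
    | exact .inl ⟨20, by simp, by simp, rfl⟩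
    | (subst h; simp)
    | skip
  · rcases writes_rankLoop h with h | rfl | rfl
    · exact .inl h
    · simp
    · simp
  · simp
  · simp

theorem fillCoord_runs {W ℓ nP nQ nR aP aQ aR i : ℕ} {c : ℚ} {σ : Mem}
    (hS : Setup W ℓ nP nQ nR σ) (hP : aP + i < 20) (hQ : aQ + i < 20) (hR : aR + i < 20) :
    Runs W (fillCoord aP aQ aR i c) σ (2 ^ ℓ * 110 + 10) fun σ' =>
      (∀ k < nR, σ'.real 20 k = c * σ.real (aR + i) k - 1) ∧
      (∀ k < nR, σ'.real 20 (4 * 2 ^ ℓ + k) = c * σ.real (aR + i) k) ∧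
      (∀ l < nQ, σ'.real 20 (2 ^ ℓ + l) = c * σ.real (aQ + i) l) ∧
      (∀ j < nP, σ'.real 20 (2 * 2 ^ ℓ + j) = c * σ.real (aP + i) j + 1) ∧
      (∀ j < nP, σ'.real 20 (3 * 2 ^ ℓ + j) = c * σ.real (aP + i) j) := by
  obtain ⟨r0, r1, r2, r3, r4, r5, r6, r9, r13, hp, hq, hr, hW⟩ := id hS
  have hWs : 8 * 2 ^ ℓ ≤ W := le_trans (by
    calc 8 * 2 ^ ℓ ≤ (ℓ + 3 + 8) * (8 * 2 ^ ℓ) := Nat.le_mul_of_pos_left _ (by omega)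
      _ ≤ W := hS.le_W) le_rfl
  have hpos : 0 < 2 ^ ℓ := by positivity
  generalize hN : 2 ^ ℓ = N at *
  refine Runs.mono (Runs.seq (Runs.forLoop (T := 35)
    (fun n σ' => (∀ k < n, σ'.real 20 k = c * σ.real (aR + i) k - 1) ∧
      (∀ k < n, σ'.real 20 (4 * N + k) = c * σ.real (aR + i) k))
    (by simp) (by simp) (by simp) (by simp) (by simp) (by omega) (by simp) ?_
    (fun σ' _ h => h)) (T₂ := N * 65 + 5) fun σ₁ h1 f1 => Runs.mono (Runs.seq
    (T₁ := N * 25 + 2) (T₂ := N * 40 + 3) (Runs.mono (Runs.forLoop (T := 20)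
    (fun n σ' => (∀ k < nR, σ'.real 20 k = c * σ.real (aR + i) k - 1) ∧
      (∀ k < nR, σ'.real 20 (4 * N + k) = c * σ.real (aR + i) k) ∧
      (∀ l < n, σ'.real 20 (N + l) = c * σ.real (aQ + i) l))
    (by simp) (by simp) (by simp) (by simp) (by simp) ?_ ?_ ?_
    (fun σ' _ h => h)) ?_ (fun _ h => h)) fun σ₂ h2 f2 =>
    Runs.mono (Runs.forLoop (T := 35)
    (fun n σ' => (∀ k < nR, σ'.real 20 k = c * σ.real (aR + i) k - 1) ∧
      (∀ k < nR, σ'.real 20 (4 * N + k) = c * σ.real (aR + i) k) ∧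
      (∀ l < nQ, σ'.real 20 (N + l) = c * σ.real (aQ + i) l) ∧
      (∀ j < n, σ'.real 20 (2 * N + j) = c * σ.real (aP + i) j + 1) ∧
      (∀ j < n, σ'.real 20 (3 * N + j) = c * σ.real (aP + i) j))
    (by simp) (by simp) (by simp) (by simp) (by simp) ?_ ?_ ?_ ?_) ?_ (fun _ h => h))
    ?_ (fun _ h => h)) ?_ (fun _ h => h)
  · intro k hk σ' hf hrk ⟨i1, i2⟩
    have s3 : σ'.reg 3 = N := by rw [hf.1 3 (by simp) (by simp), r3]
    have sR : σ'.real (aR + i) = σ.real (aR + i) := hf.2.2 _ (by simp; omega)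
    refine Runs.mono (Runs.seq (Runs.fill ?_ ?_ rfl) (T₂ := 15) fun σ'' e _ => ?_) ?_
      (fun _ h => h)
    · simp; omega
    · simp; omega
    · subst e
      refine Runs.mono (Runs.fill ?_ ?_ ?_) (by simp) (fun _ h => h)
      · simp [s3]; omega
      · simp; omega
      · simp only [IExp.eval_add, IExp.eval_mul, IExp.eval_reg, IExp.eval_const, Mem.set_real,
          Mem.setReal_real, Mem.setReal_reg, s3, hrk, true_and, sR,
          show aR + i ≠ 20 by omega, false_and, if_false]
        refine ⟨fun k' hk' => ?_, fun k' hk' => ?_⟩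
        · rw [if_neg (by omega)]
          rcases Nat.lt_succ_iff_lt_or_eq.1 hk' with hk' | rfl
          · rw [if_neg (by omega), i1 k' hk']
          · rw [if_pos rfl]
            push_cast
            ring
        · rcases Nat.lt_succ_iff_lt_or_eq.1 hk' with hk' | rfl
          · rw [if_neg (by omega), if_neg (by omega), i2 k' hk']
          · rw [if_pos rfl]
            push_cast
            ring
    · simp
  · rw [f1.1 1 (by simp) (by simp)]; omega
  · rw [r2] at h1
    simpa using h1
  · rw [f1.1 1 (by simp) (by simp), r1]
    intro k hk σ' hf hrk ⟨i1, i2, i3⟩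
    have s3 : σ'.reg 3 = N := by
      rw [hf.1 3 (by simp) (by simp), f1.1 3 (by simp) (by simp), r3]
    have sQ : σ'.real (aQ + i) = σ.real (aQ + i) :=
      (hf.2.2 _ (by simp; omega)).trans (f1.2.2 _ (by simp; omega))
    refine Runs.mono (Runs.fill ?_ ?_ ?_) (by simp) (fun _ h => h)
    · simp [s3]; omega
    · simp; omega
    · simp only [IExp.eval_add, IExp.eval_reg, Mem.set_real,
        Mem.setReal_real, s3, hrk, true_and, sQ]
      refine ⟨fun k' hk' => ?_, fun k' hk' => ?_, fun k' hk' => ?_⟩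
      · rw [if_neg (by omega), i1 k' hk']
      · rw [if_neg (by omega), i2 k' hk']
      · rcases Nat.lt_succ_iff_lt_or_eq.1 hk' with hk' | rfl
        · rw [if_neg (by omega), i3 k' hk']
        · rw [if_pos rfl]
          push_cast
          ring
  · rw [f1.1 1 (by simp) (by simp), r1]
    have := Nat.mul_le_mul_right 25 hq
    omega
  · rw [f2.1 0 (by simp) (by simp), f1.1 0 (by simp) (by simp)]; omega
  · rw [f1.1 1 (by simp) (by simp), r1] at h2
    simpa using h2
  · rw [f2.1 0 (by simp) (by simp), f1.1 0 (by simp) (by simp), r0]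
    intro k hk σ' hf hrk ⟨i1, i2, i3, i4, i5⟩
    have s3 : σ'.reg 3 = N := by
      rw [hf.1 3 (by simp) (by simp), f2.1 3 (by simp) (by simp), f1.1 3 (by simp) (by simp), r3]
    have sP : σ'.real (aP + i) = σ.real (aP + i) :=
      ((hf.2.2 _ (by simp; omega)).trans (f2.2.2 _ (by simp; omega))).trans
        (f1.2.2 _ (by simp; omega))
    refine Runs.mono (Runs.seq (Runs.fill ?_ ?_ rfl) (T₂ := 15) fun σ'' e _ => ?_) ?_
      (fun _ h => h)
    · simp [s3]; omega
    · simp; omega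
    · subst e
      refine Runs.mono (Runs.fill ?_ ?_ ?_) (by simp) (fun _ h => h)
      · simp [s3]; omega
      · simp; omega
      · simp only [IExp.eval_add, IExp.eval_mul, IExp.eval_reg, IExp.eval_const, Mem.set_real,
          Mem.setReal_real, Mem.setReal_reg, s3, hrk, true_and, sP,
          show aP + i ≠ 20 by omega, false_and, if_false]
        refine ⟨fun k' hk' => ?_, fun k' hk' => ?_, fun k' hk' => ?_, fun k' hk' => ?_,
          fun k' hk' => ?_⟩
        · rw [if_neg (by omega), if_neg (by omega), i1 k' hk']
        · rw [if_neg (by omega), if_neg (by omega), i2 k' hk']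
        · rw [if_neg (by omega), if_neg (by omega), i3 k' hk']
        · rw [if_neg (by omega)]
          rcases Nat.lt_succ_iff_lt_or_eq.1 hk' with hk' | rfl
          · rw [if_neg (by omega), i4 k' hk']
          · rw [if_pos rfl]
            push_cast
            ring
        · rcases Nat.lt_succ_iff_lt_or_eq.1 hk' with hk' | rfl
          · rw [if_neg (by omega), if_neg (by omega), i5 k' hk']
          · rw [if_pos rfl]
            push_cast
            ring
    · simp
  · intro σ' _ h
    rw [f2.1 0 (by simp) (by simp), f1.1 0 (by simp) (by simp), r0] at h
    exact h
  · rw [f2.1 0 (by simp) (by simp), f1.1 0 (by simp) (by simp), r0]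
    have := Nat.mul_le_mul_right 40 hp
    omega
  · omega
  · rw [r2]
    have := Nat.mul_le_mul_right 40 hr
    omega

theorem rankCoord_runs {W ℓ nP nQ nR aP aQ aR i : ℕ} {c : ℚ} {σ : Mem}
    (hS : Setup W ℓ nP nQ nR σ) (hP : aP + i < 20) (hQ : aQ + i < 20) (hR : aR + i < 20)
    (hi : i < 3) :
    Runs W (rankCoord aP aQ aR i c) σ
      ((ℓ + 3) * (8 * 2 ^ ℓ * ((ℓ + 3) * 60 + 250) + 20) + 2 ^ ℓ * 300 + 100) fun σ' =>
      Ranked (2 ^ ℓ) nP nQ nR (fun j => c * σ.real (aP + i) j) (fun l => c * σ.real (aQ + i) l)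
        (fun k => c * σ.real (aR + i) k) (fun x => σ'.int i ((ℓ + 3) * (8 * 2 ^ ℓ) + x))
        (σ'.reg (10 + i)) := by
  have hWle := hS.le_W
  have hWle' : (ℓ + 3) * (8 * 2 ^ ℓ) + 8 * (8 * 2 ^ ℓ) ≤ W := by rwa [← Nat.add_mul]
  refine Runs.mono (Runs.seq (fillCoord_runs hS hP hQ hR) (T₂ :=
    ((ℓ + 3) * (8 * 2 ^ ℓ * ((ℓ + 3) * 60 + 250) + 20) + 2 ^ ℓ * 190 + 90)) fun σ₁ h1 f1 => ?_)
    (by omega) (fun _ h => h)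
  have hS1 : Setup W ℓ nP nQ nR σ₁ := hS.congr fun r hr =>
    f1.1 r (by omega) (by simp [fillCoord]; omega)
  refine Runs.mono (Runs.seq (rankLoop_runs (Lr := ℓ + 3) (M := 8 * 2 ^ ℓ) (by omega)
    (by rw [pow_add]; omega) hS1.r9 hS1.r4 hS1.r5 hWle) (T₂ := 2 ^ ℓ * 30 + 20)
    fun σ₂ h2 f2 => ?_) (by omega) (fun _ h => h)
  have hw2 : ∀ r < 20, ¬ (rankLoop i 4 20).writes (.reg r) := by
    intro r hr h
    rcases writes_rankLoop h with ⟨r', h1, h2, h3⟩ | h | h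
    · cases h3; omega
    · cases h
    · cases h
  have hS2 : Setup W ℓ nP nQ nR σ₂ := hS1.congr fun r hr =>
    f2.1 r (by omega) (hw2 r (by omega))
  obtain ⟨r0, r1, r2, r3, r4, r5, r6, r9, r13, hp, hq, hr, hW⟩ := id hS2
  have hlt : ∀ k < nR, σ₂.int i ((ℓ + 3) * (8 * 2 ^ ℓ) + k) ≤ W := by
    intro k hk
    rw [h2 k (by omega)]
    have := cnt_le (σ₁.real 20) 0 (8 * 2 ^ ℓ) k
    omega
  refine Runs.mono (Runs.assign_seq (by simp) (Runs.forLoop (T := 20)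
    (fun n σ' => ∀ z, σ'.reg (10 + i) ≤ z ↔
      ∀ k < n, σ₂.int i ((ℓ + 3) * (8 * 2 ^ ℓ) + k) ≤ z) ?_ ?_ (by omega) (by simp) (by simp)
      ?_ ?_ ?_ ?_)) ?_ (fun _ h => h)
  · simp; omega
  · simp; omega
  · rw [Mem.set_reg, if_neg (by omega), r2]; omega
  · intro z
    rw [Mem.set_reg, if_neg (by omega), Mem.set_reg, if_pos rfl]
    simp
  · intro k hk σ' hf hrk hI
    rw [Mem.set_reg, if_neg (by omega), r2] at hk
    have s6 : σ'.reg 6 = (ℓ + 3) * (8 * 2 ^ ℓ) := by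
      rw [hf.1 6 (by simp) (by simp; omega), Mem.set_reg, if_neg (by omega), r6]
    have si : σ'.int i = σ₂.int i := hf.2.1 i (by simp)
    have hold : σ'.reg (10 + i) ≤ W := (hI W).2 fun k' hk' => hlt k' (by omega)
    have hnew := hlt k hk
    refine Runs.mono (Runs.assign ?_ ?_) (by simp) (fun _ h => h)
    · simp only [IExp.ok_add, IExp.ok_sub, IExp.ok_get, IExp.ok_reg, IExp.eval_add, IExp.eval_sub,
        IExp.eval_get, IExp.eval_reg, s6, hrk, si]
      omega
    · intro z
      rw [Mem.set_reg, if_neg (by omega), Mem.set_reg, if_pos rfl]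
      simp only [IExp.eval_add, IExp.eval_sub, IExp.eval_get, IExp.eval_reg, s6, hrk, si]
      simp only [Nat.lt_succ_iff_lt_or_eq, or_imp, forall_and, forall_eq, ← hI z]
      omega
  · intro σ' hf hI
    rw [Mem.set_reg, if_neg (by omega), r2] at hI
    have si : σ'.int i = σ₂.int i := hf.2.1 i (by simp)
    obtain ⟨v0, v4, v1, v2, v3⟩ := h1
    refine Ranked.of_cnt (V := σ₁.real 20) hp hq hr ?_ v0 v1 v2 v3 v4 ?_
    · intro x hx
      simp only [si, h2 x hx]
    · simpa only [si] using hI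
  · rw [Mem.set_reg, if_neg (by omega), r2]
    have := Nat.mul_le_mul_right 25 hr
    simp
    omega

/-! ### Splitting a pierced box into octants -/

/-- The number `x ≤ M`, or its mirror image `M - x` if `m` is false. -/
def mirror (M : ℕ) (m : Bool) (x : ℕ) : ℕ := if m then x else M - x

@[simp] theorem mirror_true (M x : ℕ) : mirror M true x = x := rfl
@[simp] theorem mirror_false (M x : ℕ) : mirror M false x = M - x := rfl

theorem mirror_le {M x : ℕ} (m : Bool) (h : x ≤ M) : mirror M m x ≤ M := by
  cases m <;> simp [h]

/-- `g` lies in the octant around `o` of type `(m, e)`: on the upper side (for `m` true, otherwise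
on the lower side) in the dimensions other than `e`, and on the opposite side in dimension `e`.
There are three dimensions `0, 1, 2`; dimension `3` is a dummy, in which everything is `0`, so that
`e = 3` means no exceptional dimension. -/
def InOctant (M : ℕ) (m : Bool) (e : ℕ) (o g : ℕ → ℕ) : Prop :=
  (∀ i < 3, i ≠ e → mirror M m (o i) ≤ mirror M m (g i)) ∧
    mirror M m (g e) ≤ mirror M m (o e)

/-- A point `g` lies in the box between the lower corner `a` and the upper corner `b`, which is
pierced by `o`, iff in some octant it satisfies the constraints that matter there: at least
two of these constraints (all but dimension `e`) come from the same corner. -/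
theorem mem_box_iff {M : ℕ} {a b o g : ℕ → ℕ} (ha : ∀ i < 3, a i < M)
    (hb : ∀ i < 3, b i < M) (hg : ∀ i < 3, g i < M) (a3 : a 3 = 0) (b3 : b 3 = 0) (o3 : o 3 = 0)
    (g3 : g 3 = 0) (hao : ∀ i < 3, a i ≤ o i) (hob : ∀ i < 3, o i ≤ b i)
    (hne : ∀ i < 3, a i ≠ g i) (hne' : ∀ i < 3, g i ≠ b i) :
    (∀ i < 3, a i < g i ∧ g i < b i) ↔
      (∃ e < 4, (∀ t < 3, t ≠ e → g t < b t) ∧ InOctant M true e o g ∧ a e ≤ g e) ∨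
      (∃ e < 4, (∀ t < 3, t ≠ e → M - g t < M - a t) ∧ InOctant M false e o g ∧
        M - b e ≤ M - g e) := by
  have expand : ∀ (p : ℕ → Prop), (∀ i < 3, p i) ↔ p 0 ∧ p 1 ∧ p 2 := by
    intro p
    refine ⟨fun h => ⟨h 0 (by simp), h 1 (by simp), h 2 (by simp)⟩, fun ⟨h0, h1, h2⟩ i hi => ?_⟩
    obtain rfl | rfl | rfl : i = 0 ∨ i = 1 ∨ i = 2 := by omega
    · exact h0
    · exact h1
    · exact h2
  constructor
  · intro h
    have hg' : ∀ i < 3, g i ≤ M := fun i hi => (hg i hi).le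
    have up : ∀ e < 4, (∀ i < 3, i ≠ e → o i ≤ g i) → (e < 3 → g e ≤ o e) →
        ∃ e < 4, (∀ t < 3, t ≠ e → g t < b t) ∧ InOctant M true e o g ∧ a e ≤ g e := by
      intro e he h1 h2
      refine ⟨e, he, fun t ht _ => (h t ht).2, ⟨h1, ?_⟩, ?_⟩
      · rcases Nat.lt_succ_iff_lt_or_eq.1 he with he | rfl
        · exact h2 he
        · simp [o3, g3]
      · rcases Nat.lt_succ_iff_lt_or_eq.1 he with he | rfl
        · exact (h e he).1.le
        · omega
    have down : ∀ e < 4, (∀ i < 3, i ≠ e → g i ≤ o i) → (e < 3 → o e ≤ g e) →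
        ∃ e < 4, (∀ t < 3, t ≠ e → M - g t < M - a t) ∧ InOctant M false e o g ∧
          M - b e ≤ M - g e := by
      intro e he h1 h2
      refine ⟨e, he, fun t ht _ => ?_, ⟨fun t ht hte => ?_, ?_⟩, ?_⟩
      · have := (h t ht).1
        have := hg t ht
        omega
      · simpa using Nat.sub_le_sub_left (h1 t ht hte) M
      · rcases Nat.lt_succ_iff_lt_or_eq.1 he with he | rfl
        · simpa using Nat.sub_le_sub_left (h2 he) M
        · simp [o3, g3]
      · rcases Nat.lt_succ_iff_lt_or_eq.1 he with he | rfl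
        · exact Nat.sub_le_sub_left (h e he).2.le M
        · omega
    rcases le_total (o 0) (g 0) with h0 | h0 <;> rcases le_total (o 1) (g 1) with h1 | h1 <;>
      rcases le_total (o 2) (g 2) with h2 | h2
    · exact .inl (up 3 (by simp) ((expand _).2 (by simp [h0, h1, h2])) (by simp))
    · exact .inl (up 2 (by simp) ((expand _).2 (by simp [h0, h1])) (by simp [h2]))
    · exact .inl (up 1 (by simp) ((expand _).2 (by simp [h0, h2])) (by simp [h1]))
    · exact .inr (down 0 (by simp) ((expand _).2 (by simp [h1, h2])) (by simp [h0]))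
    · exact .inl (up 0 (by simp) ((expand _).2 (by simp [h1, h2])) (by simp [h0]))
    · exact .inr (down 1 (by simp) ((expand _).2 (by simp [h0, h2])) (by simp [h1]))
    · exact .inr (down 2 (by simp) ((expand _).2 (by simp [h0, h1])) (by simp [h2]))
    · exact .inr (down 3 (by simp) ((expand _).2 (by simp [h0, h1, h2])) (by simp))
  · rintro (⟨e, he, h1, ⟨h2, h3⟩, h4⟩ | ⟨e, he, h1, ⟨h2, h3⟩, h4⟩) i hi
    · have n1 := hne i hi
      have n2 := hne' i hi
      have n3 := hao i hi
      have n4 := hob i hi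
      by_cases hie : i = e
      · subst hie
        simp only [mirror_true] at h3
        omega
      · have h5 := h1 i hi hie
        have h6 := h2 i hi hie
        simp only [mirror_true] at h6
        omega
    · have n1 := hne i hi
      have n2 := hne' i hi
      have n3 := hao i hi
      have n4 := hob i hi
      have n5 := ha i hi
      have n6 := hb i hi
      have n7 := hg i hi
      by_cases hie : i = e
      · subst hie
        simp only [mirror_false] at h3
        omega
      · have h5 := h1 i hi hie
        have h6 := h2 i hi hie
        simp only [mirror_false] at h6
        omega

/-- `Out y` is the largest value of a point of the octant `(m, e)` that is dominated by query `y` in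
the dimensions other than `e`; the value is one more than the coordinate in dimension `e`.
The points are `x (N + l)`, `l < nQ`, and the queries are `x (off + y)`, `y < nY`, for `x = G _`. -/
def OctantMax (M N nQ nY : ℕ) (G : ℕ → ℕ → ℕ) (o : ℕ → ℕ) (m : Bool) (e off : ℕ)
    (Out : ℕ → ℕ) : Prop :=
  ∀ y < nY, ∀ z, Out y ≤ z ↔ ∀ l < nQ,
    (∀ t < 3, t ≠ e → mirror M m (G t (N + l)) < mirror M m (G t (off + y))) →
    InOctant M m e o (fun i => G i (N + l)) → mirror M m (G e (N + l)) + 1 ≤ z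

/-- The octant maxima decide which boxes are empty: the box from `r k - 1` to `p j + 1` contains no
point `q l` iff for each of the eight octants the extremal point among those that
satisfy the constraints from one corner violates the remaining constraint from the other one. -/
theorem box_empty_iff {N nP nQ nR j k : ℕ} {p q r : ℕ → ℕ → ℝ} {G : ℕ → ℕ → ℕ} {o : ℕ → ℕ}
    {Out : ℕ → ℕ → ℕ} (hP : nP ≤ N) (hQ : nQ ≤ N) (hR : nR ≤ N)
    (hG : ∀ i < 3, Ranked N nP nQ nR (p i) (q i) (r i) (G i) (o i))
    (hG3 : ∀ x, G 3 x = 0) (ho3 : o 3 = 0) (hj : j < nP) (hk : k < nR)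
    (hpin : ∀ i < 3, o i ≤ G i (2 * N + j))
    (hup : ∀ e < 4, OctantMax (8 * N) N nQ nP G o true e (2 * N) (Out e))
    (hdown : ∀ e < 4, OctantMax (8 * N) N nQ nR G o false e 0 (Out (4 + e))) :
    ((∀ e < 4, Out e j < G e k + 1) ∧
      ∀ e < 4, G e (2 * N + j) < 8 * N + 1 - Out (4 + e) k) ↔
    ¬ ∃ l < nQ, ∀ i < 3, r i k - 1 ≤ q i l ∧ q i l ≤ p i j + 1 := by
  have hlt : ∀ e < 4, ∀ x < 8 * N, G e x < 8 * N := by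
    intro e he x hx
    rcases Nat.lt_succ_iff_lt_or_eq.1 he with he | rfl
    · exact (hG e he).lt x hx
    · rw [hG3]; omega
  have hbox : ∀ l < nQ, (∀ i < 3, r i k - 1 ≤ q i l ∧ q i l ≤ p i j + 1) ↔
      (∃ e < 4, (∀ t < 3, t ≠ e → G t (N + l) < G t (2 * N + j)) ∧
        InOctant (8 * N) true e o (fun i => G i (N + l)) ∧ G e k ≤ G e (N + l)) ∨
      (∃ e < 4, (∀ t < 3, t ≠ e → 8 * N - G t (N + l) < 8 * N - G t (0 + k)) ∧
        InOctant (8 * N) false e o (fun i => G i (N + l)) ∧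
        8 * N - G e (2 * N + j) ≤ 8 * N - G e (N + l)) := by
    intro l hl
    rw [zero_add, ← mem_box_iff (M := 8 * N) (a := fun i => G i k) (b := fun i => G i (2 * N + j))
      (fun i hi => (hG i hi).lt _ (by omega)) (fun i hi => (hG i hi).lt _ (by omega))
      (fun i hi => (hG i hi).lt _ (by omega)) (hG3 _) (hG3 _) ho3 (hG3 _)
      (fun i hi => ((hG i hi).top _).1 le_rfl k hk) hpin
      (fun i hi h => by have := (hG i hi).inj _ (by omega) _ (by omega) h; omega)
      (fun i hi h => by have := (hG i hi).inj _ (by omega) _ (by omega) h; omega)]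
    refine forall₂_congr fun i hi => ?_
    rw [(hG i hi).rq k hk l hl, (hG i hi).qp l hl j hj]
  constructor
  · rintro ⟨h1, h2⟩ ⟨l, hl, h⟩
    rcases (hbox l hl).1 h with ⟨e, he, e1, e2, e3⟩ | ⟨e, he, e1, e2, e3⟩
    · have := (hup e he j hj _).1 (Nat.lt_succ_iff.1 (h1 e he)) l hl e1 e2
      simp only [mirror_true] at this
      omega
    · have h3 := h2 e he
      have := (hdown e he k hk (8 * N - G e (2 * N + j))).1 (by omega) l hl e1 e2
      simp only [mirror_false] at this
      omega
  · intro h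
    refine ⟨fun e he => Nat.lt_succ_iff.2 ((hup e he j hj _).2 fun l hl e1 e2 => ?_),
      fun e he => ?_⟩
    · by_contra hc
      simp only [mirror_true] at hc
      exact h ⟨l, hl, (hbox l hl).2 (.inl ⟨e, he, e1, e2, by omega⟩)⟩
    · have hp := hlt e he (2 * N + j) (by omega)
      have : Out (4 + e) k ≤ 8 * N - G e (2 * N + j) := by
        refine (hdown e he k hk _).2 fun l hl e1 e2 => ?_
        by_contra hc
        simp only [mirror_false] at hc
        exact h ⟨l, hl, (hbox l hl).2 (.inr ⟨e, he, e1, e2, by omega⟩)⟩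
      omega

/-! ### The search for bad pairs -/

/-- The ranks `G` and the points `o` that pierce the boxes are available: `G i` is row `ℓ + 3` of
the integer array `i`, and `o i` is in register `10 + i`. -/
structure RankEnv (W ℓ nP nQ nR : ℕ) (G : ℕ → ℕ → ℕ) (o : ℕ → ℕ) (σ : Mem) : Prop extends
    Setup W ℓ nP nQ nR σ where
  int : ∀ i < 4, ∀ x, σ.int i ((ℓ + 3) * (8 * 2 ^ ℓ) + x) = G i x
  reg : ∀ i < 4, σ.reg (10 + i) = o i
  lt : ∀ i < 4, ∀ x < 8 * 2 ^ ℓ, G i x < 8 * 2 ^ ℓ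
  le : ∀ i < 4, o i ≤ 8 * 2 ^ ℓ

theorem RankEnv.congr {W ℓ nP nQ nR : ℕ} {G : ℕ → ℕ → ℕ} {o : ℕ → ℕ} {σ σ' : Mem}
    (h : RankEnv W ℓ nP nQ nR G o σ) (h1 : ∀ r < 14, r ≠ 7 → σ'.reg r = σ.reg r)
    (h2 : ∀ k < 4, σ'.int k = σ.int k) : RankEnv W ℓ nP nQ nR G o σ' where
  toSetup := h.toSetup.congr fun r hr => h1 r (by omega) (by omega)
  int i hi x := by rw [h2 i hi, h.int i hi]
  reg i hi := by rw [h1 _ (by omega) (by omega), h.reg i hi]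
  lt := h.lt
  le := h.le

/-- The rank in dimension `i` of the number with index `a`, mirrored if `m` is false. -/
def rankExp (m : Bool) (i : ℕ) (a : IExp) : IExp :=
  if m then .get i (.reg 6 + a) else .reg 5 - .get i (.reg 6 + a)

/-- The rank of the piercing point in dimension `i`, mirrored if `m` is false. -/
def pierceExp (m : Bool) (i : ℕ) : IExp :=
  if m then .reg (10 + i) else .reg 5 - .reg (10 + i)

/-- `1` if point `30` is on the right side in dimension `i` for octant `(m, e)`, otherwise `0`. -/
def sideExp (m : Bool) (e i : ℕ) : IExp :=
  if i = e then .const 1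
  else .const 1 - (pierceExp m i - rankExp m i (.reg 3 + .reg 30))

/-- The value of point `30` for octant `(m, e)`, which is `0` if it does not lie there. -/
def octantValExp (m : Bool) (e : ℕ) : IExp :=
  (rankExp m e (.reg 3 + .reg 30) + .const 1) * (sideExp m e 0 * (sideExp m e 1 *
    (sideExp m e 2 * (.const 1 - (rankExp m e (.reg 3 + .reg 30) - pierceExp m e)))))

/-- Computes the octant maxima for octant `(m, e)`. -/
def octant (kT : ℕ) (m : Bool) (e : ℕ) : Cmd :=
  domMax 3 1 (if m then 0 else 2) (octantValExp m e)
    (fun t => if t = e then .const 0 else rankExp m t (.reg 3 + .reg 30))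
    (fun t => if t = e then .const 1 else
      rankExp m t (if m then .const 2 * .reg 3 + .reg 30 else .reg 30))
    (if m then 10 + e else 14 + e) kT

section

variable {W ℓ nP nQ nR : ℕ} {G : ℕ → ℕ → ℕ} {o : ℕ → ℕ} {σ : Mem}

theorem RankEnv.bounds (h : RankEnv W ℓ nP nQ nR G o σ) :
    (ℓ + 3) * (8 * 2 ^ ℓ) + 8 * (8 * 2 ^ ℓ) ≤ W ∧ 1 ≤ 2 ^ ℓ :=
  ⟨by rw [← Nat.add_mul]; exact h.toSetup.le_W, Nat.one_le_two_pow⟩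

theorem rankExp_spec (h : RankEnv W ℓ nP nQ nR G o σ) (m : Bool) {i x : ℕ} {a : IExp}
    (hi : i < 4) (ha : a.ok W σ) (hax : a.eval σ = x) (hx : x < 8 * 2 ^ ℓ) :
    (rankExp m i a).ok W σ ∧ (rankExp m i a).eval σ = mirror (8 * 2 ^ ℓ) m (G i x) := by
  obtain ⟨hW, -⟩ := h.bounds
  have h6 := h.r6
  have h5 := h.r5
  have := h.int i hi x
  subst hax
  cases m
  · simp only [rankExp, Bool.false_eq_true, if_false, IExp.ok_sub, IExp.ok_get, IExp.ok_add,
      IExp.ok_reg, IExp.eval_sub, IExp.eval_get, IExp.eval_add, IExp.eval_reg, h5, h6, this, ha,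
      mirror_false, true_and, and_true]
    omega
  · simp only [rankExp, if_true, IExp.ok_get, IExp.ok_add,
      IExp.ok_reg, IExp.eval_get, IExp.eval_add, IExp.eval_reg, h6, this, ha,
      mirror_true, true_and, and_true]
    omega

theorem pierceExp_spec (h : RankEnv W ℓ nP nQ nR G o σ) (m : Bool) {i : ℕ} (hi : i < 4) :
    (pierceExp m i).ok W σ ∧ (pierceExp m i).eval σ = mirror (8 * 2 ^ ℓ) m (o i) := by
  obtain ⟨hW, -⟩ := h.bounds
  have h5 := h.r5
  have := h.reg i hi
  have := h.le i hi
  cases m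
  · simp only [pierceExp, Bool.false_eq_true, if_false, IExp.ok_sub, IExp.ok_reg, IExp.eval_sub,
      IExp.eval_reg, mirror_false, h5, h.reg i hi, and_true]
    omega
  · simp only [pierceExp, if_true, IExp.ok_reg, IExp.eval_reg, mirror_true, h.reg i hi, and_true]
    omega

theorem sideExp_spec (h : RankEnv W ℓ nP nQ nR G o σ) (m : Bool) {e i l : ℕ} (hi : i < 4)
    (hl : l < nQ) (h30 : σ.reg 30 = l) :
    (sideExp m e i).ok W σ ∧ (sideExp m e i).eval σ ≤ 1 ∧ ((sideExp m e i).eval σ = 1 ↔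
      (i ≠ e → mirror (8 * 2 ^ ℓ) m (o i) ≤ mirror (8 * 2 ^ ℓ) m (G i (2 ^ ℓ + l)))) := by
  obtain ⟨hW, hpos⟩ := h.bounds
  by_cases hie : i = e
  · simp [sideExp, hie]
    omega
  · have hQ := h.hQ
    obtain ⟨r1, r2⟩ := rankExp_spec (x := 2 ^ ℓ + l) (a := .reg 3 + .reg 30) h m hi
      (by simp [h.r3, h30]; omega) (by simp [h.r3, h30]) (by omega)
    obtain ⟨p1, p2⟩ := pierceExp_spec h m hi
    have b1 := mirror_le m (h.le i hi)
    have hside : sideExp m e i = .const 1 - (pierceExp m i - rankExp m i (.reg 3 + .reg 30)) :=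
      if_neg hie
    rw [hside]
    simp only [IExp.ok_sub, IExp.ok_const, IExp.eval_sub, IExp.eval_const,
      r1, r2, p1, p2, ne_eq, hie, not_false_iff, true_implies, true_and]
    omega

/-- The value of a point enters the dominance maximum only if the point lies in the octant. -/
theorem octantValExp_spec (h : RankEnv W ℓ nP nQ nR G o σ) (m : Bool) {e l : ℕ} (he : e < 4)
    (hl : l < nQ) (h30 : σ.reg 30 = l) :
    (octantValExp m e).ok W σ ∧ ∀ z, (octantValExp m e).eval σ ≤ z ↔
      (InOctant (8 * 2 ^ ℓ) m e o (fun i => G i (2 ^ ℓ + l)) →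
        mirror (8 * 2 ^ ℓ) m (G e (2 ^ ℓ + l)) + 1 ≤ z) := by
  obtain ⟨hW, hpos⟩ := h.bounds
  have hQ := h.hQ
  obtain ⟨r1, r2⟩ := rankExp_spec (x := 2 ^ ℓ + l) (a := .reg 3 + .reg 30) h m he
    (by simp [h.r3, h30]; omega) (by simp [h.r3, h30]) (by omega)
  obtain ⟨p1, p2⟩ := pierceExp_spec h m he
  obtain ⟨a1, a2, a3⟩ := sideExp_spec (e := e) (i := 0) h m (by simp) hl h30
  obtain ⟨b1, b2, b3⟩ := sideExp_spec (e := e) (i := 1) h m (by simp) hl h30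
  obtain ⟨c1, c2, c3⟩ := sideExp_spec (e := e) (i := 2) h m (by simp) hl h30
  have hoct : InOctant (8 * 2 ^ ℓ) m e o (fun i => G i (2 ^ ℓ + l)) ↔
      (sideExp m e 0).eval σ = 1 ∧ (sideExp m e 1).eval σ = 1 ∧ (sideExp m e 2).eval σ = 1 ∧
      mirror (8 * 2 ^ ℓ) m (G e (2 ^ ℓ + l)) ≤ mirror (8 * 2 ^ ℓ) m (o e) := by
    rw [a3, b3, c3]
    constructor
    · rintro ⟨h1, h2⟩
      exact ⟨h1 0 (by simp), h1 1 (by simp), h1 2 (by simp), h2⟩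
    · rintro ⟨h0, h1, h2, h3⟩
      refine ⟨fun i hi => ?_, h3⟩
      obtain rfl | rfl | rfl : i = 0 ∨ i = 1 ∨ i = 2 := by omega
      · exact h0
      · exact h1
      · exact h2
  have hGl := mirror_le m (h.lt e he (2 ^ ℓ + l) (by omega)).le
  rw [hoct]
  simp only [octantValExp, IExp.ok_mul, IExp.ok_add, IExp.ok_sub, IExp.ok_const, IExp.eval_mul,
    IExp.eval_add, IExp.eval_sub, IExp.eval_const, r1, r2, p1, p2, a1, b1, c1, true_and]
  generalize (sideExp m e 0).eval σ = u at *
  generalize (sideExp m e 1).eval σ = v at *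
  generalize (sideExp m e 2).eval σ = w at *
  generalize mirror (8 * 2 ^ ℓ) m (G e (2 ^ ℓ + l)) = g at *
  generalize mirror (8 * 2 ^ ℓ) m (o e) = p at *
  have hu : u = 0 ∨ u = 1 := by omega
  have hv : v = 0 ∨ v = 1 := by omega
  have hw : w = 0 ∨ w = 1 := by omega
  have h1W : 1 ≤ W := by omega
  have hgW : g + 1 ≤ W := by omega
  have hgW' : g - p ≤ W := by omega
  have h1s : 1 - (g - p) ≤ W := by omega
  rcases hu with rfl | rfl <;> rcases hv with rfl | rfl <;> rcases hw with rfl | rfl <;>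
    simp [h1W, hgW, hgW'] <;> try omega
  refine ⟨⟨by omega, ?_⟩, fun z => ?_⟩
  · rcases Nat.lt_or_ge p g with h1 | h1
    · rw [show 1 - (g - p) = 0 by omega]; simp
    · rw [Nat.sub_eq_zero_of_le h1]; simpa using hgW
  · rcases Nat.lt_or_ge p g with h1 | h1
    · rw [show 1 - (g - p) = 0 by omega]; simp; omega
    · rw [Nat.sub_eq_zero_of_le h1]; simp; omega

theorem rankExp_size (m : Bool) (i : ℕ) (a : IExp) : (rankExp m i a).size ≤ a.size + 7 := by
  cases m <;> simp [rankExp] <;> omega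

theorem octantValExp_size (m : Bool) (e : ℕ) : (octantValExp m e).size ≤ 150 := by
  have h1 (i : ℕ) : (rankExp m i (.reg 3 + .reg 30)).size ≤ 12 := (rankExp_size _ _ _).trans (by simp)
  have h2 (i : ℕ) : (pierceExp m i).size ≤ 5 := by cases m <;> simp [pierceExp]
  have h3 (i : ℕ) : (sideExp m e i).size ≤ 20 := by
    have := h1 i
    have := h2 i
    rw [sideExp]
    split_ifs
    · simp
    · simp; omega
  have := h1 e
  have := h2 e
  have := h3 0
  have := h3 1
  have := h3 2
  simp [octantValExp]
  omega

theorem octant_runs {kT e : ℕ} {m : Bool} (h : RankEnv W ℓ nP nQ nR G o σ) (he : e < 4)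
    (hkT : 20 ≤ kT) (hT : ∀ a, σ.int kT a = 0) :
    Runs W (octant kT m e) σ (2 * (8 * 2 ^ ℓ) * (40 * (60 * (ℓ + 6)) ^ 3 + 200) + 10) fun σ' =>
      OctantMax (8 * 2 ^ ℓ) (2 ^ ℓ) nQ (if m then nP else nR) G o m e (if m then 2 * 2 ^ ℓ else 0)
        (σ'.int (if m then 10 + e else 14 + e)) := by
  obtain ⟨hW, hpos⟩ := h.bounds
  have hP := h.hP
  have hQ := h.hQ
  have hR := h.hR
  have hk : 10 ≤ (if m then 10 + e else 14 + e) ∧ (if m then 10 + e else 14 + e) < 18 := by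
    split_ifs <;> omega
  have hnY : σ.reg (if m then 0 else 2) = (if m then nP else nR) := by
    cases m
    · exact h.r2
    · exact h.r0
  have hnY' : (if m then nP else nR) ≤ 2 ^ ℓ := by split_ifs <;> assumption
  have henv : ∀ σ', Agree (if m then 10 + e else 14 + e) kT σ σ' → RankEnv W ℓ nP nQ nR G o σ' :=
    fun σ' ha => h.congr (fun r hr _ => ha.1 r (by omega))
      fun k hk => ha.2 k (by omega) (by omega)
  have hval : ∃ V : ℕ → ℕ, ∀ σ', Agree (if m then 10 + e else 14 + e) kT σ σ' → σ'.reg 30 < nQ →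
      (octantValExp m e).ok W σ' ∧ (octantValExp m e).eval σ' = V (σ'.reg 30) := by
    -- the value depends on the index of the point only
    refine ⟨fun b => (octantValExp m e).eval (σ.set 30 b), fun σ' ha hb => ?_⟩
    have h1 := octantValExp_spec (henv σ' ha) m he hb rfl
    have hS : RankEnv W ℓ nP nQ nR G o (σ.set 30 (σ'.reg 30)) :=
      h.congr (fun r hr _ => by rw [Mem.set_reg, if_neg (by omega)]) fun _ _ => rfl
    have h2 := octantValExp_spec hS m he hb (by simp)
    refine ⟨h1.1, le_antisymm ?_ ?_⟩
    · exact (h1.2 _).2 ((h2.2 _).1 le_rfl)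
    · exact (h2.2 _).2 ((h1.2 _).1 le_rfl)
  obtain ⟨V, hV⟩ := hval
  have hVz : ∀ b < nQ, ∀ z, V b ≤ z ↔ (InOctant (8 * 2 ^ ℓ) m e o (fun i => G i (2 ^ ℓ + b)) →
      mirror (8 * 2 ^ ℓ) m (G e (2 ^ ℓ + b)) + 1 ≤ z) := by
    intro b hb z
    have ha : Agree (if m then 10 + e else 14 + e) kT σ (σ.set 30 b) :=
      ⟨fun r hr => by rw [Mem.set_reg, if_neg (by omega)], fun _ _ _ => rfl⟩
    have h1 := (hV _ ha (by simpa using hb)).2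
    simp only [Mem.set_reg, if_true] at h1
    rw [← h1]
    exact (octantValExp_spec (henv _ ha) m he hb (by simp)).2 z
  refine Runs.mono (domMax_runs (M := 8 * 2 ^ ℓ) (Lr := ℓ + 3) (V := V)
    (KI := fun t b => if t = e then 0 else mirror (8 * 2 ^ ℓ) m (G t (2 ^ ℓ + b)))
    (KQ := fun t a => if t = e then 1 else
      mirror (8 * 2 ^ ℓ) m (G t ((if m then 2 * 2 ^ ℓ else 0) + a)))
    (by rw [pow_add]; omega) h.r4 h.r5 (by simp) h.hW (by simp) (by split_ifs <;> simp) ?_ ?_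
    (by omega) hT ?_ ?_ ?_ ?_ (octantValExp_size m e) ?_ ?_) (by rw [show ℓ + 3 + 3 = ℓ + 6 by omega]) ?_
  · rw [h.r1]; omega
  · rw [hnY]; omega
  · rw [h.r1]
    intro b hb
    refine (hVz b hb W).2 fun _ => ?_
    have := mirror_le m (h.lt e he (2 ^ ℓ + b) (by omega)).le
    omega
  · rw [h.r1]
    intro b hb t ht
    have := mirror_le m (h.lt t (by omega) (2 ^ ℓ + b) (by omega)).le
    by_cases hte : t = e
    · simp only [if_pos hte]
      omega
    · simp only [if_neg hte]
      omega
  · rw [hnY]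
    intro a ha t ht
    have := mirror_le m (h.lt t (by omega) ((if m then 2 * 2 ^ ℓ else 0) + a)
      (by split_ifs <;> omega)).le
    by_cases hte : t = e
    · simp only [if_pos hte]
      omega
    · simp only [if_neg hte]
      omega
  · rw [h.r1]
    exact hV
  · rw [h.r1]
    intro t ht σ' ha hb
    have hE := henv σ' ha
    by_cases hte : t = e
    · simp [hte]
    · obtain ⟨r1, r2⟩ := rankExp_spec (i := t) (x := 2 ^ ℓ + σ'.reg 30) (a := .reg 3 + .reg 30) hE m
        (by omega) (by simp [hE.r3]; omega) (by simp [hE.r3]) (by omega)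
      simp only [if_neg hte]
      exact ⟨r1, r2, (rankExp_size _ _ _).trans (by simp)⟩
  · rw [hnY]
    intro t ht σ' ha hb
    have hE := henv σ' ha
    by_cases hte : t = e
    · simp [hte]
      omega
    · have hsz : (if m then IExp.const 2 * .reg 3 + .reg 30 else .reg 30).size ≤ 7 := by
        split_ifs <;> simp
      obtain ⟨r1, r2⟩ := rankExp_spec (i := t) (x := (if m then 2 * 2 ^ ℓ else 0) + σ'.reg 30)
        (a := if m then IExp.const 2 * .reg 3 + .reg 30 else .reg 30) hE m (by omega)
        (by split_ifs <;> simp [hE.r3] <;> omega) (by split_ifs <;> simp [hE.r3])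
        (by split_ifs <;> omega)
      simp only [if_neg hte]
      exact ⟨r1, r2, (rankExp_size _ _ _).trans (by omega)⟩
  · intro σ' hs y hy z
    rw [hnY, h.r1] at hs
    rw [hs y hy z]
    refine forall₂_congr fun l hl => ?_
    rw [hVz l hl z]
    refine imp_congr (forall₂_congr fun t ht => ?_) Iff.rfl
    by_cases hte : t = e <;> simp [hte]

end

/-- Sets register `7` to `1` if the expression `e`, which has values `0` and `1` only, has the
value `1` for some content of register `20` below that of register `n`. -/
def orLoop (n : ℕ) (e : IExp) : Cmd :=
  forLoop 20 n (assign 7 (.reg 7 + (e - .reg 7)))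

@[simp] theorem writes_orLoop (n : ℕ) (e : IExp) (l : Loc) :
    (orLoop n e).writes l ↔ l = .reg 20 ∨ l = .reg 7 := by
  simp [orLoop]

theorem orLoop_runs {W n : ℕ} {e : IExp} {σ : Mem} {E : ℕ → ℕ} (hn : n < 7) (hW : 1 ≤ W)
    (hnW : σ.reg n ≤ W) (h7 : σ.reg 7 ≤ 1) (hE : ∀ j < σ.reg n, E j ≤ 1)
    (he : ∀ σ', Frame (orLoop n e) σ σ' → σ'.reg 20 < σ.reg n →
      e.ok W σ' ∧ e.eval σ' = E (σ'.reg 20)) :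
    Runs W (orLoop n e) σ (σ.reg n * (e.size + 11) + 2) fun σ' =>
      σ'.reg 7 ≤ 1 ∧ (σ'.reg 7 = 1 ↔ σ.reg 7 = 1 ∨ ∃ j < σ.reg n, E j = 1) := by
  refine Runs.mono (Runs.forLoop (T := e.size + 6) (fun m σ' => σ'.reg 7 ≤ 1 ∧
    (σ'.reg 7 = 1 ↔ σ.reg 7 = 1 ∨ ∃ j < m, E j = 1)) (by simp) (by simp; omega) (by omega)
    (by simp) (by omega) hnW (by simp [h7]) ?_ fun σ' _ h => h) (by ring_nf; omega) fun _ h => h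
  intro j hj σ' hf hr ⟨i1, i2⟩
  obtain ⟨e1, e2⟩ := he σ' hf (by omega)
  have e3 := hE j hj
  rw [hr] at e2
  refine Runs.mono (Runs.assign ?_ ?_) (by simp; omega) (fun _ h => h)
  · simp only [IExp.ok_add, IExp.ok_sub, IExp.ok_reg, IExp.eval_sub, IExp.eval_reg, e1, e2,
      true_and]
    omega
  · have h1 : (((σ'.set 7 ((IExp.reg 7 + (e - IExp.reg 7)).eval σ')).set 20 (j + 1)).reg 7) =
        σ'.reg 7 + (E j - σ'.reg 7) := by simp [e2]
    rw [h1]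
    simp only [Nat.lt_succ_iff_lt_or_eq, or_and_right, exists_or, exists_eq_left]
    refine ⟨by omega, ?_⟩
    rw [← or_assoc, ← i2]
    omega

/-- Computes the octant maxima for the first `n` of the eight octants; the tries are the integer
arrays from `kT` on, the results are in the integer arrays from `10` on. -/
def octants (kT : ℕ) : ℕ → Cmd
  | 0 => .skip
  | n + 1 => .seq (octants kT n) (octant (kT + n) (decide (n < 4)) (n % 4))

theorem writes_octants {kT n : ℕ} {l : Loc} (hn : n ≤ 8) (h : (octants kT n).writes l) :
    (∃ r, 30 ≤ r ∧ l = .reg r) ∨ ∃ s < n, l = .int (10 + s) ∨ l = .int (kT + s) := by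
  induction n with
  | zero => exact absurd h (writes_skip l)
  | succ n ih =>
    rcases h with h | h
    · rcases ih (by omega) h with h | ⟨s, hs, h⟩
      · exact .inl h
      · exact .inr ⟨s, by omega, h⟩
    · rcases writes_domMax h with h | h | h
      · exact .inl h
      · refine .inr ⟨n, by omega, .inl ?_⟩
        rw [h]
        rcases Nat.lt_or_ge n 4 with hn | hn
        · simp [hn, Nat.mod_eq_of_lt]
        · simp [Nat.not_lt.2 hn]
          omega
      · exact .inr ⟨n, by omega, .inr h⟩

section

variable {W ℓ nP nQ nR : ℕ} {G : ℕ → ℕ → ℕ} {o : ℕ → ℕ} {σ : Mem}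

theorem octants_runs {kT n : ℕ} (h : RankEnv W ℓ nP nQ nR G o σ) (hkT : 20 ≤ kT) (hn : n ≤ 8)
    (hT : ∀ s < n, ∀ a, σ.int (kT + s) a = 0) :
    Runs W (octants kT n) σ
      (n * (2 * (8 * 2 ^ ℓ) * (40 * (60 * (ℓ + 6)) ^ 3 + 200) + 10) + 1) fun σ' => ∀ s < n,
        OctantMax (8 * 2 ^ ℓ) (2 ^ ℓ) nQ (if decide (s < 4) then nP else nR) G o (decide (s < 4))
          (s % 4) (if decide (s < 4) then 2 * 2 ^ ℓ else 0) (σ'.int (10 + s)) := by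
  induction n with
  | zero => exact Runs.mono (Runs.skip (by simp)) (by omega) fun _ h => h
  | succ n ih =>
    refine Runs.mono (Runs.seq (ih (by omega) fun s hs => hT s (by omega)) fun σ₁ h1 f1 =>
      Runs.mono (octant_runs (h.congr (fun r hr _ => f1.1 r (by omega) fun hw => ?_)
        fun k hk => f1.2.1 k fun hw => ?_) (by omega) (by omega) ?_).frame le_rfl
      fun σ₂ ⟨h2, f2⟩ s hs => ?_) (by rw [add_one_mul]; omega) fun _ h => h
    · rcases writes_octants (by omega) hw with ⟨r', h1, h2⟩ | ⟨s, hs, h | h⟩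
      · cases h2; omega
      · cases h
      · cases h
    · rcases writes_octants (by omega) hw with ⟨r', h1, h2⟩ | ⟨s, hs, h | h⟩
      · cases h2
      · simp at h; omega
      · simp at h; omega
    · intro a
      rw [f1.2.1, hT n (by omega)]
      intro hw
      rcases writes_octants (by omega) hw with ⟨r', h1, h2⟩ | ⟨s, hs, h | h⟩
      · cases h2
      · simp at h; omega
      · simp at h; omega
    · have hk : (if decide (n < 4) then 10 + n % 4 else 14 + n % 4) = 10 + n := by
        rcases Nat.lt_or_ge n 4 with hn | hn
        · simp [hn, Nat.mod_eq_of_lt]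
        · simp [Nat.not_lt.2 hn]
          omega
      rcases Nat.lt_succ_iff_lt_or_eq.1 hs with hs | rfl
      · rw [f2.2.1]
        · exact h1 s hs
        · intro hw
          rcases writes_domMax hw with ⟨r', h1, h2⟩ | h | h
          · cases h2
          · rw [hk] at h
            simp at h; omega
          · simp at h; omega
      · rw [hk] at h2
        exact h2

/-- Decides by a dominance maximum in eleven dimensions whether some pair is bad: `p` must be below
`r` in the three coordinates, and no octant may contain a point of their box. -/
def pairSearch (kT : ℕ) : Cmd :=
  domMax 11 0 2 (.const 1)
    (fun t => if t < 3 then .get t (.reg 6 + (.const 3 * .reg 3 + .reg 30))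
      else if t < 7 then .get (10 + (t - 3)) (.reg 30)
      else .get (t - 7) (.reg 6 + (.const 2 * .reg 3 + .reg 30)))
    (fun t => if t < 3 then .get t (.reg 6 + (.const 4 * .reg 3 + .reg 30))
      else if t < 7 then .get (t - 3) (.reg 6 + .reg 30) + .const 1
      else .reg 5 + .const 1 - .get (10 + (4 + (t - 7))) (.reg 30))
    18 kT

/-- Octant maxima are small enough to serve as keys. -/
theorem OctantMax.le {M N nQ nY : ℕ} {m : Bool} {e off y : ℕ} {Out : ℕ → ℕ}
    (h : OctantMax M N nQ nY G o m e off Out) (hG : ∀ l < nQ, G e (N + l) ≤ M) (hy : y < nY) :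
    Out y ≤ M + 1 :=
  (h y hy _).2 fun l hl _ _ => Nat.succ_le_succ (mirror_le m (hG l hl))

/-- The result for `k` is positive iff some `j` satisfies all eleven comparisons. -/
theorem pairSearch_runs {kT : ℕ} (h : RankEnv W ℓ nP nQ nR G o σ) (hkT : 20 ≤ kT)
    (hT : ∀ a, σ.int kT a = 0) {Out : ℕ → ℕ → ℕ} (hOut : ∀ s < 8, σ.int (10 + s) = Out s)
    (hup : ∀ e < 4, ∀ j < nP, Out e j ≤ 8 * 2 ^ ℓ + 1) :
    Runs W (pairSearch kT) σ (2 * (8 * 2 ^ ℓ) * (40 * (60 * (ℓ + 6)) ^ 11 + 200) + 10) fun σ' =>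
      ∀ k < nR, ∀ z, σ'.int 18 k ≤ z ↔ ∀ j < nP,
        ((∀ i < 3, G i (3 * 2 ^ ℓ + j) < G i (4 * 2 ^ ℓ + k)) ∧
          (∀ e < 4, Out e j < G e k + 1) ∧
          ∀ e < 4, G e (2 * 2 ^ ℓ + j) < 8 * 2 ^ ℓ + 1 - Out (4 + e) k) → 1 ≤ z := by
  obtain ⟨hW, hpos⟩ := h.bounds
  have hP := h.hP
  have hR := h.hR
  have henv : ∀ σ', Agree 18 kT σ σ' → RankEnv W ℓ nP nQ nR G o σ' ∧
      ∀ s < 8, σ'.int (10 + s) = Out s := fun σ' ha =>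
    ⟨h.congr (fun r hr _ => ha.1 r (by omega)) fun k hk => ha.2 k (by omega) (by omega),
      fun s hs => by rw [ha.2 _ (by omega) (by omega), hOut s hs]⟩
  refine Runs.mono (domMax_runs (M := 8 * 2 ^ ℓ) (Lr := ℓ + 3) (V := fun _ => 1)
    (KI := fun t j => if t < 3 then G t (3 * 2 ^ ℓ + j) else if t < 7 then Out (t - 3) j
      else G (t - 7) (2 * 2 ^ ℓ + j))
    (KQ := fun t k => if t < 3 then G t (4 * 2 ^ ℓ + k) else if t < 7 then G (t - 3) k + 1
      else 8 * 2 ^ ℓ + 1 - Out (4 + (t - 7)) k)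
    (by rw [pow_add]; omega) h.r4 h.r5 (by simp) h.hW (by simp) (by simp) ?_ ?_
    (by omega) hT ?_ ?_ ?_ ?_ (by simp) ?_ ?_) (by rw [show ℓ + 3 + 3 = ℓ + 6 by omega]) ?_
  · rw [h.r0]; omega
  · rw [h.r2]; omega
  · intro _ _
    omega
  · rw [h.r0]
    intro j hj t ht
    split_ifs with h1 h2
    · have := h.lt t (by omega) (3 * 2 ^ ℓ + j) (by omega)
      omega
    · have := hup (t - 3) (by omega) j hj
      omega
    · have := h.lt (t - 7) (by omega) (2 * 2 ^ ℓ + j) (by omega)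
      omega
  · rw [h.r2]
    intro k hk t ht
    split_ifs with h1 h2
    · have := h.lt t (by omega) (4 * 2 ^ ℓ + k) (by omega)
      omega
    · have := h.lt (t - 3) (by omega) k (by omega)
      omega
    · omega
  · intro σ' _ _
    simp
    omega
  · rw [h.r0]
    intro t ht σ' ha hj
    obtain ⟨hE, hO⟩ := henv σ' ha
    have h6 := hE.r6
    have h3 := hE.r3
    split_ifs with h1 h2
    · have := hE.int t (by omega) (3 * 2 ^ ℓ + σ'.reg 30)
      simp [h6, h3, this]
      omega
    · have := hO (t - 3) (by omega)
      simp [this]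
      omega
    · have := hE.int (t - 7) (by omega) (2 * 2 ^ ℓ + σ'.reg 30)
      simp [h6, h3, this]
      omega
  · rw [h.r2]
    intro t ht σ' ha hk
    obtain ⟨hE, hO⟩ := henv σ' ha
    have h6 := hE.r6
    have h3 := hE.r3
    have h5 := hE.r5
    split_ifs with h1 h2
    · have := hE.int t (by omega) (4 * 2 ^ ℓ + σ'.reg 30)
      simp [h6, h3, this]
      omega
    · have := hE.int (t - 3) (by omega) (σ'.reg 30)
      have := h.lt (t - 3) (by omega) (σ'.reg 30) (by omega)
      simp [h6, hE.int (t - 3) (by omega) (σ'.reg 30)]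
      omega
    · have := hO (4 + (t - 7)) (by omega)
      simp [h5, this]
      omega
  · intro σ' hs k hk z
    rw [h.r2, h.r0] at hs
    rw [hs k hk z]
    refine forall₂_congr fun j hj => imp_congr ?_ Iff.rfl
    constructor
    · intro ht
      refine ⟨fun i hi => ?_, fun e he => ?_, fun e he => ?_⟩
      · simpa [hi] using ht i (by omega)
      · simpa [show e + 3 < 7 by omega] using ht (e + 3) (by omega)
      · simpa [show ¬ e + 7 < 3 by omega] using ht (e + 7) (by omega)
    · rintro ⟨h1, h2, h3⟩ t ht
      split_ifs with c1 c2
      · exact h1 t c1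
      · exact h2 _ (by omega)
      · exact h3 _ (by omega)

end

/-- Ranks the first `n` coordinates of the points, multiplied by the signs `c`. -/
def ranks (aP aQ aR : ℕ) (c : ℕ → ℚ) : ℕ → Cmd
  | 0 => .skip
  | n + 1 => .seq (ranks aP aQ aR c n) (rankCoord aP aQ aR n (c n))

theorem writes_ranks {aP aQ aR n : ℕ} {c : ℕ → ℚ} {l : Loc}
    (h : (ranks aP aQ aR c n).writes l) :
    (∃ r, (10 ≤ r ∧ r < 10 + n ∨ 20 ≤ r) ∧ l = .reg r) ∨ (∃ k, (k < n ∨ k = 4) ∧ l = .int k) ∨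
      l = .real 20 := by
  induction n with
  | zero => exact absurd h (writes_skip l)
  | succ n ih =>
    rcases h with h | h
    · rcases ih h with ⟨r, hr, rfl⟩ | ⟨k, hk, rfl⟩ | h
      · exact .inl ⟨r, by omega, rfl⟩
      · exact .inr (.inl ⟨k, by omega, rfl⟩)
      · exact .inr (.inr h)
    · rcases writes_rankCoord h with ⟨r, h1, -, rfl⟩ | rfl | rfl | rfl | h
      · exact .inl ⟨r, .inr h1, rfl⟩
      · exact .inl ⟨_, by omega, rfl⟩
      · exact .inr (.inl ⟨_, by omega, rfl⟩)
      · exact .inr (.inl ⟨_, by omega, rfl⟩)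
      · exact .inr (.inr h)

section

variable {W ℓ nP nQ nR : ℕ} {σ : Mem}

theorem ranks_runs {aP aQ aR n : ℕ} {c : ℕ → ℚ} (hS : Setup W ℓ nP nQ nR σ) (hP : aP < 17)
    (hQ : aQ < 17) (hR : aR < 17) (hn : n ≤ 3) :
    Runs W (ranks aP aQ aR c n) σ
      (n * ((ℓ + 3) * (8 * 2 ^ ℓ * ((ℓ + 3) * 60 + 250) + 20) + 2 ^ ℓ * 300 + 100) + 1) fun σ' =>
      ∀ i < n, Ranked (2 ^ ℓ) nP nQ nR (fun j => c i * σ.real (aP + i) j)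
        (fun l => c i * σ.real (aQ + i) l) (fun k => c i * σ.real (aR + i) k)
        (fun x => σ'.int i ((ℓ + 3) * (8 * 2 ^ ℓ) + x)) (σ'.reg (10 + i)) := by
  induction n with
  | zero => exact Runs.mono (Runs.skip (by simp)) (by omega) fun _ h => h
  | succ n ih =>
    refine Runs.mono (Runs.seq (ih (by omega)) fun σ₁ h1 f1 =>
      Runs.mono (rankCoord_runs (aP := aP) (aQ := aQ) (aR := aR) (i := n) (c := c n)
      (hS.congr fun r hr => f1.1 r (by omega) fun hw => ?_) (by omega) (by omega) (by omega)
        (by omega)).frame le_rfl fun σ₂ ⟨h2, f2⟩ i hi => ?_)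
      (by rw [add_one_mul]; omega) fun _ h => h
    · rcases writes_ranks hw with ⟨r', h1, h2⟩ | ⟨k, -, h⟩ | h
      · cases h2; omega
      · cases h
      · cases h
    · have hreal : ∀ k < 20, σ₁.real k = σ.real k := fun k hk => f1.2.2 k fun hw => by
        rcases writes_ranks hw with ⟨r', h1, h2⟩ | ⟨k, -, h⟩ | h
        · cases h2
        · cases h
        · cases h; omega
      rcases Nat.lt_succ_iff_lt_or_eq.1 hi with hi | rfl
      · have e1 : σ₂.int i = σ₁.int i := f2.2.1 i fun hw => by
          rcases writes_rankCoord hw with ⟨r, -, -, h⟩ | h | h | h | h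
          · cases h
          · cases h
          · cases h; omega
          · cases h; omega
          · cases h
        have e2 : σ₂.reg (10 + i) = σ₁.reg (10 + i) := f2.1 _ (by omega) fun hw => by
          rcases writes_rankCoord hw with ⟨r, h1, -, h⟩ | h | h | h | h
          · cases h; omega
          · simp at h; omega
          · cases h
          · cases h
          · cases h
        rw [e1, e2]
        exact h1 i hi
      · rw [hreal _ (by omega), hreal _ (by omega), hreal _ (by omega)] at h2
        exact h2

/-- Sets register `7` to `1` if a box is not pierced in one of the first `n` dimensions. -/
def pierceTests : ℕ → Cmd
  | 0 => .skip
  | n + 1 => .seq (pierceTests n) (orLoop 0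
      (.const 1 - (.get n (.reg 6 + (.const 2 * .reg 3 + .reg 20)) + .const 1 - .reg (10 + n))))

theorem writes_pierceTests {n : ℕ} {l : Loc} (h : (pierceTests n).writes l) :
    l = .reg 20 ∨ l = .reg 7 := by
  induction n with
  | zero => exact absurd h (writes_skip l)
  | succ n ih =>
    rcases h with h | h
    · exact ih h
    · simpa using h

variable {G : ℕ → ℕ → ℕ} {o : ℕ → ℕ}

theorem pierceTests_runs {n : ℕ} (h : RankEnv W ℓ nP nQ nR G o σ) (hn : n ≤ 3)
    (h7 : σ.reg 7 ≤ 1) :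
    Runs W (pierceTests n) σ (n * (2 ^ ℓ * 40 + 2) + 1) fun σ' =>
      σ'.reg 7 ≤ 1 ∧
        (σ'.reg 7 = 1 ↔ σ.reg 7 = 1 ∨ ∃ i < n, ∃ j < nP, G i (2 * 2 ^ ℓ + j) < o i) := by
  induction n with
  | zero => exact Runs.mono (Runs.skip (by simp [h7])) (by omega) fun _ h => h
  | succ n ih =>
    refine Runs.mono (Runs.seq (T₂ := 2 ^ ℓ * 40 + 2) (ih (by omega)) fun σ₁ ⟨h1, h2⟩ f1 => ?_)
      (by rw [add_one_mul]; omega) fun _ h => h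
    have hE : RankEnv W ℓ nP nQ nR G o σ₁ := h.congr
      (fun r hr hr' => f1.1 r (by omega) fun hw => by
        rcases writes_pierceTests hw with h | h
        · cases h; omega
        · cases h; omega)
      (fun k hk => f1.2.1 k fun hw => by rcases writes_pierceTests hw with h | h <;> cases h)
    obtain ⟨hW, hpos⟩ := hE.bounds
    have hP := hE.hP
    refine Runs.mono (orLoop_runs (E := fun j => 1 - (G n (2 * 2 ^ ℓ + j) + 1 - o n)) (by simp)
      (by omega) (by rw [hE.r0]; omega) h1 (fun _ _ => by omega) fun σ' f2 hj => ?_) ?_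
      fun σ' h' => ⟨h'.1, ?_⟩
    · have hE' : RankEnv W ℓ nP nQ nR G o σ' := hE.congr
        (fun r hr hr' => f2.1 r (by omega) (by simp; omega)) (fun k hk => f2.2.1 k (by simp))
      rw [hE.r0] at hj
      have := hE.lt n (by omega) (2 * 2 ^ ℓ + σ'.reg 20) (by omega)
      have := hE.le n (by omega)
      simp [hE'.r6, hE'.r3, hE'.int n (by omega) (2 * 2 ^ ℓ + σ'.reg 20), hE'.reg n (by omega)]
      omega
    · rw [hE.r0]
      have := Nat.mul_le_mul_right 40 hP
      simp
      omega
    · rw [h'.2, h2, hE.r0]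
      simp only [Nat.lt_succ_iff_lt_or_eq (n := n), or_and_right, exists_or, exists_eq_left,
        or_assoc]
      refine or_congr Iff.rfl (or_congr Iff.rfl (exists_congr fun j => and_congr Iff.rfl ?_))
      omega

/-- Searches for bad pairs, given the ranks. The tries are the integer arrays from `kT` on. -/
def search (kT : ℕ) : Cmd :=
  .seq (pierceTests 3) (.seq (octants kT 8) (.seq (pairSearch (kT + 8))
    (orLoop 2 (.get 18 (.reg 20)))))

theorem writes_search {kT : ℕ} {l : Loc} (h : (search kT).writes l) :
    (∃ r, (r = 7 ∨ 20 ≤ r) ∧ l = .reg r) ∨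
      ∃ k, (10 ≤ k ∧ k < 19 ∨ kT ≤ k ∧ k < kT + 9) ∧ l = .int k := by
  rcases h with h | h | h | h
  · rcases writes_pierceTests h with h | h
    · exact .inl ⟨_, by simp, h⟩
    · exact .inl ⟨_, by simp, h⟩
  · rcases writes_octants le_rfl h with ⟨r, h1, h2⟩ | ⟨s, hs, h | h⟩
    · exact .inl ⟨r, by omega, h2⟩
    · exact .inr ⟨_, by omega, h⟩
    · exact .inr ⟨_, by omega, h⟩
  · rcases writes_domMax h with ⟨r, h1, h2⟩ | h | h
    · exact .inl ⟨r, by omega, h2⟩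
    · exact .inr ⟨_, by omega, h⟩
    · exact .inr ⟨_, by omega, h⟩
  · rcases (writes_orLoop _ _ _).1 h with h | h
    · exact .inl ⟨_, by simp, h⟩
    · exact .inl ⟨_, by simp, h⟩

/-- Register `7` tells whether there is a bad pair: either some box is not pierced, because a pair is
further apart than `2` in one coordinate, or some pierced box contains no point. -/
theorem search_runs {kT : ℕ} {p q r : ℕ → ℕ → ℝ} (h : RankEnv W ℓ nP nQ nR G o σ) (hkT : 20 ≤ kT)
    (hT : ∀ s < 9, ∀ a, σ.int (kT + s) a = 0) (h7 : σ.reg 7 ≤ 1)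
    (hG : ∀ i < 3, Ranked (2 ^ ℓ) nP nQ nR (p i) (q i) (r i) (G i) (o i))
    (hG3 : ∀ x, G 3 x = 0) (ho3 : o 3 = 0) :
    Runs W (search kT) σ (2000 * (2 ^ ℓ * (60 * (ℓ + 6)) ^ 11)) fun σ' =>
      σ'.reg 7 ≤ 1 ∧ (σ'.reg 7 = 1 ↔ σ.reg 7 = 1 ∨
        (∃ i < 3, ∃ j < nP, ∃ k < nR, p i j + 1 < r i k - 1) ∨
        ∃ j < nP, ∃ k < nR, (∀ i < 3, p i j ≤ r i k) ∧
          ¬ ∃ l < nQ, ∀ i < 3, r i k - 1 ≤ q i l ∧ q i l ≤ p i j + 1) := by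
  obtain ⟨hW, hpos⟩ := h.bounds
  have hP := h.hP
  have hQ := h.hQ
  have hR := h.hR
  have hmid : ∀ σ', (∀ r < 14, r ≠ 7 → σ'.reg r = σ.reg r) → (∀ k < 4, σ'.int k = σ.int k) →
      RankEnv W ℓ nP nQ nR G o σ' := fun σ' => h.congr
  have hX : 100 ≤ 60 * (ℓ + 6) := by omega
  have not_pt : ∀ {l}, l ≠ .reg 20 → l ≠ .reg 7 → ¬ (pierceTests 3).writes l :=
    fun h1 h2 hw => (writes_pierceTests hw).elim h1 h2
  have not_oc : ∀ {l}, (∀ r, 30 ≤ r → l ≠ .reg r) → (∀ s < 8, l ≠ .int (10 + s)) →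
      (∀ s < 8, l ≠ .int (kT + s)) → ¬ (octants kT 8).writes l := by
    intro l h1 h2 h3 hw
    rcases writes_octants le_rfl hw with ⟨r, hr, h⟩ | ⟨s, hs, h | h⟩
    · exact h1 r hr h
    · exact h2 s hs h
    · exact h3 s hs h
  have not_ps : ∀ {r}, r < 30 → ¬ (pairSearch (kT + 8)).writes (.reg r) := by
    intro r hr hw
    rcases writes_domMax hw with ⟨r', h1, h⟩ | h | h
    · cases h; omega
    · cases h
    · cases h
  have reg_eq : ∀ σ₁ σ₂ σ₃, Frame (pierceTests 3) σ σ₁ → Frame (octants kT 8) σ₁ σ₂ →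
      Frame (pairSearch (kT + 8)) σ₂ σ₃ → ∀ r < 14, r ≠ 7 → σ₃.reg r = σ.reg r :=
    fun σ₁ σ₂ σ₃ f1 f2 f3 r hr hr' => ((f3.1 r (by omega) (not_ps (by omega))).trans
      (f2.1 r (by omega) (not_oc (by simp; omega) (by simp) (by simp)))).trans
      (f1.1 r (by omega) (not_pt (by simp; omega) (by simpa using hr')))
  refine Runs.mono (Runs.seq (pierceTests_runs h le_rfl h7) fun σ₁ ⟨h1, h1'⟩ f1 => Runs.seq
    (Q₁ := fun σ' => ∀ s < 8, OctantMax (8 * 2 ^ ℓ) (2 ^ ℓ) nQ (if decide (s < 4) then nP else nR)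
      G o (decide (s < 4)) (s % 4) (if decide (s < 4) then 2 * 2 ^ ℓ else 0) (σ'.int (10 + s)))
    (octants_runs (hmid σ₁ ?_ ?_) hkT le_rfl ?_) fun σ₂ h2 f2 => Runs.seq
    (pairSearch_runs (Out := fun s => σ₂.int (10 + s)) (hmid σ₂ ?_ ?_) (by omega) ?_
      (fun _ _ => rfl) ?_) fun σ₃ h3 f3 => Runs.mono (orLoop_runs (E := σ₃.int 18) (by simp)
      (by omega) ?_ ?_ ?_ ?_) (T := 2 ^ ℓ * 40 + 2) ?_ fun σ' h4 => ⟨h4.1, ?_⟩) ?_ fun _ h => h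
  · exact fun r hr hr' => f1.1 r (by omega) (not_pt (by simp; omega) (by simpa using hr'))
  · exact fun k _ => f1.2.1 k (not_pt (by simp) (by simp))
  · intro s hs a
    rw [f1.2.1 _ (not_pt (by simp) (by simp)), hT s (by omega)]
  · exact fun r hr hr' => (f2.1 r (by omega) (not_oc (by simp; omega) (by simp) (by simp))).trans
      (f1.1 r (by omega) (not_pt (by simp; omega) (by simpa using hr')))
  · exact fun k hk => (f2.2.1 k (not_oc (by simp) (by simp; omega) (by simp; omega))).trans
      (f1.2.1 k (not_pt (by simp) (by simp)))
  · intro a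
    rw [f2.2.1 _ (not_oc (by simp) (by simp; omega) (by simp; omega)),
      f1.2.1 _ (not_pt (by simp) (by simp)), hT 8 (by omega)]
  · intro e he j hj
    have h2e := h2 e (by omega)
    rw [Nat.mod_eq_of_lt he] at h2e
    exact h2e.le (fun l hl => (h.lt e he _ (by omega)).le) (by simpa [he] using hj)
  · rw [reg_eq σ₁ σ₂ σ₃ f1 f2 f3 2 (by simp) (by simp), h.r2]
    omega
  · rw [f3.1 7 (by simp) (not_ps (by simp)),
      f2.1 7 (by simp) (not_oc (by simp; omega) (by simp) (by simp))]
    exact h1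
  · rw [reg_eq σ₁ σ₂ σ₃ f1 f2 f3 2 (by simp) (by simp), h.r2]
    exact fun k hk => (h3 k hk 1).2 fun _ _ _ => le_rfl
  · intro σ' hf hk
    rw [reg_eq σ₁ σ₂ σ₃ f1 f2 f3 2 (by simp) (by simp), h.r2] at hk
    have := hf.2.1 18 (by simp)
    simp [this]
    omega
  · rw [reg_eq σ₁ σ₂ σ₃ f1 f2 f3 2 (by simp) (by simp), h.r2]
    have := Nat.mul_le_mul_right 40 hR
    simp
    omega
  · generalize 60 * (ℓ + 6) = X at hX
    have hX3 : X ^ 3 * 100 ≤ X ^ 11 ∧ 10 ^ 6 ≤ X ^ 11 := by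
      have e1 : 100 ≤ X ^ 8 := (show 100 ≤ 100 ^ 8 by simp).trans (Nat.pow_le_pow_left hX 8)
      have e2 : 10 ^ 6 ≤ X ^ 3 := (show 10 ^ 6 ≤ 100 ^ 3 by simp).trans (Nat.pow_le_pow_left hX 3)
      have e3 : X ^ 11 = X ^ 3 * X ^ 8 := by rw [← pow_add]
      rw [e3]
      exact ⟨Nat.mul_le_mul_left _ e1, e2.trans (Nat.le_mul_of_pos_right _ (by omega))⟩
    have e1 := Nat.mul_le_mul_left (2 ^ ℓ) hX3.1
    have e2 := Nat.mul_le_mul_left (2 ^ ℓ) hX3.2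
    generalize X ^ 3 = Y at *
    generalize X ^ 11 = Z at *
    generalize 2 ^ ℓ = N at *
    have a1 : 2 * (8 * N) * (40 * Y + 200) = 640 * (N * Y) + 3200 * N := by ring
    have a2 : 2 * (8 * N) * (40 * Z + 200) = 640 * (N * Z) + 3200 * N := by ring
    rw [a1, a2]
    rw [← mul_assoc] at e1
    omega
  -- the meaning of the result
  · rw [h4.2, f3.1 7 (by simp) (not_ps (by simp)),
      f2.1 7 (by simp) (not_oc (by simp; omega) (by simp) (by simp)), h1',
      reg_eq σ₁ σ₂ σ₃ f1 f2 f3 2 (by simp) (by simp), h.r2, or_assoc]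
    refine or_congr Iff.rfl ?_
    -- `o i` is a rank of some `r i k - 1`, and different positions have different ranks
    have hpin : ∀ i < 3, ∀ j < nP, G i (2 * 2 ^ ℓ + j) < o i ↔
        ∃ k < nR, p i j + 1 < r i k - 1 := by
      intro i hi j hj
      rw [← not_le, (hG i hi).top]
      push Not
      refine exists_congr fun k => and_congr_right fun hk => ?_
      rw [show p i j + 1 < r i k - 1 ↔ ¬ r i k - 1 ≤ p i j + 1 from not_le.symm,
        ← (hG i hi).rp k hk j hj, not_lt]
      refine ⟨le_of_lt, fun hle => lt_of_le_of_ne hle fun he => ?_⟩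
      have := (hG i hi).inj _ (by omega) _ (by omega) he
      omega
    have hpins : (∃ i < 3, ∃ j < nP, G i (2 * 2 ^ ℓ + j) < o i) ↔
        ∃ i < 3, ∃ j < nP, ∃ k < nR, p i j + 1 < r i k - 1 :=
      exists_congr fun i => and_congr_right fun hi => exists_congr fun j =>
        and_congr_right fun hj => hpin i hi j hj
    rw [hpins]
    -- a far pair settles the question; without one, all boxes are pierced
    by_cases hfar : ∃ i < 3, ∃ j < nP, ∃ k < nR, p i j + 1 < r i k - 1
    · simp only [hfar, true_or]
    · refine or_congr Iff.rfl ?_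
      have hpierced : ∀ j < nP, ∀ i < 3, o i ≤ G i (2 * 2 ^ ℓ + j) := by
        intro j hj i hi
        by_contra hc
        exact hfar (hpins.1 ⟨i, hi, j, hj, not_le.1 hc⟩)
      have hiff : ∀ k < nR, (σ₃.int 18 k = 1 ↔ ∃ j < nP, (∀ i < 3, p i j ≤ r i k) ∧
          ¬ ∃ l < nQ, ∀ i < 3, r i k - 1 ≤ q i l ∧ q i l ≤ p i j + 1) := by
        intro k hk
        have hle : σ₃.int 18 k ≤ 1 := (h3 k hk 1).2 fun _ _ _ => le_rfl
        have hz := h3 k hk 0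
        rw [show (σ₃.int 18 k = 1 ↔ ¬ σ₃.int 18 k ≤ 0) by omega, hz]
        push Not
        refine exists_congr fun j => and_congr_right fun hj => ?_
        have hbox := box_empty_iff (Out := fun s => σ₂.int (10 + s)) hP hQ hR hG hG3 ho3 hj hk
          (hpierced j hj) (fun e he => by
            have := h2 e (by omega)
            rwa [Nat.mod_eq_of_lt he, decide_eq_true he] at this) (fun e he => by
            have := h2 (4 + e) (by omega)
            rwa [show (4 + e) % 4 = e by omega, decide_eq_false (by omega)] at this)
        push Not at hbox
        rw [← hbox, ← forall₂_congr fun i hi => (hG i hi).pr j hj k hk]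
        simp
      constructor
      · rintro ⟨k, hk, h⟩
        obtain ⟨j, hj, h'⟩ := (hiff k hk).1 h
        exact ⟨j, hj, k, hk, h'⟩
      · rintro ⟨j, hj, k, hk, h'⟩
        exact ⟨k, hk, (hiff k hk).2 ⟨j, hj, h'⟩⟩

end

/-! ### All pairs of points -/

/-- No point `q` is within distance `1` of both point `j` of `p` and point `k` of `r` in all
three coordinates. -/
def Unlinked (nQ : ℕ) (p q r : ℕ → ℕ → ℝ) (j k : ℕ) : Prop :=
  ¬ ∃ l < nQ, ∀ i < 3, |q i l - p i j| ≤ 1 ∧ |q i l - r i k| ≤ 1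

/-- Searches for bad pairs among those with `p` below `r` in the three coordinates, after
multiplication by the signs `c`. -/
def orthant (aP aQ aR kT : ℕ) (c : ℕ → ℚ) : Cmd :=
  .seq (ranks aP aQ aR c 3) (search kT)

theorem writes_orthant {aP aQ aR kT : ℕ} {c : ℕ → ℚ} {l : Loc}
    (h : (orthant aP aQ aR kT c).writes l) :
    (∃ r, (r = 7 ∨ 10 ≤ r ∧ r < 13 ∨ 20 ≤ r) ∧ l = .reg r) ∨
      (∃ k, (k ≠ 3 ∧ k < 20 ∨ kT ≤ k ∧ k < kT + 9) ∧ l = .int k) ∨ l = .real 20 := by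
  rcases h with h | h
  · rcases writes_ranks h with ⟨r, hr, h⟩ | ⟨k, hk, h⟩ | h
    · exact .inl ⟨r, by omega, h⟩
    · exact .inr (.inl ⟨k, by omega, h⟩)
    · exact .inr (.inr h)
  · rcases writes_search h with ⟨r, hr, h⟩ | ⟨k, hk, h⟩
    · exact .inl ⟨r, by omega, h⟩
    · exact .inr (.inl ⟨k, by omega, h⟩)

/-- In an orthant in which `p` is below `r`, the common neighbourhood is a box. -/
theorem abs_le_one_and_iff_of_sign {c p q r : ℝ} (hc : c = 1 ∨ c = -1) (h : c * p ≤ c * r) :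
    |q - p| ≤ 1 ∧ |q - r| ≤ 1 ↔ c * r - 1 ≤ c * q ∧ c * q ≤ c * p + 1 := by
  rw [abs_le, abs_le]
  rcases hc with rfl | rfl
  · constructor
    · rintro ⟨⟨h1, h2⟩, h3, h4⟩
      constructor <;> linarith
    · rintro ⟨h1, h2⟩
      refine ⟨⟨?_, ?_⟩, ?_, ?_⟩ <;> linarith
  · constructor
    · rintro ⟨⟨h1, h2⟩, h3, h4⟩
      constructor <;> linarith
    · rintro ⟨h1, h2⟩
      refine ⟨⟨?_, ?_⟩, ?_, ?_⟩ <;> linarith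

/-- A pair at distance more than `2` in one coordinate is bad. -/
theorem unlinked_of_far {nQ : ℕ} {p q r : ℕ → ℕ → ℝ} {c : ℝ} {i j k : ℕ} (hc : c = 1 ∨ c = -1)
    (hi : i < 3) (h : c * p i j + 1 < c * r i k - 1) : Unlinked nQ p q r j k := by
  rintro ⟨l, -, hl⟩
  have := (abs_le_one_and_iff_of_sign hc (by linarith)).1 (hl i hi)
  linarith

section

variable {W ℓ nP nQ nR aP aQ aR : ℕ} {σ : Mem}

theorem ranks_time_le (ℓ : ℕ) :
    3 * ((ℓ + 3) * (8 * 2 ^ ℓ * ((ℓ + 3) * 60 + 250) + 20) + 2 ^ ℓ * 300 + 100) + 1 ≤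
      2 ^ ℓ * (60 * (ℓ + 6)) ^ 11 := by
  obtain ⟨X, hX⟩ : ∃ X, X = 60 * (ℓ + 6) := ⟨_, rfl⟩
  obtain ⟨N, hN⟩ : ∃ N, N = 2 ^ ℓ := ⟨_, rfl⟩
  have hN1 : 1 ≤ N := hN ▸ Nat.one_le_two_pow
  have hX1 : 360 ≤ X := by omega
  rw [← hX, ← hN]
  calc 3 * ((ℓ + 3) * (8 * N * ((ℓ + 3) * 60 + 250) + 20) + N * 300 + 100) + 1
      ≤ 3 * (X * (8 * N * (2 * X) + 20 * (N * X)) + N * X * X + N * X * X) + N * X * X := by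
        have e1 : 1 ≤ N * X := Nat.mul_pos hN1 (by omega)
        have e2 : 1 * 300 ≤ X * X := Nat.mul_le_mul (by omega) (by omega)
        have e3 : N * (1 * 300) ≤ N * (X * X) := Nat.mul_le_mul_left N e2
        rw [← mul_assoc] at e3
        rw [mul_assoc N X X]
        gcongr <;> omega
    _ = 115 * (N * X ^ 2) := by ring
    _ ≤ N * X ^ 3 := by
        rw [mul_left_comm, pow_succ' X 2]
        gcongr
        omega
    _ ≤ N * X ^ 11 := by
        gcongr <;> omega

theorem orthant_runs {kT : ℕ} {c : ℕ → ℚ} (hS : Setup W ℓ nP nQ nR σ)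
    (hP : aP < 17) (hQ : aQ < 17) (hR : aR < 17) (hc : ∀ i, c i = 1 ∨ c i = -1)
    (h3 : ∀ x, σ.int 3 x = 0) (hkT : 20 ≤ kT) (hT : ∀ s < 9, ∀ a, σ.int (kT + s) a = 0)
    (h7 : σ.reg 7 ≤ 1) :
    Runs W (orthant aP aQ aR kT c) σ (3000 * (2 ^ ℓ * (60 * (ℓ + 6)) ^ 11)) fun σ' =>
      σ'.reg 7 ≤ 1 ∧ (σ.reg 7 = 1 → σ'.reg 7 = 1) ∧
      (σ'.reg 7 = 1 → σ.reg 7 = 1 ∨ ∃ j < nP, ∃ k < nR, Unlinked nQ (fun i => σ.real (aP + i))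
        (fun i => σ.real (aQ + i)) (fun i => σ.real (aR + i)) j k) ∧
      ∀ j < nP, ∀ k < nR, (∀ i < 3, c i * σ.real (aP + i) j ≤ c i * σ.real (aR + i) k) →
        Unlinked nQ (fun i => σ.real (aP + i)) (fun i => σ.real (aQ + i))
          (fun i => σ.real (aR + i)) j k → σ'.reg 7 = 1 := by
  have hcr : ∀ i, (c i : ℝ) = 1 ∨ (c i : ℝ) = -1 := fun i => by
    rcases hc i with h | h <;> simp [h]
  have hnot : ∀ {l}, (∀ r, (10 ≤ r ∧ r < 13 ∨ 20 ≤ r) → l ≠ .reg r) →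
      (∀ k, (k < 3 ∨ k = 4) → l ≠ .int k) → l ≠ .real 20 →
      ¬ (ranks aP aQ aR c 3).writes l := by
    intro l h1 h2 h3 hw
    rcases writes_ranks hw with ⟨r, hr, h⟩ | ⟨k, hk, h⟩ | h
    · exact h1 r (by omega) h
    · exact h2 k hk h
    · exact h3 h
  have hboxes : ∀ j k, (∀ i < 3, c i * σ.real (aP + i) j ≤ c i * σ.real (aR + i) k) →
      ((¬ ∃ l < nQ, ∀ i < 3, c i * σ.real (aR + i) k - 1 ≤ c i * σ.real (aQ + i) l ∧
        c i * σ.real (aQ + i) l ≤ c i * σ.real (aP + i) j + 1) ↔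
      Unlinked nQ (fun i => σ.real (aP + i)) (fun i => σ.real (aQ + i))
          (fun i => σ.real (aR + i)) j k) := fun j k h =>
    not_congr (exists_congr fun l => and_congr_right fun _ => forall₂_congr fun i hi =>
      (abs_le_one_and_iff_of_sign (hcr i) (h i hi)).symm)
  refine Runs.mono (Runs.seq (ranks_runs (aP := aP) (aQ := aQ) (aR := aR) (c := c) hS hP hQ hR
    le_rfl) fun σ₁ h1 f1 => Runs.mono (search_runs
      (G := fun i x => σ₁.int i ((ℓ + 3) * (8 * 2 ^ ℓ) + x)) (o := fun i => σ₁.reg (10 + i))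
      (p := fun i j => c i * σ.real (aP + i) j) (q := fun i l => c i * σ.real (aQ + i) l)
      (r := fun i k => c i * σ.real (aR + i) k) ?_ hkT ?_ ?_ h1 ?_ ?_) le_rfl
      fun σ' ⟨e1, e2⟩ => ?_) ?_ fun _ h => h
  · have hS1 : Setup W ℓ nP nQ nR σ₁ := hS.congr fun r hr =>
      f1.1 r (by omega) (hnot (by simp; omega) (by simp) (by simp))
    have hz : ∀ x, σ₁.int 3 x = 0 := by
      rw [f1.2.1 3 (hnot (by simp) (by simp; omega) (by simp))]
      exact h3
    have hlt : ∀ i < 4, ∀ x < 8 * 2 ^ ℓ, σ₁.int i ((ℓ + 3) * (8 * 2 ^ ℓ) + x) < 8 * 2 ^ ℓ := by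
      intro i hi x hx
      rcases Nat.lt_succ_iff_lt_or_eq.1 hi with hi | rfl
      · exact (h1 i hi).lt x hx
      · rw [hz]
        omega
    refine ⟨hS1, fun _ _ _ => rfl, fun _ _ => rfl, hlt, fun i hi => ?_⟩
    rcases Nat.lt_succ_iff_lt_or_eq.1 hi with hi' | rfl
    · have hR := hS.hR
      exact ((h1 i hi').top _).2 fun k hk => (hlt i hi k (by omega)).le
    · exact hS1.r13.le.trans (Nat.zero_le _)
  · intro s hs a
    rw [f1.2.1 _ (hnot (by simp) (by simp; omega) (by simp)), hT s hs]
  · rw [f1.1 7 (by simp) (hnot (by simp; omega) (by simp) (by simp))]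
    exact h7
  · intro x
    rw [f1.2.1 3 (hnot (by simp) (by simp; omega) (by simp)), h3]
  · rw [f1.1 13 (by simp) (hnot (by simp; omega) (by simp) (by simp)), hS.r13]
  · have := ranks_time_le ℓ
    omega
  · rw [f1.1 7 (by simp) (hnot (by simp; omega) (by simp) (by simp))] at e2
    refine ⟨e1, fun h => e2.2 (.inl h), fun h => ?_, fun j hj k hk hle hu => ?_⟩
    · rcases e2.1 h with h | ⟨i, hi, j, hj, k, hk, h⟩ | ⟨j, hj, k, hk, h, h'⟩
      · exact .inl h
      · exact .inr ⟨j, hj, k, hk, unlinked_of_far (hcr i) hi h⟩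
      · exact .inr ⟨j, hj, k, hk, (hboxes j k h).1 h'⟩
    · exact e2.2 (.inr (.inr ⟨j, hj, k, hk, hle, (hboxes j k hle).2 hu⟩))

/-- The eight sign vectors: the binary digits of `ρ` are the places of the signs `-1`. -/
def signs (ρ i : ℕ) : ℚ := if ρ / 2 ^ i % 2 = 0 then 1 else -1

theorem exists_signs (p r : ℕ → ℝ) : ∃ ρ < 8, ∀ i < 3, signs ρ i * p i ≤ signs ρ i * r i := by
  have key : ∀ b : ℕ → ℕ, (∀ i, b i < 2) → b 0 + 2 * b 1 + 4 * b 2 < 8 ∧ ∀ i < 3,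
      signs (b 0 + 2 * b 1 + 4 * b 2) i = if b i = 0 then 1 else -1 := by
    intro b hb
    have h0 := hb 0
    have h1 := hb 1
    have h2 := hb 2
    refine ⟨by omega, fun i hi => ?_⟩
    obtain rfl | rfl | rfl : i = 0 ∨ i = 1 ∨ i = 2 := by omega
    all_goals
      rw [signs]
      congr 1
      norm_num
      omega
  classical
  obtain ⟨h1, h2⟩ := key (fun i => if p i ≤ r i then 0 else 1) fun i => by split_ifs <;> simp
  refine ⟨_, h1, fun i hi => ?_⟩
  rw [h2 i hi]
  by_cases h : p i ≤ r i
  · simp [h]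
  · simp [h, (not_le.1 h).le]

/-- Searches the first `n` of the eight orthants. Tries are never cleared: every search uses nine
integer arrays of its own. -/
def orthants (aP aQ aR : ℕ) : ℕ → Cmd
  | 0 => .skip
  | n + 1 => .seq (orthants aP aQ aR n) (orthant aP aQ aR (20 + 9 * n) (signs n))

theorem writes_orthants {n : ℕ} {l : Loc} (h : (orthants aP aQ aR n).writes l) :
    (∃ r, (r = 7 ∨ 10 ≤ r ∧ r < 13 ∨ 20 ≤ r) ∧ l = .reg r) ∨
      (∃ k, k ≠ 3 ∧ k < 20 + 9 * n ∧ l = .int k) ∨ l = .real 20 := by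
  induction n with
  | zero => exact absurd h (writes_skip l)
  | succ n ih =>
    rcases h with h | h
    · rcases ih h with h | ⟨k, hk, hk', h⟩ | h
      · exact .inl h
      · exact .inr (.inl ⟨k, by omega, by omega, h⟩)
      · exact .inr (.inr h)
    · rcases writes_orthant h with h | ⟨k, hk, h⟩ | h
      · exact .inl h
      · exact .inr (.inl ⟨k, by omega, by omega, h⟩)
      · exact .inr (.inr h)

theorem orthants_runs {n : ℕ} (hS : Setup W ℓ nP nQ nR σ)
    (hP : aP < 17) (hQ : aQ < 17) (hR : aR < 17) (h0 : ∀ k x, σ.int k x = 0)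
    (h7 : σ.reg 7 = 0) :
    Runs W (orthants aP aQ aR n) σ (n * (3000 * (2 ^ ℓ * (60 * (ℓ + 6)) ^ 11)) + 1) fun σ' =>
      σ'.reg 7 ≤ 1 ∧
      (σ'.reg 7 = 1 → ∃ j < nP, ∃ k < nR, Unlinked nQ (fun i => σ.real (aP + i))
        (fun i => σ.real (aQ + i)) (fun i => σ.real (aR + i)) j k) ∧
      ∀ ρ < n, ∀ j < nP, ∀ k < nR,
        (∀ i < 3, signs ρ i * σ.real (aP + i) j ≤ signs ρ i * σ.real (aR + i) k) →
        Unlinked nQ (fun i => σ.real (aP + i)) (fun i => σ.real (aQ + i))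
          (fun i => σ.real (aR + i)) j k → σ'.reg 7 = 1 := by
  induction n with
  | zero => exact Runs.mono (Runs.skip (by simp [h7])) (by omega) fun _ h => h
  | succ n ih =>
    refine Runs.mono (Runs.seq (T₂ := 3000 * (2 ^ ℓ * (60 * (ℓ + 6)) ^ 11)) ih
      fun σ₁ ⟨h1, h2, h3⟩ f1 => ?_) (by rw [add_one_mul]; omega)
      fun _ h => h
    have hnot : ∀ {l}, (∀ r, (r = 7 ∨ 10 ≤ r ∧ r < 13 ∨ 20 ≤ r) → l ≠ .reg r) →
        (∀ k, k ≠ 3 → k < 20 + 9 * n → l ≠ .int k) → l ≠ .real 20 →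
        ¬ (orthants aP aQ aR n).writes l := by
      intro l h1 h2 h3 hw
      rcases writes_orthants hw with ⟨r, hr, h⟩ | ⟨k, hk, hk', h⟩ | h
      · exact h1 r (by omega) h
      · exact h2 k hk hk' h
      · exact h3 h
    have hreal : ∀ k < 20, σ₁.real k = σ.real k := fun k hk =>
      f1.2.2 k (hnot (by simp) (by simp) (by simp; omega))
    refine Runs.mono (orthant_runs (aP := aP) (aQ := aQ) (aR := aR) (kT := 20 + 9 * n)
      (c := signs n) (hS.congr fun r hr =>
        f1.1 r (by omega) (hnot (by rintro r' hr' ⟨⟩; omega) (by simp) (by simp))) hP hQ hR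
      (fun i => by rw [signs]; split_ifs <;> simp) ?_ (by omega) ?_ h1) le_rfl
      fun σ' ⟨e1, e2, e3, e4⟩ => ?_
    · intro x
      rw [f1.2.1 3 (hnot (by simp) (by simp; omega) (by simp)), h0]
    · intro s _ a
      rw [f1.2.1 _ (hnot (by simp) (by simp; omega) (by simp)), h0]
    · have hu : ∀ j k, (Unlinked nQ (fun i => σ₁.real (aP + i)) (fun i => σ₁.real (aQ + i))
          (fun i => σ₁.real (aR + i)) j k ↔ Unlinked nQ (fun i => σ.real (aP + i))
          (fun i => σ.real (aQ + i)) (fun i => σ.real (aR + i)) j k) := fun j k =>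
        not_congr (exists_congr fun l => and_congr_right fun _ => forall₂_congr fun i hi => by
          beta_reduce
          rw [hreal _ (by omega), hreal _ (by omega), hreal _ (by omega)])
      simp only [hu] at e3 e4
      refine ⟨e1, fun h => (e3 h).elim h2 id, fun ρ hρ j hj k hk hle hun => ?_⟩
      rcases Nat.lt_succ_iff_lt_or_eq.1 hρ with hρ | rfl
      · exact e2 (h3 ρ hρ j hj k hk hle hun)
      · refine e4 j hj k hk (fun i hi => ?_) hun
        rw [hreal _ (by omega), hreal _ (by omega)]
        exact hle i hi

end

/-! ### The program -/

/-- Prepares the registers. Registers `3` and `4` hold `2 ^ ℓ` and `ℓ + 5`, where `2 ^ ℓ` is doubled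
while register `20` counts up to the number of points. -/
def prepare : Cmd :=
  .seq (assign 8 (.reg 0 + .reg 1 + .reg 2)) (.seq (assign 3 (.const 1))
    (.seq (assign 4 (.const 5)) (.seq
      (forLoop 20 8 (.seq (assign 4 (.reg 4 + (.const 1 - (.reg 3 - .reg 20))))
        (assign 3 (.reg 3 * (.const 1 + (.const 1 - (.reg 3 - .reg 20)))))))
      (.seq (assign 5 (.const 8 * .reg 3)) (.seq (assign 9 (.reg 4 - .const 2))
        (assign 6 (.reg 9 * .reg 5)))))))

theorem writes_prepare {l : Loc} (h : prepare.writes l) : ∃ r, l = .reg r := by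
  simp only [prepare, writes_seq, writes_assign, writes_forLoop] at h
  rcases h with h | h | h | ((h | h | h) | h | h | h) <;> exact ⟨_, h.1⟩

theorem prepare_runs {W nP nQ nR n : ℕ} {σ : Mem} (hn : nP + nQ + nR = n) (h0 : σ.reg 0 = nP)
    (h1 : σ.reg 1 = nQ) (h2 : σ.reg 2 = nR) (h7 : σ.reg 7 = 0) (h13 : σ.reg 13 = 0)
    (hW : (64 * (n + 1)) ^ 12 ≤ W) :
    Runs W prepare σ (50 * n + 100) fun σ' => σ'.reg 7 = 0 ∧
      ∃ ℓ, 2 ^ ℓ ≤ 2 * n + 1 ∧ Setup W ℓ nP nQ nR σ' := by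
  have hW' : 64 * (n + 1) ≤ W := (Nat.le_self_pow (by simp) _).trans hW
  refine Runs.mono (Runs.assign_seq ?_ (Runs.assign_seq ?_ (Runs.assign_seq ?_ (Runs.seq
    (Runs.forLoop (T := 26) (fun m σ' => ∃ ℓ, σ'.reg 4 = ℓ + 5 ∧ σ'.reg 3 = 2 ^ ℓ ∧ m ≤ 2 ^ ℓ ∧
      2 ^ ℓ ≤ 2 * m + 1) (by simp) (by simp) (by simp) (by simp) (by simp) ?_ ?_ ?_
      fun _ _ h => h) (T₂ := 20) fun σ₁ h f => ?_)))) ?_ fun _ h => h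
  · simp [h0, h1, h2]
    omega
  · simp
    omega
  · simp
    omega
  · simp [h0, h1, h2]
    omega
  · exact ⟨0, by simp, by simp, by simp, by simp⟩
  · intro m hm σ' hf hr ⟨ℓ, i4, i3, i1, i2⟩
    simp [h0, h1, h2] at hm
    have hℓ : ℓ < 2 ^ ℓ := Nat.lt_two_pow_self
    refine Runs.mono (Runs.assign_seq ?_ (Runs.assign ?_ ?_)) (by simp) fun _ h => h
    · simp [i3, i4, hr]
      omega
    -- register `3` is doubled exactly if it equals `m`
    · simp [i3, hr]
      rcases Nat.eq_or_lt_of_le i1 with he | hlt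
      · rw [show 2 ^ ℓ - m = 0 by omega]
        omega
      · rw [show 1 - (2 ^ ℓ - m) = 0 by omega]
        omega
    · rcases Nat.eq_or_lt_of_le i1 with he | hlt
      · refine ⟨ℓ + 1, ?_⟩
        simp [i3, i4, hr, show 2 ^ ℓ - m = 0 by omega, pow_succ]
        omega
      · refine ⟨ℓ, ?_⟩
        simp [i3, i4, hr, show 1 - (2 ^ ℓ - m) = 0 by omega]
        omega
  · obtain ⟨ℓ, i4, i3, i1, i2⟩ := h
    simp [h0, h1, h2, hn] at i1 i2
    have hℓ : ℓ < 2 ^ ℓ := Nat.lt_two_pow_self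
    have hfr : ∀ r, r ≠ 20 → r ≠ 4 → r ≠ 3 → r ≠ 8 → r < 200 → σ₁.reg r = σ.reg r := by
      intro r e1 e2 e3 e4 e5
      rw [f.1 r e5 (by simp [e1, e2, e3])]
      simp [e2, e3, e4]
    have hbig : (ℓ + 3) * (8 * 2 ^ ℓ) ≤ W := by
      refine le_trans ?_ hW
      calc (ℓ + 3) * (8 * 2 ^ ℓ) ≤ (64 * (n + 1)) * (64 * (n + 1)) :=
            Nat.mul_le_mul (by omega) (by omega)
        _ = (64 * (n + 1)) ^ 2 := (sq _).symm
        _ ≤ _ := Nat.pow_le_pow_right (by omega) (by omega)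
    refine Runs.mono (Runs.assign_seq ?_ (Runs.assign_seq ?_ (Runs.assign ?_ ?_))) (by simp)
      fun _ h => h
    · simp [i3]
      omega
    · simp [i4]
      omega
    · simp [i3, i4]
      omega
    · refine ⟨?_, ℓ, i2, ?_⟩
      · simp [hfr, h7]
      · constructor
        any_goals simp [hfr, h0, h1, h2, h13, i3, i4]
        any_goals omega
        exact (Nat.pow_le_pow_left (by omega) 12).trans hW
  · simp [h0, h1, h2]
    omega

/-- The whole program: register `0` receives `1` if all pairs are linked, and `0` otherwise. -/
def solve (aP aQ aR : ℕ) : Cmd :=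
  .seq prepare (.seq (orthants aP aQ aR 8) (assign 0 (.const 1 - .reg 7)))

/-- The number of steps of `solve` for at most `3 * m` points. -/
def timeBound (m : ℕ) : ℕ := 30000 * ((6 * m + 1) * (60 * (Nat.log 2 (6 * m + 1) + 6)) ^ 11)

theorem solve_runs {W nP nQ nR aP aQ aR m : ℕ} {σ : Mem} (hP : aP < 17) (hQ : aQ < 17)
    (hR : aR < 17) (hm : nP + nQ + nR ≤ 3 * m) (h0 : σ.reg 0 = nP) (h1 : σ.reg 1 = nQ)
    (h2 : σ.reg 2 = nR) (h7 : σ.reg 7 = 0) (h13 : σ.reg 13 = 0) (hint : ∀ k x, σ.int k x = 0)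
    (hW : (64 * (3 * m + 1)) ^ 12 ≤ W) :
    Runs W (solve aP aQ aR) σ (timeBound m) fun σ' =>
      σ'.reg 0 ≤ 1 ∧ (σ'.reg 0 = 0 ↔ ∃ j < nP, ∃ k < nR,
        Unlinked nQ (fun i => σ.real (aP + i)) (fun i => σ.real (aQ + i))
          (fun i => σ.real (aR + i)) j k) := by
  obtain ⟨T, hT⟩ : ∃ T, T = (6 * m + 1) * (60 * (Nat.log 2 (6 * m + 1) + 6)) ^ 11 := ⟨_, rfl⟩
  have hT1 : 1000 * (6 * m + 1) ≤ T := by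
    rw [hT, mul_comm]
    refine Nat.mul_le_mul_left _ ?_
    calc 1000 ≤ 60 ^ 2 := by simp
      _ ≤ 60 ^ 11 := Nat.pow_le_pow_right (by simp) (by simp)
      _ ≤ _ := Nat.pow_le_pow_left (by omega) 11
  refine Runs.mono (Runs.seq (prepare_runs rfl h0 h1 h2 h7 h13 ((Nat.pow_le_pow_left
    (by omega) 12).trans hW)) (T₂ := 24000 * T + 10) fun σ₁ ⟨g7, ℓ, hℓ, hS⟩ f1 => ?_) ?_
    fun _ h => h
  · have hreal : ∀ k, σ₁.real k = σ.real k := fun k => f1.2.2 k fun hw => by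
      obtain ⟨r, h⟩ := writes_prepare hw
      cases h
    have hint1 : ∀ k x, σ₁.int k x = 0 := fun k x => by
      rw [f1.2.1 k fun hw => (writes_prepare hw).elim (fun _ h => by cases h), hint]
    refine Runs.mono (Runs.seq (orthants_runs (n := 8) hS hP hQ hR hint1 g7) (T₂ := 4)
      fun σ₂ ⟨e1, e2, e3⟩ f2 => ?_) ?_ fun _ h => h
    · simp only [hreal] at e2 e3
      have hW1 : 1 ≤ W := le_trans (Nat.one_le_pow _ _ (by omega)) hW
      refine Runs.mono (Runs.assign ?_ ?_) (by simp) fun _ h => h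
      · simp
        omega
      · simp only [IExp.eval_sub, IExp.eval_const, IExp.eval_reg, Mem.set_reg, if_true]
        refine ⟨by omega, fun h => e2 (by omega), ?_⟩
        rintro ⟨j, hj, k, hk, h⟩
        obtain ⟨ρ, hρ, h'⟩ := exists_signs (fun i => σ.real (aP + i) j)
          (fun i => σ.real (aR + i) k)
        have := e3 ρ hρ j hj k hk h' h
        omega
    · have : 2 ^ ℓ * (60 * (ℓ + 6)) ^ 11 ≤ T := by
        rw [hT]
        have hl : ℓ ≤ Nat.log 2 (6 * m + 1) := Nat.le_log_of_pow_le (by simp) (by omega)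
        exact Nat.mul_le_mul (by omega) (Nat.pow_le_pow_left (by omega) 11)
      omega
  · rw [timeBound, ← hT]
    omega

/-- The time is near-linear because `log₂ (6 * m + 1) + 6 ≤ 18 * log (m + 2)`. -/
theorem timeBound_le (m : ℕ) :
    (timeBound m : ℝ) ≤ 180000 * 1080 ^ 11 * ((m : ℝ) + 1) * Real.log ((m : ℝ) + 2) ^ 11 := by
  have hm : (0 : ℝ) ≤ m := Nat.cast_nonneg m
  have hlog2 := Real.log_two_gt_d9
  have hL : Real.log 2 ≤ Real.log ((m : ℝ) + 2) := Real.log_le_log (by simp) (by linarith)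
  have h1 : (Nat.log 2 (6 * m + 1) : ℝ) * Real.log 2 ≤ 3 * Real.log ((m : ℝ) + 2) := by
    have e1 : ((2 ^ Nat.log 2 (6 * m + 1) : ℕ) : ℝ) ≤ ((6 * m + 1 : ℕ) : ℝ) :=
      Nat.cast_le.2 (Nat.pow_log_le_self 2 (by omega))
    have e2 := Real.log_le_log (by positivity) e1
    push_cast at e2
    rw [Real.log_pow] at e2
    refine e2.trans ?_
    -- `6 * m + 1 ≤ (m + 2) ^ 3`
    rw [show (3 : ℝ) * Real.log ((m : ℝ) + 2) = Real.log (((m : ℝ) + 2) ^ 3) by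
      rw [Real.log_pow]; norm_num]
    exact Real.log_le_log (by positivity) (by nlinarith [mul_nonneg hm hm, mul_nonneg (mul_nonneg hm hm) hm])
  have h2 : (Nat.log 2 (6 * m + 1) : ℝ) + 6 ≤ 18 * Real.log ((m : ℝ) + 2) := by
    have h3 : (0 : ℝ) ≤ Nat.log 2 (6 * m + 1) := Nat.cast_nonneg _
    nlinarith
  rw [timeBound]
  push_cast
  have h4 : (60 * ((Nat.log 2 (6 * m + 1) : ℝ) + 6)) ^ 11 ≤
      (1080 * Real.log ((m : ℝ) + 2)) ^ 11 :=
    pow_le_pow_left₀ (by positivity) (by linarith) 11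
  calc _ ≤ 30000 * ((6 * (m : ℝ) + 6) * (1080 * Real.log ((m : ℝ) + 2)) ^ 11) := by
        gcongr
        simp
    _ = _ := by rw [mul_pow]; ring

/-- Twelfth powers of `64 * (3 * m + 1)` are words of `O(log m)` bits. -/
theorem wordBound_le (m : ℕ) : (64 * (3 * m + 1)) ^ 12 ≤ (m + 2) ^ 96 := by
  rw [show 96 = 8 * 12 by rfl, pow_mul]
  refine Nat.pow_le_pow_left ?_ 12
  rw [show 8 = 6 + 2 by rfl, pow_add]
  exact Nat.mul_le_mul ((show 64 = 2 ^ 6 by rfl).le.trans (Nat.pow_le_pow_left (by omega) 6))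
    (by nlinarith)

theorem timeBound_add_le (m : ℕ) : ((timeBound m + 100 : ℕ) : ℝ) ≤
    (180000 + 1) * 1080 ^ 11 * ((m : ℝ) + 1) * Real.log ((m : ℝ) + 2) ^ 11 := by
  have h2 := timeBound_le m
  have h3 : (100 : ℝ) ≤ 1080 ^ 11 * ((m : ℝ) + 1) * Real.log ((m : ℝ) + 2) ^ 11 := by
    have hm : (0 : ℝ) ≤ m := Nat.cast_nonneg _
    have hL : (1 / 2 : ℝ) ≤ Real.log ((m : ℝ) + 2) :=
      le_trans (by linarith [Real.log_two_gt_d9]) (Real.log_le_log two_pos (by linarith))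
    calc (100 : ℝ) ≤ 1080 ^ 11 * 1 * (1 / 2) ^ 11 := by norm_num
      _ ≤ _ := by gcongr; linarith
  rw [Nat.cast_add]
  generalize (timeBound m : ℝ) = T at *
  norm_num at *
  linarith

/-- A program that computes the answer within `timeBound` steps, up to a constant, solves the
decision problem in near-linear time. -/
theorem solvable_of_runs {ι : Type} {size : ι → ℕ} {input : ι → List (List Point3)}
    {yes : ι → Prop} {c : Cmd}
    (h : ∀ x W, (64 * (3 * size x + 1)) ^ 12 ≤ W → Runs W c
      ⟨(inputState (input x)).ireg, (inputState (input x)).imem, (inputState (input x)).rmem⟩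
      (timeBound (size x) + 100) fun σ' => σ'.reg 0 ≤ 1 ∧ (σ'.reg 0 = 0 ↔ ¬ yes x)) :
    SolvableInNearLinearTime size input yes := by
  refine ⟨⟨[], c⟩, 96, 11, (180000 + 1) * 1080 ^ 11, fun x => ?_⟩
  have hW := wordBound_le (size x)
  generalize (size x + 2) ^ 96 = W at *
  obtain ⟨s', t, σ', e1, e2, e3, e4, e5⟩ := h x W hW (inputState (input x))
    ⟨fun _ _ => rfl, rfl, rfl⟩
  clear hW h
  refine ⟨s', t, e1, (Nat.cast_le.2 e2).trans (timeBound_add_le _), fun hy => ?_, fun hy => ?_⟩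
  · rw [e3.1 0 (by simp)]
    exact le_antisymm e4 (Nat.pos_of_ne_zero fun h => e5.1 h hy)
  · rw [e3.1 0 (by simp)]
    exact e5.2 hy

end RealRAM

/-! ### Unit cubes -/

theorem unitCube_inter_nonempty_iff {p q : Point3} :
    (unitCube p ∩ unitCube q).Nonempty ↔ ∀ i, |p i - q i| ≤ 1 := by
  constructor
  · rintro ⟨x, hp, hq⟩ i
    have h1 := abs_le.1 (hp i)
    have h2 := abs_le.1 (hq i)
    rw [abs_le]
    constructor <;> linarith
  · intro h
    refine ⟨fun i => (p i + q i) / 2, fun i => ?_, fun i => ?_⟩ <;>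
    · have := abs_le.1 (h i)
      rw [abs_le]
      constructor <;> linarith

theorem unitCube_inter_self_nonempty (p : Point3) : (unitCube p ∩ unitCube p).Nonempty :=
  unitCube_inter_nonempty_iff.2 fun i => by simp

theorem unitCubeGraph_ediam_le_two_iff (L : List Point3) :
    (unitCubeGraph L).ediam ≤ 2 ↔ ∀ p ∈ L, ∀ r ∈ L, ∃ q ∈ L,
      (unitCube q ∩ unitCube p).Nonempty ∧ (unitCube q ∩ unitCube r).Nonempty := by
  simp only [SimpleGraph.ediam_le_iff, List.forall_mem_iff_get, List.exists_mem_iff_get]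
  refine forall₂_congr fun u v => ?_
  rw [← not_lt, SimpleGraph.two_lt_edist_iff]
  have hcomm : ∀ i j, (unitCube (L.get i) ∩ unitCube (L.get j)).Nonempty →
      (unitCube (L.get j) ∩ unitCube (L.get i)).Nonempty := fun i j h => by rwa [Set.inter_comm]
  constructor
  · intro h
    by_cases huv : u = v
    · exact ⟨u, unitCube_inter_self_nonempty _, huv ▸ unitCube_inter_self_nonempty _⟩
    by_cases hadj : (unitCubeGraph L).Adj u v
    · exact ⟨u, unitCube_inter_self_nonempty _, hadj.2⟩
    -- in the remaining case there is a common neighbour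
    obtain ⟨w, hw1, hw2⟩ := Set.nonempty_iff_ne_empty.2 fun he => h ⟨huv, hadj, he⟩
    exact ⟨w, hcomm _ _ hw1.2, hcomm _ _ hw2.2⟩
  · rintro ⟨w, hw1, hw2⟩ ⟨huv, hadj, he⟩
    by_cases hu : w = u
    · exact hadj ⟨huv, hu ▸ hw2⟩
    by_cases hv : w = v
    · exact hadj ⟨huv, hcomm _ _ (hv ▸ hw1)⟩
    refine Set.eq_empty_iff_forall_notMem.1 he w ⟨?_, ?_⟩
    · exact ⟨Ne.symm hu, hcomm _ _ hw1⟩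
    · exact ⟨Ne.symm hv, hcomm _ _ hw2⟩

namespace RealRAM

/-- Bad pairs of indices are the obstruction to the property of the lists. -/
theorem exists_unlinked_iff {P Q R : List Point3} {p q r : ℕ → ℕ → ℝ}
    (hp : ∀ i < 3, ∀ j, p i j = P.getD j 0 (Fin.ofNat 3 i))
    (hq : ∀ i < 3, ∀ j, q i j = Q.getD j 0 (Fin.ofNat 3 i))
    (hr : ∀ i < 3, ∀ j, r i j = R.getD j 0 (Fin.ofNat 3 i)) :
    (∃ j < P.length, ∃ k < R.length, Unlinked Q.length p q r j k) ↔
      ¬ ∀ p ∈ P, ∀ r ∈ R, ∃ q ∈ Q,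
        (unitCube q ∩ unitCube p).Nonempty ∧ (unitCube q ∩ unitCube r).Nonempty := by
  have hmem : ∀ (L : List Point3) (S : Point3 → Prop),
      (∃ x ∈ L, S x) ↔ ∃ j < L.length, S (L.getD j 0) := by
    intro L S
    constructor
    · rintro ⟨x, hx, h⟩
      obtain ⟨j, hj, rfl⟩ := List.getElem_of_mem hx
      exact ⟨j, hj, by rwa [List.getD_eq_getElem _ _ hj]⟩
    · rintro ⟨j, hj, h⟩
      rw [List.getD_eq_getElem _ _ hj] at h
      exact ⟨_, List.getElem_mem hj, h⟩
  have hfin : ∀ S : Fin 3 → Prop, (∀ i < 3, S (Fin.ofNat 3 i)) ↔ ∀ i, S i := fun S =>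
    ⟨fun h i => by simpa using h i i.2, fun h i _ => h _⟩
  simp only [not_forall, exists_prop, hmem]
  refine exists_congr fun j => and_congr_right fun _ => exists_congr fun k =>
    and_congr_right fun _ => not_congr (exists_congr fun l => and_congr_right fun _ => ?_)
  rw [unitCube_inter_nonempty_iff, unitCube_inter_nonempty_iff, ← forall_and, ← hfin]
  exact forall₂_congr fun i hi => by rw [hp i hi, hq i hi, hr i hi]

theorem inputState_rmem {Ls : List (List Point3)} {m i : ℕ} (hi : i < 3) (j : ℕ) :
    (inputState Ls).rmem (3 * m + i) j = (Ls.getD m []).getD j 0 (Fin.ofNat 3 i) := by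
  have h1 : (3 * m + i) / 3 = m := by omega
  have h2 : Fin.ofNat 3 (3 * m + i) = Fin.ofNat 3 i := by
    ext
    simp [Fin.ofNat]
  simp only [inputState, h1, h2]

end RealRAM

theorem mainTheorem3 :
    RealRAM.SolvableInNearLinearTime
      (fun I : List Point3 × List Point3 × List Point3 =>
        I.1.length + I.2.1.length + I.2.2.length)
      (fun I => [I.1, I.2.1, I.2.2])
      (fun I => ∀ p ∈ I.1, ∀ r ∈ I.2.2, ∃ q ∈ I.2.1,
        (unitCube q ∩ unitCube p).Nonempty ∧ (unitCube q ∩ unitCube r).Nonempty) ∧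
    RealRAM.SolvableInNearLinearTime
      (fun L : List Point3 => L.length)
      (fun L => [L])
      (fun L => (unitCubeGraph L).ediam ≤ 2) := by
  constructor
  · refine RealRAM.solvable_of_runs (c := RealRAM.solve (3 * 0) (3 * 1) (3 * 2)) ?_
    rintro ⟨P, Q, R⟩ W hW
    refine RealRAM.Runs.mono (RealRAM.solve_runs (nP := P.length) (nQ := Q.length)
      (nR := R.length) (by simp) (by simp) (by simp) (by dsimp only; omega) rfl rfl rfl rfl rfl
      (fun _ _ => rfl) hW) (by omega) fun σ' h => ⟨h.1, h.2.trans ?_⟩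
    exact RealRAM.exists_unlinked_iff (fun i hi j => RealRAM.inputState_rmem hi j)
      (fun i hi j => RealRAM.inputState_rmem hi j) (fun i hi j => RealRAM.inputState_rmem hi j)
  · refine RealRAM.solvable_of_runs (c := .seq (RealRAM.assign 1 (.reg 0))
      (.seq (RealRAM.assign 2 (.reg 0)) (RealRAM.solve (3 * 0) (3 * 0) (3 * 0)))) ?_
    intro L W hW
    have hL : L.length ≤ W := le_trans (by omega) ((Nat.le_self_pow (by simp) _).trans hW)
    refine RealRAM.Runs.mono (RealRAM.Runs.assign_seq ?_ (RealRAM.Runs.assign_seq ?_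
      (RealRAM.solve_runs (nP := L.length) (nQ := L.length) (nR := L.length) (by simp)
      (by simp) (by simp) (by omega) rfl rfl rfl rfl rfl (fun _ _ => rfl) hW))) ?_
      fun σ' h => ⟨h.1, h.2.trans ?_⟩
    · exact ⟨by simp, hL⟩
    · exact ⟨by simp, hL⟩
    · simp
      omega
    · rw [unitCubeGraph_ediam_le_two_iff]
      exact RealRAM.exists_unlinked_iff (fun i hi j => RealRAM.inputState_rmem hi j)
        (fun i hi j => RealRAM.inputState_rmem hi j) (fun i hi j => RealRAM.inputState_rmem hi j)
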